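/- Fix an integer $d \ge 2$ and a probability distribution on $[0,\infty)$ with a density, with cumulative distribution function $F(x)=\mathbb{P}[W\le x]$ and quantile function $F^{-1}(p)=\inf\{x\ge 0 : p\le F(x)\}$. Let $c>0$ and $\theta_n = cn/\log n$. The geographical threshold graph (GTG) $G=G_n$ on the $d$-dimensional toric unit cube has $n$ nodes placed independently and uniformly at random on $[0,1]^d$ with opposite faces identified; each node $i$ receives an independent random weight $w_i$ with the above distribution, independent of the positions, and distinct nodes $i,j$ are adjacent if and only if $(w_i+w_j)/r_{ij}^d \ge \theta_n$, where $r_{ij}$ is the Euclidean distance on the torus. For a graph $G$ with edge set $E$, let $P$ be the transition matrix of the simple random walk on $G$, let $\pi_j=\deg(j)/(2|E|)$, and let $\Delta_i(t)=\frac12\sum_j |P^t(i,j)-\pi_j|$. The mixing time is $\tau(\delta)=\max_i \min\{t : \Delta_i(t')\le\delta \text{ for all } t'\ge t\}$ (infinite if no such $t$ exists for some $i$). Suppose that for some $\nu>0$ we have $\mathbb{P}[W\ge x]=O(1/x^{d+\nu})$ as $x\to\infty$, and that $$c \le \frac{1}{d+3}\min\Big\{\sup_{\alpha\in(0,1/2]}\alpha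 F^{-1}(\alpha),\ \sup_{\alpha\in(1/2,1)}(1-\alpha)F^{-1}(\alpha)\Big\}.$$ Then with probability $1-o(1)$ as $n\to\infty$, if $G$ is connected then $\tau(1/n)=O\big(n^{2/d}(\log n)^{(d-2)/d}\big)$. That is, there is a constant $K$, independent of $n$ (it may depend on $d$, $c$ and the weight distribution), such that $$\mathbb{P}\big[G_n \text{ is connected and } \tau(1/n) > K n^{2/d}(\log n)^{(d-2)/d}\big]\to 0 .$$ -/

import Mathlib

open MeasureTheory ProbabilityTheory Filter Topology
open scoped ENNReal

/-! ### Simple random walk on a finite graph and its mixing time -/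

namespace SimpleGraph

open Classical in
/-- One-step transition matrix of the simple random walk on a finite graph. -/
noncomputable def walkMatrix {V : Type*} [Fintype V] (G : SimpleGraph V) : Matrix V V ℝ :=
  fun i j => if G.Adj i j then 1 / (G.degree i : ℝ) else 0

open Classical in
/-- The distribution `π k = deg k / (2 |E|)`. -/
noncomputable def walkStationary {V : Type*} [Fintype V] (G : SimpleGraph V) (k : V) : ℝ :=
  (G.degree k : ℝ) / (2 * (G.edgeFinset.card : ℝ))

/-- Variational distance `Δ_i(t) = (1/2) ∑ j, |P^t(i,j) - π j|`. -/
noncomputable def walkDist {V : Type*} [Fintype V] [DecidableEq V] (G : SimpleGraph V)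
    (i : V) (t : ℕ) : ℝ :=
  (1 / 2) * ∑ j, |(G.walkMatrix ^ t) i j - G.walkStationary j|

/-- Mixing time from `i`: the least `t` with `Δ_i(t') ≤ δ` for all `t' ≥ t`
(`⊤` if there is no such `t`). -/
noncomputable def mixingTimeFrom {V : Type*} [Fintype V] [DecidableEq V] (G : SimpleGraph V) (δ : ℝ)
    (i : V) : ℕ∞ :=
  ⨅ t ∈ {t : ℕ | ∀ t' ≥ t, G.walkDist i t' ≤ δ}, (t : ℕ∞)

/-- Mixing time of `G`: the maximum over the starting vertices. -/
noncomputable def mixingTime {V : Type*} [Fintype V] [DecidableEq V] (G : SimpleGraph V)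
    (δ : ℝ) : ℕ∞ :=
  ⨆ i, G.mixingTimeFrom δ i

end SimpleGraph

/-! ### Geographical threshold graphs -/

namespace GTG

/-- Euclidean distance on the `d`-dimensional toric unit cube `(ℝ/ℤ)^d`; the norm on `ℝ/ℤ` is the
distance to the nearest integer. -/
noncomputable def toricDist {d : ℕ} (x y : UnitAddTorus (Fin d)) : ℝ :=
  Real.sqrt (∑ i, ‖x i - y i‖ ^ 2)

/-- A configuration of `n` nodes: each node has a position on the torus and a weight. -/
abbrev Config (d n : ℕ) : Type := Fin n → UnitAddTorus (Fin d) × ℝ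

/-- The geographical threshold graph of a configuration with threshold `θ`: distinct nodes `i, j`
are adjacent when `(w_i + w_j) / r_ij ^ d ≥ θ`, written without division so that nodes at distance
zero cause no trouble. -/
noncomputable def graph {d n : ℕ} (θ : ℝ) (ω : Config d n) : SimpleGraph (Fin n) where
  Adj i j := i ≠ j ∧ θ * toricDist (ω i).1 (ω j).1 ^ d ≤ (ω i).2 + (ω j).2
  symm := ⟨fun i j h => ⟨h.1.symm, by
    have hd : toricDist (ω j).1 (ω i).1 = toricDist (ω i).1 (ω j).1 := by
      unfold toricDist
      simp only [norm_sub_rev]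
    rw [hd, add_comm]
    exact h.2⟩⟩
  loopless := ⟨fun _ h => h.1 rfl⟩

/-- The law of the model: `n` independent nodes, each with a uniform position on the torus and an
independent weight of law `ρ`. -/
noncomputable def law (d : ℕ) (ρ : Measure ℝ) (n : ℕ) : Measure (Config d n) :=
  Measure.pi fun _ => (volume : Measure (UnitAddTorus (Fin d))).prod ρ

/-- Quantile function `F⁻¹(p) = inf {x ≥ 0 : p ≤ F(x)}` of the weight law. -/
noncomputable def quantile (ρ : Measure ℝ) (p : ℝ) : ℝ :=
  sInf {x : ℝ | 0 ≤ x ∧ p ≤ cdf ρ x}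

/-- A sequence of events holds with high probability: the probability of failure is `o(1)`. -/
def Whp {d : ℕ} (ρ : Measure ℝ) (A : (n : ℕ) → Set (Config d n)) : Prop :=
  Tendsto (fun n => law d ρ n (A n)ᶜ) atTop (𝓝 0)

end GTG

/-! For a reversible chain, a Poincaré inequality with constant `A` at each end of the spectrum
(against `energy` for functions of mean zero, against `signlessEnergy` for all functions) confines
the nontrivial eigenvalues to `[-l, l]` with `l = 1 - 1 / (2 * A)`, and then `4 * A * log n` steps
suffice for distance `1 / n`. The theorem therefore reduces to `A = O(M ^ 2)` with `M ^ d` of order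
`n / log n`: the product `M ^ 2 * log n` is the claimed order.

The torus is discretised by a lattice of mesh `1 / M`. Fix `m₀ > 0` such that weights at least `m₀`
have positive probability; `M` is scaled so that a node of weight at least `m₀` sees everything
within two meshes. The heavy nodes near a lattice point then form a clique, the cluster, completely
joined to the neighbouring clusters and of expected size of order `log n`. One cluster is too small
with a probability that is only some power of `1 / n`, but `k₀ + 1` small clusters in one bounded
box have probability `O(n ^ (-2))` for a suitable constant `k₀`. Hence, with high probability, every
such box contains at most `k₀` unpopulated points. In dimension at least two such a box has full
slabs in every direction; their crossing point is connected to the crossing point of the adjacent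
box (`Grid.reachable_translate`) and to all but `k₀ ^ 2` points of its own box
(`Grid.card_not_reachable_le`). The Poincaré inequality of the discrete torus, with its factor `M ^
2`, thus passes to the means over crossing clusters.

Connectivity of the graph ties the remaining nodes to the clusters (`Regular.exists_reachable`). A
node linked to no core cluster is light, so a long edge at it is due to the weight of the other end,
which then also covers core clusters along the geodesic. Unattached components are therefore trapped
within a bounded number of meshes, and every node reaches its crossing cluster through `O(log n)`
local nodes and at most one distant node. This costs a factor `(log n) ^ 3`, which is at most `M ^
2`.

Degrees may be large, but each edge can be charged to its lighter endpoint, and the finite mean of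
the weights leaves only `O(log n)` heavier neighbours per node. At the lower end of the spectrum,
`|f|` replaces `f` and cliques of size at least four control the means of `f ^ 2`. -/

/-! ### Mixing of reversible chains from quadratic form bounds -/

namespace ReversibleChain

variable {V : Type*} [Fintype V]

/-- Polarisation: a symmetric form `B` dominated by `l` times the square norm given by the positive
weights `D` on a subspace satisfies the corresponding operator bound. -/
theorem sq_norm_le_of_form_bound (w : V → V → ℝ) (hw : ∀ x y, w x y = w y x) (D : V → ℝ)
    (hwD : ∀ x, ∑ y, w x y = D x) (l : ℝ) (hl : 0 < l)
    (hform : ∀ f : V → ℝ, ∑ x, D x * f x = 0 →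
      |∑ x, ∑ y, w x y * f x * f y| ≤ l * ∑ x, D x * f x ^ 2)
    (f : V → ℝ) (hf : ∑ x, D x * f x = 0) (g : V → ℝ)
    (hg : ∀ x, D x * g x = ∑ y, w x y * f y) :
    ∑ x, D x * g x = 0 ∧ ∑ x, D x * g x ^ 2 ≤ l ^ 2 * ∑ x, D x * f x ^ 2 := by
  have hg0 : ∑ x, D x * g x = 0 := by
    simp_rw [hg]
    rw [Finset.sum_comm, ← hf]
    refine Finset.sum_congr rfl fun y _ => ?_
    rw [← Finset.sum_mul, ← hwD y]
    simp_rw [hw y]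
  refine ⟨hg0, ?_⟩
  set a := ∑ x, D x * f x ^ 2
  set b := ∑ x, D x * g x ^ 2
  set e := ∑ x, D x * (f x * g x) with he
  have hB : ∀ t : ℝ, ∑ x, ∑ y, w x y * (f x + t * g x) * (f y + t * g y)
      = ∑ x, ∑ y, w x y * f x * f y + 2 * t * b
        + t ^ 2 * ∑ x, ∑ y, w x y * g x * g y := by
    intro t
    have h1 : ∑ x, ∑ y, w x y * g x * f y = b := by
      refine Finset.sum_congr rfl fun x _ => ?_
      have : ∑ y, w x y * g x * f y = g x * ∑ y, w x y * f y := by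
        rw [Finset.mul_sum]; exact Finset.sum_congr rfl fun y _ => by ring
      rw [this, ← hg]; ring
    have h2 : ∑ x, ∑ y, w x y * f x * g y = b := by
      rw [Finset.sum_comm, ← h1]
      refine Finset.sum_congr rfl fun x _ => Finset.sum_congr rfl fun y _ => ?_
      rw [hw]; ring
    have : ∑ x, ∑ y, w x y * (f x + t * g x) * (f y + t * g y)
        = ∑ x, ∑ y, w x y * f x * f y + t * ∑ x, ∑ y, w x y * f x * g y
          + t * ∑ x, ∑ y, w x y * g x * f y + t ^ 2 * ∑ x, ∑ y, w x y * g x * g y := by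
      simp_rw [Finset.mul_sum, ← Finset.sum_add_distrib]
      exact Finset.sum_congr rfl fun x _ => Finset.sum_congr rfl fun y _ => by ring
    rw [this, h1, h2]; ring
  have hN : ∀ t : ℝ, ∑ x, D x * (f x + t * g x) ^ 2 = a + 2 * t * e + t ^ 2 * b := by
    intro t
    simp only [a, b, e, Finset.mul_sum, ← Finset.sum_add_distrib]
    exact Finset.sum_congr rfl fun x _ => by ring
  have hz : ∀ t : ℝ, ∑ x, D x * (f x + t * g x) = 0 := by
    intro t
    have : ∑ x, D x * (f x + t * g x) = ∑ x, D x * f x + t * ∑ x, D x * g x := by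
      rw [Finset.mul_sum, ← Finset.sum_add_distrib]
      exact Finset.sum_congr rfl fun x _ => by ring
    rw [this, hf, hg0]; ring
  -- Subtract the form bounds at `f + t g` and `f - t g`: the diagonal terms of the form cancel on
  -- the left, the cross terms `e` on the right. The choice `t = l⁻¹` below balances the two sides.
  have key : ∀ t : ℝ, 4 * t * b ≤ 2 * l * (a + t ^ 2 * b) := by
    intro t
    have h1 := (abs_le.1 (hform _ (hz t))).2
    have h2 := (abs_le.1 (hform _ (hz (-t)))).1
    rw [hB, hN] at h1 h2
    nlinarith
  have h3 := key l⁻¹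
  have h4 : l * (4 * l⁻¹ * b) ≤ l * (2 * l * (a + l⁻¹ ^ 2 * b)) :=
    mul_le_mul_of_nonneg_left h3 hl.le
  have h5 : l * (4 * l⁻¹ * b) = 4 * b := by field_simp
  have h6 : l * (2 * l * (a + l⁻¹ ^ 2 * b)) = 2 * l ^ 2 * a + 2 * b := by field_simp
  linarith

/-- Total variation convergence of a reversible chain whose quadratic form is dominated. -/
theorem sum_abs_pow_sub_le [DecidableEq V] (w : V → V → ℝ) (hw : ∀ x y, w x y = w y x) (D : V → ℝ)
    (hD : ∀ x, 1 ≤ D x) (hwD : ∀ x, ∑ y, w x y = D x) (l : ℝ) (hl : 0 < l)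
    (hform : ∀ f : V → ℝ, ∑ x, D x * f x = 0 →
      |∑ x, ∑ y, w x y * f x * f y| ≤ l * ∑ x, D x * f x ^ 2)
    (P : Matrix V V ℝ) (hP : ∀ x y, P x y = w x y / D x) (i : V) (t : ℕ) :
    ∑ j, |(P ^ t) i j - D j / ∑ x, D x| ≤ √(∑ x, D x) * l ^ t := by
  have hD0 : ∀ x, 0 < D x := fun x => one_pos.trans_le (hD x)
  set S := ∑ x, D x with hS
  have hSpos : 0 < S := Finset.sum_pos (fun x _ => hD0 x) ⟨i, Finset.mem_univ i⟩
  have hPrev : ∀ t x y, D x * (P ^ t) x y = D y * (P ^ t) y x := by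
    intro t
    induction t with
    | zero =>
      intro x y
      by_cases h : x = y
      · subst h; rfl
      · simp [h, Ne.symm h]
    | succ k ih =>
      intro x y
      rw [pow_succ, Matrix.mul_apply, ← pow_succ, pow_succ', Matrix.mul_apply, Finset.mul_sum,
        Finset.mul_sum]
      refine Finset.sum_congr rfl fun z _ => ?_
      rw [← mul_assoc, ih x z, hP, hP, hw y z]
      have := (hD0 z).ne'
      have := (hD0 y).ne'
      field_simp
  -- The centred density of the point mass at `i` with respect to `D`. By reversibility `P ^ t φ` is
  -- the density of the signed measure whose total variation is sought, and `D i ≥ 1` makes the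
  -- initial norm at most one.
  set φ : V → ℝ := fun x => (if x = i then 1 / D i else 0) - 1 / S with hφ
  have hφ0 : ∑ x, D x * φ x = 0 := by
    simp only [hφ, mul_sub, Finset.sum_sub_distrib, mul_ite, mul_zero, Finset.sum_ite_eq',
      Finset.mem_univ, if_true, ← Finset.sum_mul, ← hS]
    rw [mul_one_div_cancel (hD0 i).ne', mul_one_div_cancel hSpos.ne', sub_self]
  have hφ2 : ∑ x, D x * φ x ^ 2 ≤ 1 := by
    have h1 : ∑ x, D x * φ x ^ 2 = 1 / D i - 1 / S := by
      have : ∀ x, D x * φ x ^ 2 = (if x = i then 1 / D i - 2 / S else 0) + D x * (1 / S ^ 2) := by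
        intro x
        by_cases h : x = i
        · subst h
          simp only [hφ, if_true]
          have := (hD0 x).ne'
          field_simp
          ring
        · simp only [hφ, h, if_false]; ring
      simp_rw [this]
      rw [Finset.sum_add_distrib, Finset.sum_ite_eq' , ← Finset.sum_mul, ← hS]
      simp only [Finset.mem_univ, if_true]
      field_simp
      ring
    have h2 : 1 / D i ≤ 1 := by rw [div_le_one (hD0 i)]; exact hD i
    have h3 : 0 < 1 / S := by positivity
    linarith
  set F : ℕ → V → ℝ := fun t => (P ^ t).mulVec φ with hF
  have hFsucc : ∀ t x, D x * F (t + 1) x = ∑ y, w x y * F t y := by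
    intro t x
    simp only [hF]
    rw [pow_succ', ← Matrix.mulVec_mulVec]
    simp only [Matrix.mulVec, dotProduct] at *
    rw [Finset.mul_sum]
    refine Finset.sum_congr rfl fun y _ => ?_
    rw [hP, ← mul_assoc, mul_div_cancel₀ _ (hD0 x).ne']
  have hind : ∀ t, ∑ x, D x * F t x = 0 ∧ ∑ x, D x * F t x ^ 2 ≤ (l ^ t) ^ 2 := by
    intro t
    induction t with
    | zero => simpa [hF] using ⟨hφ0, hφ2⟩
    | succ k ih =>
      obtain ⟨h1, h2⟩ := sq_norm_le_of_form_bound w hw D hwD l hl hform (F k) ih.1 (F (k+1))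
        (hFsucc k)
      refine ⟨h1, h2.trans ?_⟩
      rw [pow_succ l k, mul_pow, mul_comm]
      exact mul_le_mul_of_nonneg_right ih.2 (sq_nonneg l)
  have hP1 : ∀ t x, ∑ y, (P ^ t) x y = 1 := by
    intro t
    induction t with
    | zero => intro x; simp [Matrix.one_apply]
    | succ k ih =>
      intro x
      simp_rw [pow_succ, Matrix.mul_apply]
      rw [Finset.sum_comm]
      simp_rw [← Finset.mul_sum, hP, ← Finset.sum_div, hwD, div_self (hD0 _).ne', mul_one]
      exact ih x
  have hent : ∀ j, (P ^ t) i j - D j / S = D j * F t j := by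
    intro j
    simp only [hF, Matrix.mulVec, dotProduct, hφ, mul_sub, Finset.sum_sub_distrib, mul_ite, mul_zero,
      Finset.sum_ite_eq', Finset.mem_univ, if_true, ← Finset.sum_mul, hP1]
    rw [← mul_assoc, ← hPrev t i j]
    have := (hD0 i).ne'
    field_simp
  simp_rw [hent, abs_mul, abs_of_pos (hD0 _)]
  have hcs : (∑ j, D j * |F t j|) ^ 2 ≤ S * ∑ x, D x * F t x ^ 2 := by
    have := Finset.sum_mul_sq_le_sq_mul_sq Finset.univ (fun j => √(D j)) (fun j => √(D j) * |F t j|)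
    simp only [mul_pow, Real.sq_sqrt (hD0 _).le, sq_abs] at this
    refine le_trans (le_of_eq ?_) this
    congr 1
    refine Finset.sum_congr rfl fun j _ => ?_
    rw [← mul_assoc, Real.mul_self_sqrt (hD0 j).le]
  have h7 : (∑ j, D j * |F t j|) ^ 2 ≤ (√S * l ^ t) ^ 2 := by
    rw [mul_pow, Real.sq_sqrt hSpos.le]
    exact hcs.trans (mul_le_mul_of_nonneg_left (hind t).2 hSpos.le)
  exact le_of_sq_le_sq h7 (by positivity)

end ReversibleChain

/-! ### Dirichlet forms of graphs and the mixing time -/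

namespace SimpleGraph

open Classical in
/-- Along a path inside a finite vertex set `N` the increment of `h` is controlled by the energy of
the pairs in `N`. -/
theorem sq_sub_le_of_reachable {V : Type*} (H : SimpleGraph V) (N : Finset V)
    (hN : ∀ x y, H.Adj x y → x ∈ N) (h : V → ℝ) {x y : V} (hxy : H.Reachable x y) :
    (h x - h y) ^ 2 ≤ N.card * ∑ u ∈ N, ∑ v ∈ N, if H.Adj u v then (h u - h v) ^ 2 else 0 := by
  obtain ⟨p, hp⟩ := hxy.exists_isPath
  have hsum : ∀ {a b : V} (q : H.Walk a b),
      h a - h b = (q.darts.map fun e => h e.fst - h e.snd).sum := by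
    intro a b q
    induction q with
    | nil => simp
    | cons hadj q ih => simp [← ih]
  have hnd : p.darts.Nodup := p.darts_nodup_of_support_nodup hp.support_nodup
  -- The darts of a path have distinct initial vertices, all in `N`; Cauchy–Schwarz along the path
  -- then costs only the factor `N.card`.
  have hlen : p.darts.length ≤ N.card := by
    have hfst : (p.darts.map (·.fst)).Nodup := by
      have := hp.support_nodup
      rw [← p.map_fst_darts_append] at this
      exact (List.nodup_append.1 this).1
    have : (p.darts.map (·.fst)).toFinset ⊆ N := by
      intro v hv
      simp only [List.mem_toFinset, List.mem_map] at hv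
      obtain ⟨e, -, rfl⟩ := hv
      exact hN _ _ e.adj
    calc p.darts.length = (p.darts.map (·.fst)).toFinset.card := by
          rw [List.toFinset_card_of_nodup hfst, List.length_map]
      _ ≤ _ := Finset.card_le_card this
  have hfin : (p.darts.map fun e => h e.fst - h e.snd).sum
      = ∑ e ∈ p.darts.toFinset, (h e.fst - h e.snd) := (List.sum_toFinset _ hnd).symm
  rw [hsum p, hfin]
  refine (sq_sum_le_card_mul_sum_sq).trans ?_
  have hcard : ((p.darts.toFinset.card : ℕ) : ℝ) ≤ N.card := by
    rw [List.toFinset_card_of_nodup hnd]; exact_mod_cast hlen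
  have h2 : ∑ e ∈ p.darts.toFinset, (h e.fst - h e.snd) ^ 2
      ≤ ∑ u ∈ N, ∑ v ∈ N, if H.Adj u v then (h u - h v) ^ 2 else 0 := by
    rw [← Finset.sum_product', ← Finset.sum_filter]
    have hinj : Set.InjOn (fun e : H.Dart => e.toProd) (p.darts.toFinset : Set H.Dart) :=
      fun a _ b _ hab => SimpleGraph.Dart.toProd_injective hab
    rw [← Finset.sum_image (g := fun e : H.Dart => e.toProd)
      (f := fun q : V × V => (h q.1 - h q.2) ^ 2) hinj]
    refine Finset.sum_le_sum_of_subset_of_nonneg ?_ (fun _ _ _ => sq_nonneg _)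
    intro q hq
    simp only [Finset.mem_image] at hq
    obtain ⟨e, -, rfl⟩ := hq
    simp only [Finset.mem_filter, Finset.mem_product]
    exact ⟨⟨hN _ _ e.adj, hN _ _ e.adj.symm⟩, e.adj⟩
  have h0 : 0 ≤ ∑ e ∈ p.darts.toFinset, (h e.fst - h e.snd) ^ 2 :=
    Finset.sum_nonneg fun _ _ => sq_nonneg _
  gcongr

variable {V : Type*} [Fintype V]

open Classical in
/-- Twice the Dirichlet form of `f`: the sum of `(f x - f y) ^ 2` over ordered adjacent pairs. -/
noncomputable def energy (G : SimpleGraph V) (f : V → ℝ) : ℝ :=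
  ∑ x, ∑ y, if G.Adj x y then (f x - f y) ^ 2 else 0

open Classical in
/-- The signless analogue of `energy`. -/
noncomputable def signlessEnergy (G : SimpleGraph V) (f : V → ℝ) : ℝ :=
  ∑ x, ∑ y, if G.Adj x y then (f x + f y) ^ 2 else 0

open Classical in
theorem degree_eq_sum_ite (G : SimpleGraph V) (x : V) :
    (G.degree x : ℝ) = ∑ y, if G.Adj x y then (1 : ℝ) else 0 := by
  rw [← card_neighborFinset_eq_degree, neighborFinset_eq_filter, Finset.sum_boole]

open Classical in
theorem sum_degree_mul_sq_sub (G : SimpleGraph V) (f : V → ℝ) :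
    2 * ∑ x, (G.degree x : ℝ) * f x ^ 2
      - 2 * ∑ x, ∑ y, (if G.Adj x y then (1 : ℝ) else 0) * f x * f y = G.energy f := by
  have h1 : ∑ x, (G.degree x : ℝ) * f x ^ 2
      = ∑ x, ∑ y, (if G.Adj x y then (1 : ℝ) else 0) * f x ^ 2 := by
    simp_rw [degree_eq_sum_ite, Finset.sum_mul]
  have h2 : ∑ x, (G.degree x : ℝ) * f x ^ 2
      = ∑ x, ∑ y, (if G.Adj x y then (1 : ℝ) else 0) * f y ^ 2 := by
    rw [h1, Finset.sum_comm]; simp_rw [G.adj_comm]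
  rw [two_mul]
  nth_rewrite 1 [h1]
  rw [h2, energy, Finset.mul_sum]
  simp_rw [Finset.mul_sum, ← Finset.sum_add_distrib, ← Finset.sum_sub_distrib]
  refine Finset.sum_congr rfl fun x _ => Finset.sum_congr rfl fun y _ => ?_
  split_ifs <;> ring

open Classical in
theorem sum_degree_mul_sq_add (G : SimpleGraph V) (f : V → ℝ) :
    2 * ∑ x, (G.degree x : ℝ) * f x ^ 2
      + 2 * ∑ x, ∑ y, (if G.Adj x y then (1 : ℝ) else 0) * f x * f y = G.signlessEnergy f := by
  have h1 : ∑ x, (G.degree x : ℝ) * f x ^ 2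
      = ∑ x, ∑ y, (if G.Adj x y then (1 : ℝ) else 0) * f x ^ 2 := by
    simp_rw [degree_eq_sum_ite, Finset.sum_mul]
  have h2 : ∑ x, (G.degree x : ℝ) * f x ^ 2
      = ∑ x, ∑ y, (if G.Adj x y then (1 : ℝ) else 0) * f y ^ 2 := by
    rw [h1, Finset.sum_comm]; simp_rw [G.adj_comm]
  rw [two_mul]
  nth_rewrite 1 [h1]
  rw [h2, signlessEnergy, Finset.mul_sum]
  simp_rw [Finset.mul_sum, ← Finset.sum_add_distrib]
  refine Finset.sum_congr rfl fun x _ => Finset.sum_congr rfl fun y _ => ?_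
  split_ifs <;> ring

open Classical in
/-- Mixing time bound from Poincaré inequalities at both ends of the spectrum. -/
theorem mixingTime_le_of_poincare [DecidableEq V] (G : SimpleGraph V) (hG : G.Connected)
    (hV : 2 ≤ Fintype.card V) (A : ℝ) (hA : 1 ≤ A)
    (h₁ : ∀ f : V → ℝ, ∑ x, (G.degree x : ℝ) * f x = 0 →
      ∑ x, (G.degree x : ℝ) * f x ^ 2 ≤ A * G.energy f)
    (h₂ : ∀ f : V → ℝ, ∑ x, (G.degree x : ℝ) * f x ^ 2 ≤ A * G.signlessEnergy f)
    (T : ℕ) (hT : 4 * A * Real.log (Fintype.card V) ≤ T) :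
    G.mixingTime (1 / (Fintype.card V : ℝ)) ≤ T := by
  set n := Fintype.card V with hn
  have hn0 : (0 : ℝ) < n := by positivity
  have : Nontrivial V := Fintype.one_lt_card_iff_nontrivial.1 (by omega)
  have hdeg : ∀ x, (1 : ℝ) ≤ G.degree x := fun x => by
    exact_mod_cast hG.preconnected.degree_pos_of_nontrivial x
  have hsum : ∑ x, (G.degree x : ℝ) = 2 * (G.edgeFinset.card : ℝ) := by
    have := G.sum_degrees_eq_twice_card_edges
    exact_mod_cast this
  have hle : ∑ x, (G.degree x : ℝ) ≤ (n : ℝ) ^ 2 := by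
    calc ∑ x, (G.degree x : ℝ) ≤ ∑ _x : V, (n : ℝ) :=
          Finset.sum_le_sum fun x _ => by exact_mod_cast (G.degree_lt_card_verts x).le
      _ = _ := by rw [Finset.sum_const, Finset.card_univ, nsmul_eq_mul, ← hn, sq]
  -- Since `energy` is twice the Dirichlet form, a Poincaré constant `A` gives a spectral gap `1 /
  -- (2 * A)`.
  set l : ℝ := 1 - 1 / (2 * A) with hl
  have hA0 : 0 < A := by linarith
  have hl0 : 0 < l := by
    have : 1 / (2 * A) ≤ 1 / 2 := by
      apply one_div_le_one_div_of_le <;> linarith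
    rw [hl]; linarith
  have hlexp : l ≤ Real.exp (-(1 / (2 * A))) := by
    have := Real.add_one_le_exp (-(1 / (2 * A))); rw [hl]; linarith
  have hform : ∀ f : V → ℝ, ∑ x, (G.degree x : ℝ) * f x = 0 →
      |∑ x, ∑ y, (if G.Adj x y then (1 : ℝ) else 0) * f x * f y|
        ≤ l * ∑ x, (G.degree x : ℝ) * f x ^ 2 := by
    intro f hf
    have e1 := sum_degree_mul_sq_sub G f
    have e2 := sum_degree_mul_sq_add G f
    have i1 := h₁ f hf
    have i2 := h₂ f
    have hx : ∀ a b : ℝ, b ≤ A * a → 1 / (2 * A) * b ≤ a / 2 := by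
      intro a b hab
      calc 1 / (2 * A) * b ≤ 1 / (2 * A) * (A * a) := by gcongr
        _ = a / 2 := by field_simp
    have j1 := hx _ _ i1
    have j2 := hx _ _ i2
    rw [abs_le, hl]
    constructor <;> linarith
  have hmain : ∀ i, ∀ t ≥ T, G.walkDist i t ≤ 1 / (n : ℝ) := by
    intro i t ht
    have h := ReversibleChain.sum_abs_pow_sub_le (fun x y => if G.Adj x y then (1 : ℝ) else 0)
      (fun x y => by simp_rw [G.adj_comm]) (fun x => (G.degree x : ℝ)) hdeg
      (fun x => (degree_eq_sum_ite G x).symm) l hl0 hform G.walkMatrix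
      (fun x y => by simp only [walkMatrix]; split_ifs <;> simp) i t
    rw [hsum] at h
    -- The factor 4 in `T` yields `n ^ (-2)`: one power of `n` absorbs the square root of the total
    -- degree, the other is the target accuracy.
    have h3 : l ^ t ≤ 1 / (n : ℝ) ^ 2 := by
      calc l ^ t ≤ Real.exp (-(1 / (2 * A))) ^ t := pow_le_pow_left₀ hl0.le hlexp t
        _ = Real.exp (-(t / (2 * A))) := by rw [← Real.exp_nat_mul]; congr 1; ring
        _ ≤ Real.exp (-(2 * Real.log n)) := by
          apply Real.exp_le_exp.2
          apply neg_le_neg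
          rw [le_div_iff₀ (by positivity)]
          have : (T : ℝ) ≤ t := by exact_mod_cast ht
          linarith
        _ = 1 / (n : ℝ) ^ 2 := by
          rw [Real.exp_neg, two_mul, Real.exp_add, Real.exp_log hn0, one_div, sq]
    have h4 : √(2 * (G.edgeFinset.card : ℝ)) ≤ n := by
      rw [← hsum]
      exact Real.sqrt_le_iff.2 ⟨hn0.le, hle⟩
    have h5 : G.walkDist i t ≤ 1 / 2 * (√(2 * (G.edgeFinset.card : ℝ)) * l ^ t) := by
      unfold walkDist walkStationary
      exact mul_le_mul_of_nonneg_left h (by norm_num)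
    have h6 : √(2 * (G.edgeFinset.card : ℝ)) * l ^ t ≤ n * (1 / (n : ℝ) ^ 2) := by gcongr
    have h7 : (n : ℝ) * (1 / (n : ℝ) ^ 2) = 1 / n := by field_simp
    have h8 : 0 < 1 / (n : ℝ) := by positivity
    linarith
  unfold mixingTime
  refine iSup_le fun i => ?_
  unfold mixingTimeFrom
  exact iInf₂_le T (hmain i)

end SimpleGraph

/-! ### The discrete torus: Poincaré inequality and connectivity of sparse perforations -/

namespace Grid

/-- The `ℓ²` norm of the increment of `g` along `v`. -/
noncomputable def shiftNorm {A : Type*} [Fintype A] [AddCommGroup A] (g : A → ℝ) (v : A) : ℝ :=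
  ‖WithLp.toLp 2 (fun a => g (a + v) - g a)‖

section Shift

variable {A : Type*} [Fintype A] [AddCommGroup A] (g : A → ℝ)

theorem shiftNorm_sq (v : A) : shiftNorm g v ^ 2 = ∑ a, (g (a + v) - g a) ^ 2 := by
  simp [shiftNorm, EuclideanSpace.norm_sq_eq]

theorem shiftNorm_nonneg (v : A) : 0 ≤ shiftNorm g v := norm_nonneg _

theorem shiftNorm_zero : shiftNorm g 0 = 0 := by
  have : shiftNorm g 0 ^ 2 = 0 := by rw [shiftNorm_sq]; simp
  exact pow_eq_zero_iff (two_ne_zero) |>.1 this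

/-- Translation invariance of the `ℓ²` norm and Minkowski's inequality. This subadditivity lets a
long shift be broken into unit shifts. -/
theorem shiftNorm_add_le (v w : A) : shiftNorm g (v + w) ≤ shiftNorm g v + shiftNorm g w := by
  have h : shiftNorm g v = ‖WithLp.toLp 2 (fun a => g (a + w + v) - g (a + w))‖ := by
    have h2 : shiftNorm g v ^ 2 = ‖WithLp.toLp 2 (fun a => g (a + w + v) - g (a + w))‖ ^ 2 := by
      rw [shiftNorm_sq, EuclideanSpace.norm_sq_eq]
      simp only [Real.norm_eq_abs, sq_abs]
      exact (Equiv.sum_comp (Equiv.addRight w) fun a => (g (a + v) - g a) ^ 2).symm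
    exact (pow_left_inj₀ (shiftNorm_nonneg g v) (norm_nonneg _) two_ne_zero).1 h2
  rw [h]
  refine le_trans (le_of_eq ?_) (norm_add_le _ _)
  unfold shiftNorm
  congr 1
  ext a
  simp [add_comm v w, add_assoc]

theorem shiftNorm_sum_le {ι : Type*} (s : Finset ι) (v : ι → A) :
    shiftNorm g (∑ i ∈ s, v i) ≤ ∑ i ∈ s, shiftNorm g (v i) := by
  classical
  induction s using Finset.induction_on with
  | empty => simp [shiftNorm_zero]
  | insert i s hi ih =>
    rw [Finset.sum_insert hi, Finset.sum_insert hi]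
    exact (shiftNorm_add_le g _ _).trans (by gcongr)

theorem shiftNorm_nsmul_le (k : ℕ) (v : A) : shiftNorm g (k • v) ≤ k * shiftNorm g v := by
  have := shiftNorm_sum_le g (Finset.range k) (fun _ => v)
  simpa using this

end Shift

/-- Poincaré inequality on the discrete torus. -/
theorem poincare {d M : ℕ} [NeZero M] (g : (Fin d → ZMod M) → ℝ) :
    ∑ a, ∑ b, (g b - g a) ^ 2 ≤
      (d : ℝ) * M ^ 2 * M ^ d * ∑ a, ∑ j, (g (a + Pi.single j 1) - g a) ^ 2 := by
  have hv : ∀ v : Fin d → ZMod M, shiftNorm g v ^ 2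
      ≤ (d : ℝ) * M ^ 2 * ∑ j, shiftNorm g (Pi.single j 1) ^ 2 := by
    intro v
    -- With the representatives `ZMod.val`, each coordinate is fewer than `M` unit steps;
    -- Cauchy–Schwarz over the `d` directions then gives `d * M ^ 2`.
    have hdec : v = ∑ j, (v j).val • (Pi.single j 1 : Fin d → ZMod M) := by
      ext k
      rw [Finset.sum_apply]
      simp [Pi.single_apply]
    have h1 : shiftNorm g v ≤ ∑ j, (M : ℝ) * shiftNorm g (Pi.single j 1) := by
      conv_lhs => rw [hdec]
      refine (shiftNorm_sum_le g _ _).trans (Finset.sum_le_sum fun j _ => ?_)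
      refine (shiftNorm_nsmul_le g _ _).trans ?_
      have : ((v j).val : ℝ) ≤ M := by exact_mod_cast (ZMod.val_lt (v j)).le
      exact mul_le_mul_of_nonneg_right this (shiftNorm_nonneg g _)
    calc shiftNorm g v ^ 2 ≤ (∑ j, (M : ℝ) * shiftNorm g (Pi.single j 1)) ^ 2 :=
          pow_le_pow_left₀ (shiftNorm_nonneg g v) h1 2
      _ ≤ (Finset.univ : Finset (Fin d)).card * ∑ j, ((M : ℝ) * shiftNorm g (Pi.single j 1)) ^ 2 :=
          sq_sum_le_card_mul_sum_sq
      _ = _ := by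
          simp only [mul_pow, ← Finset.mul_sum, Finset.card_univ, Fintype.card_fin]; ring
  -- Regroup the ordered pairs according to their difference.
  have hre : ∑ a, ∑ b, (g b - g a) ^ 2 = ∑ v, shiftNorm g v ^ 2 := by
    simp_rw [shiftNorm_sq]
    rw [Finset.sum_comm (s := Finset.univ) (t := Finset.univ) (f := fun v a => (g (a + v) - g a) ^ 2)]
    refine Finset.sum_congr rfl fun a _ => ?_
    exact (Equiv.sum_comp (Equiv.addLeft a) fun b => (g b - g a) ^ 2).symm
  rw [hre]
  calc ∑ v, shiftNorm g v ^ 2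
      ≤ ∑ _v : Fin d → ZMod M, (d : ℝ) * M ^ 2 * ∑ j, shiftNorm g (Pi.single j 1) ^ 2 :=
        Finset.sum_le_sum fun v _ => hv v
    _ = _ := by
        rw [Finset.sum_const, Finset.card_univ, Fintype.card_fun, ZMod.card, Fintype.card_fin,
          Finset.sum_comm]
        simp_rw [shiftNorm_sq]
        rw [nsmul_eq_mul]; push_cast; ring

/-! ### Connectivity in sparsely perforated cubes of the integer lattice -/

/-- Nearest neighbour graph of a subset of `ℤ^d`. -/
def nnGraph {d : ℕ} (P : Set (Fin d → ℤ)) : SimpleGraph (Fin d → ℤ) where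
  Adj x y := x ∈ P ∧ y ∈ P ∧ ∃ i, y = x + Pi.single i 1 ∨ x = y + Pi.single i 1
  symm := ⟨fun _ _ h => ⟨h.2.1, h.1, h.2.2.imp fun _ hi => hi.symm⟩⟩
  loopless := ⟨fun x h => by
    obtain ⟨-, -, i, hi⟩ := h
    have : x i = x i + 1 := by
      rcases hi with hi | hi <;> simpa using congrFun hi i
    omega⟩

variable {d : ℕ}

theorem nnGraph_mem_of_reachable {P : Set (Fin d → ℤ)} {x y : Fin d → ℤ} (hx : x ∈ P)
    (h : (nnGraph P).Reachable x y) : y ∈ P := by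
  obtain ⟨p⟩ := h
  induction p with
  | nil => exact hx
  | cons hadj _ ih => exact ih hadj.2.1

/-- Two points are connected in `P` when the box they span lies in `P`. -/
theorem reachable_of_box (P : Set (Fin d → ℤ)) (x y : Fin d → ℤ)
    (h : ∀ v : Fin d → ℤ, (∀ k, min (x k) (y k) ≤ v k ∧ v k ≤ max (x k) (y k)) → v ∈ P) :
    (nnGraph P).Reachable x y := by
  induction hN : ∑ k, (x k - y k).natAbs using Nat.strong_induction_on generalizing x with
  | _ N ih =>
  by_cases hxy : x = y
  · subst hxy; rfl
  obtain ⟨i, hi⟩ := Function.ne_iff.1 hxy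
  have hxP : x ∈ P := h x fun k => ⟨min_le_left _ _, le_max_left _ _⟩
  -- A unit step in coordinate `i` towards `y` shrinks the spanned box and the `ℓ¹` distance, so the
  -- induction applies.
  have step : ∀ e : ℤ, (e = 1 ∨ e = -1) → (x i + e - y i).natAbs < (x i - y i).natAbs →
      min (x i) (y i) ≤ x i + e → x i + e ≤ max (x i) (y i) → (nnGraph P).Reachable x y := by
    intro e he hlt hle1 hle2
    set x' := x + Pi.single i e with hx'
    have hx'k : ∀ k, k ≠ i → x' k = x k := fun k hk => by simp [hx', hk]
    have hx'i : x' i = x i + e := by simp [hx']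
    have hbox : ∀ v : Fin d → ℤ, (∀ k, min (x' k) (y k) ≤ v k ∧ v k ≤ max (x' k) (y k)) → v ∈ P := by
      intro v hv
      refine h v fun k => ?_
      by_cases hk : k = i
      · subst hk
        have := hv k
        rw [hx'i] at this
        omega
      · rw [← hx'k k hk]; exact hv k
    have hx'P : x' ∈ P := hbox x' fun k => ⟨min_le_left _ _, le_max_left _ _⟩
    have hadj : (nnGraph P).Adj x x' := by
      refine ⟨hxP, hx'P, i, ?_⟩
      rcases he with rfl | rfl
      · exact Or.inl rfl
      · right
        rw [hx', add_assoc, ← Pi.single_add]; simp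
    refine hadj.reachable.trans (ih (∑ k, (x' k - y k).natAbs) ?_ x' hbox rfl)
    rw [← hN]
    refine Finset.sum_lt_sum (fun k _ => ?_) ⟨i, Finset.mem_univ i, by rw [hx'i]; exact hlt⟩
    by_cases hk : k = i
    · subst hk; rw [hx'i]; exact hlt.le
    · rw [hx'k k hk]
  rcases lt_or_gt_of_ne hi with hlt | hgt
  · exact step 1 (Or.inl rfl) (by omega) (by omega) (by omega)
  · exact step (-1) (Or.inr rfl) (by omega) (by omega) (by omega)

/-- The cube `[-r, r]^d` of `ℤ^d`. -/
noncomputable def box (d : ℕ) (r : ℕ) : Finset (Fin d → ℤ) := Finset.Icc (fun _ => -(r : ℤ)) (fun _ => (r : ℤ))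

theorem mem_box {r : ℕ} {v : Fin d → ℤ} : v ∈ box d r ↔ ∀ k, -(r : ℤ) ≤ v k ∧ v k ≤ r := by
  simp only [box, Finset.mem_Icc, Pi.le_def]
  exact ⟨fun h k => ⟨h.1 k, h.2 k⟩, fun h => ⟨fun k => (h k).1, fun k => (h k).2⟩⟩

theorem box_mono {r r' : ℕ} (h : r ≤ r') : box d r ⊆ box d r' := by
  intro v hv
  rw [mem_box] at *
  intro k
  have := hv k
  omega

open Classical in
/-- If few points of a cube lie outside `P`, some slab orthogonal to a given direction avoids
them. -/
theorem exists_slab_subset (P : Set (Fin d → ℤ)) (r k₀ : ℕ)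
    (hP : ((box d r).filter (· ∉ P)).card ≤ k₀) (i : Fin d) :
    ∃ t : ℤ, 0 ≤ t ∧ t ≤ k₀ ∧ ∀ v ∈ box d r, v i = t → v ∈ P := by
  -- Pigeonhole: there are `k₀ + 1` candidate levels, and each point outside `P` spoils only one of
  -- them.
  have hlt : (((box d r).filter (· ∉ P)).image (· i)).card < (Finset.Icc (0 : ℤ) k₀).card := by
    have := (Finset.card_image_le (s := (box d r).filter (· ∉ P)) (f := (· i))).trans hP
    simp only [Int.card_Icc]
    omega
  obtain ⟨t, ht, ht'⟩ := Finset.exists_mem_notMem_of_card_lt_card hlt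
  rw [Finset.mem_Icc] at ht
  refine ⟨t, ht.1, ht.2, fun v hv hvt => ?_⟩
  by_contra hvP
  exact ht' (Finset.mem_image.2 ⟨v, Finset.mem_filter.2 ⟨hv, hvP⟩, hvt⟩)

/-- A crossing point `t` of full slabs of a cube is connected to the crossing point of full slabs of
the cube translated by a unit vector. -/
theorem reachable_translate (hd : 2 ≤ d) (P : Set (Fin d → ℤ)) (r k₀ : ℕ) (hr : k₀ + 1 ≤ r)
    (t t' : Fin d → ℤ) (ht : ∀ i, 0 ≤ t i ∧ t i ≤ k₀) (ht' : ∀ i, 0 ≤ t' i ∧ t' i ≤ k₀) (j : Fin d)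
    (hP : ∀ i, ∀ v ∈ box d r, v i = t i → v ∈ P)
    (hP' : ∀ i, ∀ v ∈ box d r, v i = t' i → v + Pi.single j 1 ∈ P)
    (hslab : ∀ i, ∃ b : ℤ, 0 ≤ b ∧ b ≤ k₀ ∧ ∀ v ∈ box d (r + 1), v i = b → v ∈ P) :
    (nnGraph (P ∩ box d (r + 1))).Reachable t (t' + Pi.single j 1) := by
  -- A full slab of the larger cube orthogonal to some `i ≠ j` serves as a bridge. The path goes
  -- along direction `i` inside the `j`-slab of the first cube, then within the bridge, then along
  -- direction `i` inside the `j`-slab of the translated cube.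
  obtain ⟨i, hij⟩ : ∃ i : Fin d, i ≠ j := by
    have : Nontrivial (Fin d) := Fin.nontrivial_iff_two_le.2 hd
    exact exists_ne j
  obtain ⟨b, hb0, hb1, hb⟩ := hslab i
  have h1 : (nnGraph (P ∩ box d (r + 1))).Reachable t (Function.update t i b) := by
    refine reachable_of_box _ _ _ fun v hv => ?_
    have hvb : v ∈ box d r := by
      rw [mem_box]; intro k
      have h1 := hv k
      have h2 := ht k
      by_cases hk : k = i
      · subst hk
        simp only [Function.update_self] at h1
        omega
      · simp only [Function.update_of_ne hk] at h1
        omega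
    refine ⟨hP j v hvb ?_, box_mono (Nat.le_succ r) hvb⟩
    have := hv j
    simp only [Function.update_of_ne hij.symm] at this
    omega
  have h2 : (nnGraph (P ∩ box d (r + 1))).Reachable (Function.update t i b)
      (Function.update (t' + Pi.single j 1) i b) := by
    refine reachable_of_box _ _ _ fun v hv => ?_
    have hvb : v ∈ box d (r + 1) := by
      rw [mem_box]; intro k
      have h1 := hv k
      have h2 := ht k
      have h3 := ht' k
      by_cases hk : k = i
      · subst hk
        simp only [Function.update_self] at h1
        push_cast; omega
      · simp only [Function.update_of_ne hk, Pi.add_apply] at h1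
        have h4 : (0 : ℤ) ≤ (Pi.single j 1 : Fin d → ℤ) k ∧ (Pi.single j 1 : Fin d → ℤ) k ≤ 1 := by
          rw [Pi.single_apply]; split_ifs <;> omega
        push_cast; omega
    refine ⟨hb v hvb ?_, hvb⟩
    have := hv i
    simp only [Function.update_self] at this
    omega
  have h3 : (nnGraph (P ∩ box d (r + 1))).Reachable (Function.update (t' + Pi.single j 1) i b)
      (t' + Pi.single j 1) := by
    refine reachable_of_box _ _ _ fun v hv => ?_
    have hvb : v - Pi.single j 1 ∈ box d r := by
      rw [mem_box]; intro k
      have h1 := hv k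
      have h3 := ht' k
      rw [Pi.sub_apply]
      by_cases hk : k = i
      · subst hk
        simp only [Function.update_self, Pi.add_apply, Pi.single_eq_of_ne hij] at h1 ⊢
        omega
      · simp only [Function.update_of_ne hk, Pi.add_apply] at h1
        omega
    have hvj : (v - Pi.single j 1 : Fin d → ℤ) j = t' j := by
      have := hv j
      simp only [Function.update_of_ne hij.symm, Pi.add_apply, Pi.single_eq_same, Pi.sub_apply] at *
      omega
    have hvP := hP' j _ hvb hvj
    rw [sub_add_cancel] at hvP
    refine ⟨hvP, ?_⟩
    rw [Finset.mem_coe, mem_box] at *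
    intro k
    have h5 := hvb k
    rw [Pi.sub_apply] at h5
    have h4 : (0 : ℤ) ≤ (Pi.single j 1 : Fin d → ℤ) k ∧ (Pi.single j 1 : Fin d → ℤ) k ≤ 1 := by
      rw [Pi.single_apply]; split_ifs <;> omega
    push_cast; omega
  exact (h1.trans h2).trans h3

open Classical in
/-- At most quadratically many points of a sparsely perforated cube are disconnected from the
crossing point of full slabs. -/
theorem card_not_reachable_le (hd : 2 ≤ d) (P : Set (Fin d → ℤ)) (r k₀ : ℕ) (hr : k₀ ≤ r)
    (hcard : ((box d r).filter (· ∉ P)).card ≤ k₀)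
    (t : Fin d → ℤ) (ht : ∀ i, 0 ≤ t i ∧ t i ≤ k₀)
    (hP : ∀ i, ∀ v ∈ box d r, v i = t i → v ∈ P) :
    ((box d r).filter fun v => ¬ (nnGraph (P ∩ box d r)).Reachable t v).card ≤ k₀ ^ 2 := by
  -- If some axis line through `v` avoids the holes, it leads from `v` to a full slab and hence to
  -- `t`. So a disconnected `v` has a hole on every axis line through it.
  have hline : ∀ v ∈ box d r, ¬ (nnGraph (P ∩ box d r)).Reachable t v → ∀ i,
      ∃ u ∈ (box d r).filter (· ∉ P), ∀ k, k ≠ i → u k = v k := by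
    intro v hv hnr i
    by_contra! hcon
    apply hnr
    rw [mem_box] at hv
    have h1 : (nnGraph (P ∩ box d r)).Reachable v (Function.update v i (t i)) := by
      refine reachable_of_box _ _ _ fun u hu => ?_
      have hub : u ∈ box d r := by
        rw [mem_box]; intro k
        have h1 := hu k
        have h2 := ht k
        have h3 := hv k
        by_cases hk : k = i
        · subst hk
          simp only [Function.update_self] at h1
          omega
        · simp only [Function.update_of_ne hk] at h1
          omega
      refine ⟨?_, hub⟩
      by_contra huP
      obtain ⟨k, hk, hne⟩ := hcon u (Finset.mem_filter.2 ⟨hub, huP⟩)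
      have := hu k
      simp only [Function.update_of_ne hk] at this
      omega
    have h2 : (nnGraph (P ∩ box d r)).Reachable (Function.update v i (t i)) t := by
      refine reachable_of_box _ _ _ fun u hu => ?_
      have hub : u ∈ box d r := by
        rw [mem_box]; intro k
        have h1 := hu k
        have h2 := ht k
        have h3 := hv k
        by_cases hk : k = i
        · subst hk
          simp only [Function.update_self] at h1
          omega
        · simp only [Function.update_of_ne hk] at h1
          omega
      refine ⟨hP i u hub ?_, hub⟩
      have := hu i
      simp only [Function.update_self] at this
      omega
    exact (h1.trans h2).symm
  let i₀ : Fin d := ⟨0, by omega⟩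
  let i₁ : Fin d := ⟨1, by omega⟩
  have hne : i₀ ≠ i₁ := by simp [i₀, i₁]
  set B := (box d r).filter (· ∉ P)
  -- Holes on the lines in two different directions determine `v`: the second supplies every
  -- coordinate except `i₁`, the first supplies `i₁`. This bounds the count by the number of pairs
  -- of holes.
  have hsub : ((box d r).filter fun v => ¬ (nnGraph (P ∩ box d r)).Reachable t v)
      ⊆ (B ×ˢ B).image fun q => Function.update q.2 i₁ (q.1 i₁) := by
    intro v hv
    rw [Finset.mem_filter] at hv
    obtain ⟨u, hu, huv⟩ := hline v hv.1 hv.2 i₀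
    obtain ⟨u', hu', huv'⟩ := hline v hv.1 hv.2 i₁
    refine Finset.mem_image.2 ⟨(u, u'), Finset.mem_product.2 ⟨hu, hu'⟩, ?_⟩
    ext k
    by_cases hk : k = i₁
    · subst hk; simp [huv i₁ hne.symm]
    · simp [hk, huv' k hk]
  calc _ ≤ _ := Finset.card_le_card hsub
    _ ≤ (B ×ˢ B).card := Finset.card_image_le
    _ = B.card * B.card := Finset.card_product _ _
    _ ≤ k₀ ^ 2 := by rw [sq]; exact Nat.mul_le_mul hcard hcard

end Grid

/-! ### Geometry of the flat torus -/

namespace GTG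

variable {d : ℕ}

theorem toricDist_nonneg (x y : UnitAddTorus (Fin d)) : 0 ≤ toricDist x y := Real.sqrt_nonneg _

theorem toricDist_comm (x y : UnitAddTorus (Fin d)) : toricDist x y = toricDist y x := by
  unfold toricDist; simp only [norm_sub_rev]

theorem norm_sub_le_toricDist (x y : UnitAddTorus (Fin d)) : ‖x - y‖ ≤ toricDist x y := by
  refine (pi_norm_le_iff_of_nonneg (toricDist_nonneg x y)).2 fun i => ?_
  refine Real.le_sqrt_of_sq_le ?_
  exact Finset.single_le_sum (f := fun i => ‖x i - y i‖ ^ 2) (fun _ _ => sq_nonneg _)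
    (Finset.mem_univ i)

theorem toricDist_le_mul_norm (x y : UnitAddTorus (Fin d)) : toricDist x y ≤ d * ‖x - y‖ := by
  refine Real.sqrt_le_iff.2 ⟨by positivity, ?_⟩
  calc ∑ i, ‖x i - y i‖ ^ 2 ≤ ∑ _i : Fin d, ‖x - y‖ ^ 2 :=
        Finset.sum_le_sum fun i _ => pow_le_pow_left₀ (norm_nonneg _) (norm_le_pi_norm (x - y) i) 2
    _ = d * ‖x - y‖ ^ 2 := by simp
    _ ≤ (d * ‖x - y‖) ^ 2 := by
        rw [mul_pow]
        refine mul_le_mul_of_nonneg_right ?_ (sq_nonneg _)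
        rcases Nat.eq_zero_or_pos d with h | h
        · simp [h]
        · have : (1 : ℝ) ≤ d := by exact_mod_cast h
          nlinarith

theorem toricDist_eq_norm (x y : UnitAddTorus (Fin d)) :
    toricDist x y = ‖WithLp.toLp 2 (fun i => ‖x i - y i‖)‖ := by
  simp [toricDist, EuclideanSpace.norm_eq]

theorem toricDist_triangle (x y z : UnitAddTorus (Fin d)) :
    toricDist x z ≤ toricDist x y + toricDist y z := by
  rw [toricDist_eq_norm x y, toricDist_eq_norm y z]
  refine le_trans ?_ (norm_add_le _ _)
  rw [EuclideanSpace.norm_eq]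
  refine Real.sqrt_le_sqrt (Finset.sum_le_sum fun i _ => ?_)
  refine pow_le_pow_left₀ (norm_nonneg _) ?_ 2
  refine le_trans ?_ (le_abs_self _)
  simpa using norm_sub_le_norm_sub_add_norm_sub (x i) (y i) (z i)

/-- Subtracting the nearest integer gives the representative of smallest absolute value; scaling
these lifts coordinatewise traces geodesics. -/
theorem exists_real_lift (x : UnitAddCircle) : ∃ t : ℝ, (t : UnitAddCircle) = x ∧ |t| = ‖x‖ := by
  induction x using QuotientAddGroup.induction_on with
  | H u =>
    refine ⟨u - round u, ?_, (UnitAddCircle.norm_eq).symm⟩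
    have h2 : ((round u : ℝ) : UnitAddCircle) = 0 := by
      rw [AddCircle.coe_eq_zero_iff]
      exact ⟨round u, by simp⟩
    rw [AddCircle.coe_sub, h2, sub_zero]

theorem norm_coe_le_abs (t : ℝ) : ‖(t : UnitAddCircle)‖ ≤ |t| := by
  rw [UnitAddCircle.norm_eq]
  have := round_le t 0
  simpa using this

/-- Points at prescribed distance along a geodesic. -/
theorem exists_point_on_geodesic (x y : UnitAddTorus (Fin d)) (l : ℝ) (hl : 0 ≤ l) (hl1 : l ≤ 1) :
    ∃ q, toricDist x q ≤ l * toricDist x y ∧ toricDist q y ≤ (1 - l) * toricDist x y := by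
  choose t ht htn using fun i => exists_real_lift (y i - x i)
  have hn : ∀ i, |t i| = ‖x i - y i‖ := fun i => by rw [htn, norm_sub_rev]
  have key : ∀ (a b : UnitAddTorus (Fin d)) (c : ℝ), 0 ≤ c → (∀ i, ‖a i - b i‖ ≤ c * ‖x i - y i‖) →
      toricDist a b ≤ c * toricDist x y := by
    intro a b c hc h
    unfold toricDist
    refine Real.sqrt_le_iff.2 ⟨by positivity, ?_⟩
    rw [mul_pow, Real.sq_sqrt (Finset.sum_nonneg fun _ _ => sq_nonneg _), Finset.mul_sum]
    refine Finset.sum_le_sum fun i _ => ?_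
    rw [← mul_pow]
    exact pow_le_pow_left₀ (norm_nonneg _) (h i) 2
  refine ⟨fun i => x i + ((l * t i : ℝ) : UnitAddCircle), key _ _ l hl fun i => ?_,
    key _ _ (1 - l) (by linarith) fun i => ?_⟩
  · rw [norm_sub_rev, add_sub_cancel_left, ← hn]
    refine (norm_coe_le_abs _).trans ?_
    rw [abs_mul, abs_of_nonneg hl]
  · have : x i + ((l * t i : ℝ) : UnitAddCircle) - y i = -(((1 - l) * t i : ℝ) : UnitAddCircle) := by
      rw [one_sub_mul, AddCircle.coe_sub, ht]; abel
    rw [this, norm_neg, ← hn]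
    refine (norm_coe_le_abs _).trans ?_
    rw [abs_mul, abs_of_nonneg (by linarith : 0 ≤ 1 - l)]

/-! ### The lattice of mesh `1 / M` -/

variable {M : ℕ}

/-- Reduction of an integer vector. -/
def red (M : ℕ) (v : Fin d → ℤ) : Fin d → ZMod M := fun i => (v i : ZMod M)

theorem red_add (v w : Fin d → ℤ) : red M (v + w) = red M v + red M w := by
  ext i; simp [red]

theorem red_single (j : Fin d) : red M (Pi.single j 1) = Pi.single j 1 := by
  ext i
  by_cases h : i = j
  · subst h; simp [red]
  · simp [red, h]

variable [NeZero M]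

/-- The lattice point of the torus with index `a`. -/
noncomputable def pt (a : Fin d → ZMod M) : UnitAddTorus (Fin d) := fun i => ZMod.toAddCircle (a i)

theorem pt_add_red (a : Fin d → ZMod M) (v : Fin d → ℤ) (i : Fin d) :
    pt (a + red M v) i = pt a i + ((v i / M : ℝ) : UnitAddCircle) := by
  simp only [pt, red, Pi.add_apply, map_add, ZMod.toAddCircle_intCast]

theorem norm_pt_add_red_sub_le (a : Fin d → ZMod M) (v : Fin d → ℤ) (r : ℕ)
    (hv : v ∈ Grid.box d r) : ‖pt (a + red M v) - pt a‖ ≤ r * (1 / M) := by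
  refine (pi_norm_le_iff_of_nonneg (by positivity)).2 fun i => ?_
  rw [Pi.sub_apply, pt_add_red, add_sub_cancel_left]
  refine (norm_coe_le_abs _).trans ?_
  rw [abs_div, abs_of_nonneg (Nat.cast_nonneg M : (0 : ℝ) ≤ M), mul_one_div]
  gcongr
  have := Grid.mem_box.1 hv i
  rw [abs_le]
  exact ⟨by exact_mod_cast this.1, by exact_mod_cast this.2⟩

theorem single_mem_box (j : Fin d) : (Pi.single j 1 : Fin d → ℤ) ∈ Grid.box d 1 := by
  rw [Grid.mem_box]
  intro k
  rw [Pi.single_apply]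
  split_ifs <;> simp

/-- Round each coordinate of a minimal lift. The error of half a mesh, rather than a full one, is
what identifies a lattice point uniquely in `card_filter_norm_le`. -/
theorem exists_near_red_half (a : Fin d → ZMod M) (q : UnitAddTorus (Fin d)) (r : ℕ)
    (hq : ‖q - pt a‖ ≤ r * (1 / M)) :
    ∃ v ∈ Grid.box d (r + 1), ‖q - pt (a + red M v)‖ ≤ 1 / 2 / M := by
  have hM : (0 : ℝ) < M := by exact_mod_cast Nat.pos_of_ne_zero (NeZero.ne M)
  choose t ht htn using fun i => exists_real_lift (q i - pt a i)
  have htr : ∀ i, |t i| ≤ r * (1 / M) := fun i => by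
    rw [htn]; exact (norm_le_pi_norm (q - pt a) i).trans hq
  have habs : ∀ i, |t i * M - round (t i * M)| ≤ 1 / 2 := fun i => abs_sub_round _
  refine ⟨fun i => round (t i * M), Grid.mem_box.2 fun i => ?_,
    (pi_norm_le_iff_of_nonneg (by positivity)).2 fun i => ?_⟩
  · have h1 : |t i * M| ≤ r := by
      rw [abs_mul, abs_of_pos hM]
      calc |t i| * M ≤ r * (1 / M) * M := by gcongr; exact htr i
        _ = r := by field_simp
    have h2 := abs_le.1 (habs i)
    have h3 := abs_le.1 h1
    constructor
    · have : (-(r + 1 : ℝ)) ≤ (round (t i * M) : ℝ) := by linarith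
      exact_mod_cast this
    · have : (round (t i * M) : ℝ) ≤ r + 1 := by linarith
      exact_mod_cast this
  · rw [Pi.sub_apply, pt_add_red, ← sub_sub, ← ht, ← AddCircle.coe_sub]
    refine (norm_coe_le_abs _).trans ?_
    have : t i - (round (t i * M) : ℝ) / M = (t i * M - round (t i * M)) / M := by field_simp
    rw [this, abs_div, abs_of_pos hM]
    gcongr
    exact habs i

theorem exists_near_red (a : Fin d → ZMod M) (q : UnitAddTorus (Fin d)) (r : ℕ)
    (hq : ‖q - pt a‖ ≤ r * (1 / M)) :
    ∃ v ∈ Grid.box d (r + 1), ‖q - pt (a + red M v)‖ ≤ 1 / M := by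
  obtain ⟨v, hv, h⟩ := exists_near_red_half a q r hq
  refine ⟨v, hv, h.trans ?_⟩
  gcongr
  norm_num

theorem exists_near_pt (q : UnitAddTorus (Fin d)) : ∃ a : Fin d → ZMod M, ‖q - pt a‖ ≤ 1 / M := by
  have hM : (0 : ℝ) < M := by exact_mod_cast Nat.pos_of_ne_zero (NeZero.ne M)
  obtain ⟨r, hr⟩ := exists_nat_ge (‖q - pt (0 : Fin d → ZMod M)‖ * M)
  obtain ⟨v, -, hv⟩ := exists_near_red (0 : Fin d → ZMod M) q r (by
    rw [mul_one_div, le_div_iff₀ hM]; exact hr)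
  exact ⟨_, hv⟩

/-- In a coordinate where the indices differ, the difference is a nonzero multiple of `1 / M` modulo
one, so its distance to the integers is at least one mesh. -/
theorem le_norm_pt_sub (a b : Fin d → ZMod M) (hab : a ≠ b) : 1 / (M : ℝ) ≤ ‖pt a - pt b‖ := by
  have hM : (0 : ℝ) < M := by exact_mod_cast Nat.pos_of_ne_zero (NeZero.ne M)
  obtain ⟨i, hi⟩ := Function.ne_iff.1 hab
  refine le_trans ?_ (norm_le_pi_norm (pt a - pt b) i)
  have h1 : (pt a - pt b) i = (((a i - b i).val / M : ℝ) : UnitAddCircle) := by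
    rw [← ZMod.toAddCircle_apply, map_sub]; rfl
  have h0 : (pt a - pt b) i ≠ 0 := by
    rw [Pi.sub_apply, sub_ne_zero]
    exact fun h => hi (ZMod.toAddCircle_injective M h)
  rw [h1] at h0 ⊢
  set k := (a i - b i).val
  rw [UnitAddCircle.norm_eq]
  have h2 : (k / M : ℝ) - round (k / M : ℝ) = ((k - round (k / M : ℝ) * M : ℤ) : ℝ) / M := by
    push_cast; field_simp
  rw [h2, abs_div, abs_of_pos hM]
  gcongr
  rw [← Int.cast_abs]
  have h3 : ((k : ℤ) - round (k / M : ℝ) * M : ℤ) ≠ 0 := by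
    intro h
    rw [h, Int.cast_zero, zero_div] at h2
    have h4 : ‖((k / M : ℝ) : UnitAddCircle)‖ = 0 := by rw [UnitAddCircle.norm_eq, h2, abs_zero]
    exact h0 (norm_eq_zero.1 h4)
  exact_mod_cast Int.one_le_abs h3

open Classical in
/-- The number of lattice points near a given point is bounded. -/
theorem card_filter_norm_le (q : UnitAddTorus (Fin d)) (r : ℕ) :
    (Finset.univ.filter fun a : Fin d → ZMod M => ‖q - pt a‖ ≤ r * (1 / M)).card
      ≤ (Grid.box d (2 * r + 1)).card := by
  rcases (Finset.univ.filter fun a : Fin d → ZMod M =>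
    ‖q - pt a‖ ≤ r * (1 / M)).eq_empty_or_nonempty with h | ⟨a₀, ha₀⟩
  · rw [h]; simp
  refine (Finset.card_le_card (t := (Grid.box d (2 * r + 1)).image fun v => a₀ + red M v) ?_).trans
    Finset.card_image_le
  intro a ha
  rw [Finset.mem_filter] at ha ha₀
  have h1 : ‖pt a - pt a₀‖ ≤ (2 * r : ℕ) * (1 / M) := by
    have := norm_sub_le_norm_sub_add_norm_sub (pt a) q (pt a₀)
    rw [norm_sub_rev (pt a) q] at this
    push_cast
    linarith [ha.2, ha₀.2]
  obtain ⟨v, hv, hva⟩ := exists_near_red_half a₀ (pt a) _ h1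
  refine Finset.mem_image.2 ⟨v, hv, ?_⟩
  by_contra hne
  have h2 := le_norm_pt_sub a (a₀ + red M v) (Ne.symm hne)
  have hM : (0 : ℝ) < 1 / M := by
    have : (0 : ℝ) < M := by exact_mod_cast Nat.pos_of_ne_zero (NeZero.ne M)
    positivity
  have h3 : (1 : ℝ) / 2 / M = 1 / M / 2 := by ring
  linarith

end GTG

/-! ### Local connectivity of regular configurations -/

/-- The subgraph of `G` formed by the edges inside `S`, on the same vertex type. -/
def SimpleGraph.inside {V : Type*} (G : SimpleGraph V) (S : Set V) : SimpleGraph V where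
  Adj x y := G.Adj x y ∧ x ∈ S ∧ y ∈ S
  symm := ⟨fun _ _ h => ⟨h.1.symm, h.2.2, h.2.1⟩⟩
  loopless := ⟨fun _ h => h.1.ne rfl⟩

theorem SimpleGraph.inside_mono {V : Type*} (G : SimpleGraph V) {S T : Set V} (h : S ⊆ T) :
    G.inside S ≤ G.inside T := fun _ _ hxy => ⟨hxy.1, h hxy.2.1, h hxy.2.2⟩

namespace GTG

variable {d n : ℕ} {M : ℕ}

theorem third_mesh : 1 / (3 * (M : ℝ)) = (1 / M) / 3 := by ring

variable [NeZero M]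

open Classical in
/-- The nodes of weight at least `m₀` that are close to the lattice point `a`. -/
noncomputable def cluster (ω : Config d n) (m₀ : ℝ) (a : Fin d → ZMod M) : Finset (Fin n) :=
  Finset.univ.filter fun x => m₀ ≤ (ω x).2 ∧ ‖(ω x).1 - pt a‖ ≤ 1 / (3 * M)

theorem mem_cluster {ω : Config d n} {m₀ : ℝ} {a : Fin d → ZMod M} {x : Fin n} :
    x ∈ cluster ω m₀ a ↔ m₀ ≤ (ω x).2 ∧ ‖(ω x).1 - pt a‖ ≤ 1 / (3 * M) := by
  simp [cluster]

/-- The lattice points around `a` with a populated cluster. -/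
def populated (ω : Config d n) (m₀ ℓ : ℝ) (a : Fin d → ZMod M) : Set (Fin d → ℤ) :=
  {v | ℓ ≤ ((cluster ω m₀ (a + red M v)).card : ℝ)}

/-- A radius, in units of the mesh, at which components avoiding populated clusters are
confined. -/
def trapRadius (d k₀ : ℕ) : ℕ := (k₀ ^ 2 + 1) * (2 * d * (k₀ ^ 2 + 2) + 3)

/-- The radius, in units of the mesh, of the neighbourhoods used in local arguments. -/
def localRadius (d k₀ : ℕ) : ℕ := trapRadius d k₀ + 2 * d * (k₀ ^ 2 + 2) + k₀ ^ 2 + k₀ + 2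

/-- Deterministic part of the description of a typical configuration: weights are nonnegative, nodes
at distance at most two meshes see every heavy node, and unpopulated lattice points are sparse. -/
structure Regular (ω : Config d n) (M : ℕ) [NeZero M] (θ m₀ ℓ : ℝ) (k₀ : ℕ) : Prop where
  two_le_dim : 2 ≤ d
  weight_nonneg : ∀ x, 0 ≤ (ω x).2
  theta_pos : 0 < θ
  range_le : θ * (d * (2 * (1 / M))) ^ d ≤ m₀
  one_le : 1 ≤ ℓ
  sparse : ∀ a : Fin d → ZMod M, (open Classical in
    (Grid.box d (localRadius d k₀ + 1)).filter (· ∉ populated ω m₀ ℓ a)).card ≤ k₀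

/-- Nodes within `r` meshes of the lattice point `a`. -/
def near (ω : Config d n) (a : Fin d → ZMod M) (r : ℝ) : Set (Fin n) :=
  {x | ‖(ω x).1 - pt a‖ ≤ r * (1 / M)}

section

variable {ω : Config d n} {θ m₀ ℓ : ℝ} {k₀ : ℕ}

theorem mesh_pos : 0 < 1 / (M : ℝ) := by
  have : (0 : ℝ) < M := by exact_mod_cast Nat.pos_of_ne_zero (NeZero.ne M)
  positivity

/-- The distances add up to `5/3 + 1/3 = 2` meshes in the supremum norm, so at most `d` times that
in the Euclidean one; by `range_le` the weight of `b` alone then produces the edge. -/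
theorem Regular.adj_of_toricDist_le (h : Regular ω M θ m₀ ℓ k₀) {x b : Fin n} {c : Fin d → ZMod M}
    (hb : b ∈ cluster ω m₀ c) (hx : ‖(ω x).1 - pt c‖ ≤ 5 / 3 * (1 / M)) :
    x = b ∨ (graph θ ω).Adj x b := by
  by_cases hxb : x = b
  · exact Or.inl hxb
  refine Or.inr ⟨hxb, ?_⟩
  rw [mem_cluster, third_mesh] at hb
  have h1 : ‖(ω x).1 - (ω b).1‖ ≤ 2 * (1 / M) := by
    have := norm_sub_le_norm_sub_add_norm_sub (ω x).1 (pt c) (ω b).1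
    rw [norm_sub_rev (pt c)] at this
    linarith
  have h2 : toricDist (ω x).1 (ω b).1 ≤ d * (2 * (1 / M)) :=
    (toricDist_le_mul_norm _ _).trans (by gcongr)
  have h3 : θ * toricDist (ω x).1 (ω b).1 ^ d ≤ θ * (d * (2 * (1 / M))) ^ d :=
    mul_le_mul_of_nonneg_left (pow_le_pow_left₀ (toricDist_nonneg _ _) h2 d) h.theta_pos.le
  have := h.range_le
  have := h.weight_nonneg x
  linarith

theorem cluster_nonempty (hℓ : 1 ≤ ℓ) {a : Fin d → ZMod M} {v : Fin d → ℤ}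
    (hv : v ∈ populated ω m₀ ℓ a) : (cluster ω m₀ (a + red M v)).Nonempty := by
  rw [← Finset.card_pos]
  have : (1 : ℝ) ≤ _ := hℓ.trans hv
  exact_mod_cast this

theorem cluster_subset_near {a : Fin d → ZMod M} {v : Fin d → ℤ} {r : ℕ} (hv : v ∈ Grid.box d r)
    {b : Fin n} (hb : b ∈ cluster ω m₀ (a + red M v)) : b ∈ near ω a (r + 1) := by
  rw [mem_cluster, third_mesh] at hb
  have h1 := norm_pt_add_red_sub_le a v r hv
  have h2 := norm_sub_le_norm_sub_add_norm_sub (ω b).1 (pt (a + red M v)) (pt a)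
  have h3 := mesh_pos (M := M)
  change ‖(ω b).1 - pt a‖ ≤ ((r : ℝ) + 1) * (1 / M)
  linarith

theorem norm_pt_sub_pt_le_of_adj {P : Set (Fin d → ℤ)} (a : Fin d → ZMod M) {u v : Fin d → ℤ}
    (huv : (Grid.nnGraph P).Adj u v) : ‖pt (a + red M u) - pt (a + red M v)‖ ≤ 1 / M := by
  obtain ⟨-, -, j, hj | hj⟩ := huv
  · rw [hj, red_add, ← add_assoc, norm_sub_rev]
    simpa using norm_pt_add_red_sub_le (a + red M u) _ 1 (single_mem_box j)
  · rw [hj, red_add, ← add_assoc]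
    simpa using norm_pt_add_red_sub_le (a + red M v) _ 1 (single_mem_box j)

theorem Regular.eq_or_adj_of_nnGraph_adj (h : Regular ω M θ m₀ ℓ k₀) {P : Set (Fin d → ℤ)}
    (a : Fin d → ZMod M) {u v : Fin d → ℤ} (huv : (Grid.nnGraph P).Adj u v)
    {b b' : Fin n} (hb : b ∈ cluster ω m₀ (a + red M u)) (hb' : b' ∈ cluster ω m₀ (a + red M v)) :
    b = b' ∨ (graph θ ω).Adj b b' := by
  refine h.adj_of_toricDist_le hb' ?_
  rw [mem_cluster, third_mesh] at hb
  have h2 := norm_sub_le_norm_sub_add_norm_sub (ω b).1 (pt (a + red M u)) (pt (a + red M v))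
  have h3 := norm_pt_sub_pt_le_of_adj a huv
  have := mesh_pos (M := M)
  linarith

theorem Regular.eq_or_adj_of_mem_cluster (h : Regular ω M θ m₀ ℓ k₀) {c : Fin d → ZMod M}
    {b b' : Fin n} (hb : b ∈ cluster ω m₀ c) (hb' : b' ∈ cluster ω m₀ c) :
    b = b' ∨ (graph θ ω).Adj b b' := by
  refine h.adj_of_toricDist_le hb' ?_
  rw [mem_cluster, third_mesh] at hb
  have := mesh_pos (M := M)
  linarith

theorem reachable_of_eq_or_adj {S : Set (Fin n)} {x y : Fin n} (hx : x ∈ S) (hy : y ∈ S)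
    (h : x = y ∨ (graph θ ω).Adj x y) : ((graph θ ω).inside S).Reachable x y := by
  rcases h with rfl | h
  · rfl
  · exact SimpleGraph.Adj.reachable ⟨h, hx, hy⟩

/-- A lattice path through populated points lifts to a walk by picking one node in each cluster it
visits. -/
theorem Regular.reachable_clusters (h : Regular ω M θ m₀ ℓ k₀) (a : Fin d → ZMod M) (r : ℕ)
    {u v : Fin d → ℤ} (hu : u ∈ Grid.box d r)
    (huv : (Grid.nnGraph (populated ω m₀ ℓ a ∩ Grid.box d r)).Reachable u v) {b b' : Fin n}
    (hb : b ∈ cluster ω m₀ (a + red M u)) (hb' : b' ∈ cluster ω m₀ (a + red M v)) :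
    ((graph θ ω).inside (near ω a (r + 1))).Reachable b b' := by
  obtain ⟨p⟩ := huv
  induction p generalizing b with
  | nil =>
    exact reachable_of_eq_or_adj (cluster_subset_near hu hb) (cluster_subset_near hu hb')
      (h.eq_or_adj_of_mem_cluster hb hb')
  | cons hadj p ih =>
    obtain ⟨b₁, hb₁⟩ := cluster_nonempty h.one_le hadj.2.1.1
    have hw := hadj.2.1.2
    exact (reachable_of_eq_or_adj (cluster_subset_near hu hb) (cluster_subset_near hw hb₁)
      (h.eq_or_adj_of_nnGraph_adj a hadj hb hb₁)).trans (ih hw hb₁ hb')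

/-! ### Crossing points and the core of a local box -/

/-- `t` is a crossing point of populated slabs of the cube of radius `localRadius d k₀` around
`a`. -/
structure IsCrossing (ω : Config d n) (m₀ ℓ : ℝ) (k₀ : ℕ) (a : Fin d → ZMod M)
    (t : Fin d → ℤ) : Prop where
  mem_Icc : ∀ i, 0 ≤ t i ∧ t i ≤ k₀
  slab : ∀ i, ∀ v ∈ Grid.box d (localRadius d k₀), v i = t i → v ∈ populated ω m₀ ℓ a

open Classical in
theorem Regular.sparse' (h : Regular ω M θ m₀ ℓ k₀) (a : Fin d → ZMod M) :
    ((Grid.box d (localRadius d k₀)).filter (· ∉ populated ω m₀ ℓ a)).card ≤ k₀ := by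
  refine (Finset.card_le_card ?_).trans (h.sparse a)
  intro v hv
  rw [Finset.mem_filter] at *
  exact ⟨Grid.box_mono (Nat.le_succ _) hv.1, hv.2⟩

theorem Regular.exists_isCrossing (h : Regular ω M θ m₀ ℓ k₀) (a : Fin d → ZMod M) :
    ∃ t, IsCrossing ω m₀ ℓ k₀ a t := by
  choose t ht0 ht1 ht using fun i => Grid.exists_slab_subset _ _ _ (h.sparse' a) i
  exact ⟨t, fun i => ⟨ht0 i, ht1 i⟩, ht⟩

theorem le_localRadius (d k₀ : ℕ) : k₀ + 1 ≤ localRadius d k₀ := by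
  unfold localRadius; omega

theorem IsCrossing.mem_box {a : Fin d → ZMod M} {t : Fin d → ℤ} (ht : IsCrossing ω m₀ ℓ k₀ a t) :
    t ∈ Grid.box d (localRadius d k₀) := by
  rw [Grid.mem_box]
  intro k
  have := ht.mem_Icc k
  have := le_localRadius d k₀
  omega

theorem IsCrossing.mem_populated (hd : 2 ≤ d) {a : Fin d → ZMod M} {t : Fin d → ℤ}
    (ht : IsCrossing ω m₀ ℓ k₀ a t) : t ∈ populated ω m₀ ℓ a :=
  ht.slab ⟨0, by omega⟩ t ht.mem_box rfl

/-- The points of the cube connected to the crossing point. -/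
def core (ω : Config d n) (m₀ ℓ : ℝ) (k₀ : ℕ) (a : Fin d → ZMod M) (t : Fin d → ℤ) :
    Set (Fin d → ℤ) :=
  {v | (Grid.nnGraph (populated ω m₀ ℓ a ∩ Grid.box d (localRadius d k₀))).Reachable t v}

theorem IsCrossing.core_subset (hd : 2 ≤ d) {a : Fin d → ZMod M} {t : Fin d → ℤ}
    (ht : IsCrossing ω m₀ ℓ k₀ a t) :
    core ω m₀ ℓ k₀ a t ⊆ populated ω m₀ ℓ a ∩ Grid.box d (localRadius d k₀) :=
  fun _ hv => Grid.nnGraph_mem_of_reachable ⟨ht.mem_populated hd, ht.mem_box⟩ hv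

open Classical in
theorem Regular.card_not_core_le (h : Regular ω M θ m₀ ℓ k₀) {a : Fin d → ZMod M} {t : Fin d → ℤ}
    (ht : IsCrossing ω m₀ ℓ k₀ a t) :
    ((Grid.box d (localRadius d k₀)).filter (· ∉ core ω m₀ ℓ k₀ a t)).card ≤ k₀ ^ 2 :=
  Grid.card_not_reachable_le h.two_le_dim _ _ _ (by have := le_localRadius d k₀; omega)
    (h.sparse' a) t ht.mem_Icc ht.slab

/-- Among `k₀ ^ 2 + 1` consecutive lattice points on a line starting within one mesh of `q`, at
least one belongs to the core, because fewer points are missing. The bound on `r` keeps this segment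
inside the local box. -/
theorem Regular.exists_core_near (h : Regular ω M θ m₀ ℓ k₀) {a : Fin d → ZMod M} {t : Fin d → ℤ}
    (ht : IsCrossing ω m₀ ℓ k₀ a t) (q : UnitAddTorus (Fin d)) (r : ℕ)
    (hr : r + 1 + k₀ ^ 2 ≤ localRadius d k₀) (hq : ‖q - pt a‖ ≤ r * (1 / M)) :
    ∃ v ∈ core ω m₀ ℓ k₀ a t, ‖q - pt (a + red M v)‖ ≤ (k₀ ^ 2 + 1 : ℕ) * (1 / M) := by
  classical
  obtain ⟨v₀, hv₀, hv₀q⟩ := exists_near_red a q r hq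
  let i₀ : Fin d := ⟨0, by have := h.two_le_dim; omega⟩
  by_contra! hcon
  have hmap : ∀ k ∈ Finset.range (k₀ ^ 2 + 1), v₀ + Pi.single i₀ (k : ℤ) ∈
      (Grid.box d (localRadius d k₀)).filter (· ∉ core ω m₀ ℓ k₀ a t) := by
    intro k hk
    rw [Finset.mem_range] at hk
    have hkb : (Pi.single i₀ (k : ℤ) : Fin d → ℤ) ∈ Grid.box d k := by
      rw [Grid.mem_box]; intro j
      rw [Pi.single_apply]; split_ifs <;> omega
    refine Finset.mem_filter.2 ⟨?_, fun hc => ?_⟩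
    · rw [Grid.mem_box] at *
      intro j
      have h1 := hv₀ j
      have h2 := hkb j
      rw [Pi.add_apply]
      push_cast at h1
      omega
    · refine absurd ?_ (not_le.2 (hcon _ hc))
      have h1 := norm_pt_add_red_sub_le (a + red M v₀) _ k hkb
      rw [red_add, ← add_assoc]
      have h2 := norm_sub_le_norm_sub_add_norm_sub q (pt (a + red M v₀))
        (pt (a + red M v₀ + red M (Pi.single i₀ (k : ℤ))))
      rw [norm_sub_rev (pt (a + red M v₀))] at h2
      have h3 := mesh_pos (M := M)
      have h4 : (k : ℝ) ≤ k₀ ^ 2 := by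
        have : k ≤ k₀ ^ 2 := by omega
        exact_mod_cast this
      push_cast
      nlinarith
  have hinj : Set.InjOn (fun k : ℕ => v₀ + Pi.single i₀ (k : ℤ))
      (Finset.range (k₀ ^ 2 + 1) : Set ℕ) := by
    intro k _ k' _ hkk
    have := congrFun (add_left_cancel hkk) i₀
    simpa using this
  have := Finset.card_le_card_of_injOn _ hmap hinj
  have h2 := h.card_not_core_le ht
  rw [Finset.card_range] at this
  omega

/-- Nodes linked to all heavy nodes of some core lattice point. -/
def attached (ω : Config d n) (θ m₀ ℓ : ℝ) (k₀ : ℕ) (a : Fin d → ZMod M) (t : Fin d → ℤ) :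
    Set (Fin n) :=
  {x | ∃ v ∈ core ω m₀ ℓ k₀ a t, ∀ b ∈ cluster ω m₀ (a + red M v), x = b ∨ (graph θ ω).Adj x b}

theorem Regular.reachable_of_attached (h : Regular ω M θ m₀ ℓ k₀) {a : Fin d → ZMod M}
    {t : Fin d → ℤ} (ht : IsCrossing ω m₀ ℓ k₀ a t) {x : Fin n}
    (hx : x ∈ attached ω θ m₀ ℓ k₀ a t) {b : Fin n} (hb : b ∈ cluster ω m₀ (a + red M t)) :
    ((graph θ ω).inside (near ω a (localRadius d k₀ + 1) ∪ {x})).Reachable x b := by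
  obtain ⟨v, hv, hvx⟩ := hx
  have hvp := ht.core_subset h.two_le_dim hv
  obtain ⟨b₁, hb₁⟩ := cluster_nonempty h.one_le hvp.1
  have h1 : ((graph θ ω).inside (near ω a (localRadius d k₀ + 1) ∪ {x})).Reachable x b₁ :=
    reachable_of_eq_or_adj (Or.inr rfl) (Or.inl (cluster_subset_near hvp.2 hb₁)) (hvx b₁ hb₁)
  have h2 := h.reachable_clusters a (localRadius d k₀) ht.mem_box hv hb hb₁
  exact h1.trans (h2.symm.mono (SimpleGraph.inside_mono _ Set.subset_union_left))

/-- An edge leaving an unattached node either is short or leads to an attached node. -/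
theorem Regular.norm_le_of_not_attached (h : Regular ω M θ m₀ ℓ k₀) {a : Fin d → ZMod M}
    {t : Fin d → ℤ} (ht : IsCrossing ω m₀ ℓ k₀ a t) {x x' : Fin n}
    (hx : x ∉ attached ω θ m₀ ℓ k₀ a t) (hxa : ‖(ω x).1 - pt a‖ ≤ trapRadius d k₀ * (1 / M))
    (hadj : (graph θ ω).Adj x x') (hx' : x' ∉ attached ω θ m₀ ℓ k₀ a t) :
    ‖(ω x').1 - (ω x).1‖ ≤ (2 * d * (k₀ ^ 2 + 2) : ℕ) * (1 / M) := by
  -- A bound for the toric distance from a point to the nodes of a nearby core cluster: `k₀ ^ 2 + 1`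
  -- meshes to the lattice point, one third of a mesh inside the cluster, and the factor `d` for the
  -- Euclidean norm.
  set η : ℝ := d * ((k₀ ^ 2 + 2 : ℕ) * (1 / M)) with hη
  have hs := mesh_pos (M := M)
  have hη0 : 0 < η := by
    have : (0 : ℝ) < d := by have := h.two_le_dim; positivity
    positivity
  have hclose : ∀ (q : UnitAddTorus (Fin d)) (v : Fin d → ℤ) (b : Fin n),
      ‖q - pt (a + red M v)‖ ≤ (k₀ ^ 2 + 1 : ℕ) * (1 / M) → b ∈ cluster ω m₀ (a + red M v) →
      toricDist q (ω b).1 ≤ η := by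
    intro q v b hq hb
    refine (toricDist_le_mul_norm _ _).trans ?_
    rw [hη]
    gcongr
    rw [mem_cluster, third_mesh] at hb
    have h2 := norm_sub_le_norm_sub_add_norm_sub q (pt (a + red M v)) (ω b).1
    rw [norm_sub_rev (pt (a + red M v))] at h2
    push_cast at *
    linarith
  have hdpos : 0 < d := by have := h.two_le_dim; omega
  have hm₀ : 0 < m₀ := lt_of_lt_of_le (by
    have : (0 : ℝ) < d := by exact_mod_cast hdpos
    have := h.theta_pos
    positivity) h.range_le
  -- A node of weight at least `θ * η ^ d` would reach a whole core cluster on its own and be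
  -- attached.
  have hwx : (ω x).2 < θ * η ^ d := by
    by_contra! hcon
    obtain ⟨v, hv, hvx⟩ := h.exists_core_near ht (ω x).1 (trapRadius d k₀)
      (by unfold localRadius; omega) hxa
    refine hx ⟨v, hv, fun b hb => ?_⟩
    by_cases hxb : x = b
    · exact Or.inl hxb
    refine Or.inr ⟨hxb, ?_⟩
    have h1 := pow_le_pow_left₀ (toricDist_nonneg _ _) (hclose _ v b hvx hb) d
    have h2 := mul_le_mul_of_nonneg_left h1 h.theta_pos.le
    have := h.weight_nonneg b
    linarith
  have h2η : 2 * η = (2 * d * (k₀ ^ 2 + 2) : ℕ) * (1 / M) := by rw [hη]; push_cast; ring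
  rw [← h2η, norm_sub_rev]
  refine (norm_sub_le_toricDist _ _).trans ?_
  by_contra! hlong
  apply hx'
  set D := toricDist (ω x).1 (ω x').1 with hD
  have hD0 : 0 < D := by linarith
  -- The point at distance `2 * η` from `x` towards `x'`: it is still in the local box, and a core
  -- cluster within `η` of it is closer to `x'` than `x` is, by at least `η`.
  obtain ⟨q, hq1, hq2⟩ := exists_point_on_geodesic (ω x).1 (ω x').1 (2 * η / D)
    (by positivity) (by rw [div_le_one hD0]; exact hlong.le)
  rw [← hD] at hq1 hq2
  have hq1' : toricDist (ω x).1 q ≤ 2 * η := by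
    refine hq1.trans (le_of_eq ?_); field_simp
  have hq2' : toricDist q (ω x').1 ≤ D - 2 * η := by
    refine hq2.trans (le_of_eq ?_); field_simp
  obtain ⟨v, hv, hvq⟩ := h.exists_core_near ht q (trapRadius d k₀ + 2 * d * (k₀ ^ 2 + 2))
    (by unfold localRadius; omega) (by
      have h1 := norm_sub_le_norm_sub_add_norm_sub q (ω x).1 (pt a)
      rw [norm_sub_rev q (ω x).1] at h1
      have h2 := norm_sub_le_toricDist (ω x).1 q
      rw [Nat.cast_add, add_mul, ← h2η]
      linarith)
  refine ⟨v, hv, fun b hb => ?_⟩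
  by_cases hxb : x' = b
  · exact Or.inl hxb
  refine Or.inr ⟨hxb, ?_⟩
  have h1 : toricDist (ω x').1 (ω b).1 ≤ D - η := by
    have h1 := toricDist_triangle (ω x').1 q (ω b).1
    have h2 := hclose q v b hvq hb
    rw [toricDist_comm (ω x').1 q] at h1
    linarith
  -- By `(D - η) ^ d ≤ D ^ d - η ^ d`, the distance gained compensates for the loss of the weight of
  -- `x`, which is below `θ * η ^ d`. The edge from `x` to `x'` therefore forces one from `x'` to
  -- `b`.
  have h2 : toricDist (ω x').1 (ω b).1 ^ d ≤ D ^ d - η ^ d := by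
    obtain ⟨k, rfl⟩ : ∃ k, d = k + 1 := ⟨d - 1, by omega⟩
    calc toricDist (ω x').1 (ω b).1 ^ (k + 1) ≤ (D - η) ^ (k + 1) :=
          pow_le_pow_left₀ (toricDist_nonneg _ _) h1 _
      _ = (D - η) ^ k * (D - η) := pow_succ _ _
      _ ≤ D ^ k * (D - η) := by
          refine mul_le_mul_of_nonneg_right ?_ (by linarith)
          exact pow_le_pow_left₀ (by linarith) (by linarith) _
      _ = D ^ (k + 1) - D ^ k * η := by ring
      _ ≤ D ^ (k + 1) - η ^ k * η := by
          have := pow_le_pow_left₀ hη0.le (by linarith : η ≤ D) k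
          have := mul_le_mul_of_nonneg_right this hη0.le
          linarith
      _ = _ := by rw [← pow_succ]
  have h3 := mul_le_mul_of_nonneg_left h2 h.theta_pos.le
  have h4 := hadj.2
  rw [← hD] at h4
  have := (mem_cluster.1 hb).1
  rw [mul_sub] at h3
  linarith

open Classical in
/-- Some annulus around `a` contains no unattached node. -/
theorem Regular.exists_empty_annulus (h : Regular ω M θ m₀ ℓ k₀) {a : Fin d → ZMod M}
    {t : Fin d → ℤ} (ht : IsCrossing ω m₀ ℓ k₀ a t) :
    ∃ r : ℕ, 1 ≤ r ∧ r + 2 * d * (k₀ ^ 2 + 2) ≤ trapRadius d k₀ ∧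
      ∀ x : Fin n, r * (1 / (M : ℝ)) < ‖(ω x).1 - pt a‖ →
        ‖(ω x).1 - pt a‖ ≤ (r + 2 * d * (k₀ ^ 2 + 2) : ℕ) * (1 / M) →
        x ∈ attached ω θ m₀ ℓ k₀ a t := by
  by_contra! hcon
  set R := 2 * d * (k₀ ^ 2 + 2) with hR
  have hs := mesh_pos (M := M)
  -- `trapRadius` has room for `k₀ ^ 2 + 1` annuli of width `R` separated by gaps of three meshes.
  have hr : ∀ j : Fin (k₀ ^ 2 + 1), (j : ℕ) * (R + 3) + 1 + R ≤ trapRadius d k₀ := by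
    intro j
    have h1 : (j : ℕ) * (R + 3) ≤ k₀ ^ 2 * (R + 3) :=
      Nat.mul_le_mul_right _ (Nat.lt_succ_iff.1 j.2)
    have h2 : trapRadius d k₀ = k₀ ^ 2 * (R + 3) + (R + 3) := by rw [trapRadius, ← hR]; ring
    omega
  -- An unattached node in an annulus has a lattice point within one mesh, and this point is outside
  -- the core since otherwise the node would be attached.
  have hx : ∀ j : Fin (k₀ ^ 2 + 1), ∃ x : Fin n, ∃ v ∈ (Grid.box d (localRadius d k₀)).filter
      (· ∉ core ω m₀ ℓ k₀ a t), ((j : ℕ) * (R + 3) + 1 : ℕ) * (1 / (M : ℝ)) < ‖(ω x).1 - pt a‖ ∧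
        ‖(ω x).1 - pt a‖ ≤ ((j : ℕ) * (R + 3) + 1 + R : ℕ) * (1 / M) ∧
        ‖(ω x).1 - pt (a + red M v)‖ ≤ 1 / M := by
    intro j
    obtain ⟨x, hx1, hx2, hx3⟩ := hcon ((j : ℕ) * (R + 3) + 1) (by omega) (hr j)
    obtain ⟨v, hv, hxv⟩ := exists_near_red a (ω x).1 _ hx2
    refine ⟨x, v, Finset.mem_filter.2 ⟨Grid.box_mono ?_ hv, fun hvc => hx3 ⟨v, hvc, fun b hb => ?_⟩⟩,
      hx1, hx2, hxv⟩
    · have := hr j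
      unfold localRadius
      omega
    · refine h.adj_of_toricDist_le hb (hxv.trans ?_)
      linarith
  choose x v hv hx1 hx2 hxv using hx
  -- A shared lattice point would put the two nodes within two meshes of each other, against the gap
  -- of three. Hence there would be `k₀ ^ 2 + 1` distinct points outside the core.
  have hlt : ∀ j j', j < j' → v j ≠ v j' := by
    intro j j' hjj heq
    have h1 := hxv j
    have h2 := hxv j'
    rw [heq] at h1
    have h3 := norm_sub_le_norm_sub_add_norm_sub (ω (x j')).1 (pt (a + red M (v j'))) (pt a)
    have h4 := norm_sub_le_norm_sub_add_norm_sub (pt (a + red M (v j'))) (ω (x j)).1 (pt a)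
    rw [norm_sub_rev _ (ω (x j)).1] at h4
    have h5 := hx1 j'
    have h6 := hx2 j
    have h7 : (j : ℕ) * (R + 3) + 1 + R + 3 ≤ (j' : ℕ) * (R + 3) + 1 := by
      have : ((j : ℕ) + 1) * (R + 3) ≤ (j' : ℕ) * (R + 3) := Nat.mul_le_mul_right _ hjj
      rw [add_mul] at this
      omega
    have h8 : (((j : ℕ) * (R + 3) + 1 + R : ℕ) : ℝ) + 3 ≤ ((j' : ℕ) * (R + 3) + 1 : ℕ) := by
      exact_mod_cast h7
    have h9 := mul_le_mul_of_nonneg_right h8 hs.le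
    rw [add_mul] at h9
    linarith
  have hinj : Function.Injective v := by
    intro j j' hjj
    rcases lt_trichotomy j j' with hlt' | rfl | hlt'
    · exact absurd hjj (hlt _ _ hlt')
    · rfl
    · exact absurd hjj.symm (hlt _ _ hlt')
  have hc := Finset.card_le_card_of_injOn (s := Finset.univ) v (fun j _ => hv j) hinj.injOn
  have h2 := h.card_not_core_le ht
  rw [Finset.card_univ, Fintype.card_fin] at hc
  omega

/-- Every node close to `a` is connected to the crossing cluster through nodes close to `a` and at
most one further node. -/
theorem Regular.exists_reachable (h : Regular ω M θ m₀ ℓ k₀) (hG : (graph θ ω).Connected)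
    {a : Fin d → ZMod M} {t : Fin d → ℤ} (ht : IsCrossing ω m₀ ℓ k₀ a t) {y : Fin n}
    (hy : ‖(ω y).1 - pt a‖ ≤ 1 / M) :
    ∃ u, ∀ b ∈ cluster ω m₀ (a + red M t),
      ((graph θ ω).inside (near ω a (localRadius d k₀ + 1) ∪ {u})).Reachable y b := by
  by_cases hya : y ∈ attached ω θ m₀ ℓ k₀ a t
  · exact ⟨y, fun b hb => h.reachable_of_attached ht hya hb⟩
  obtain ⟨r, hr1, hr2, hr⟩ := h.exists_empty_annulus ht
  have hs := mesh_pos (M := M)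
  set S : Set (Fin n) := {x | x ∉ attached ω θ m₀ ℓ k₀ a t ∧ ‖(ω x).1 - pt a‖ ≤ r * (1 / M)}
  have hSnear : S ⊆ near ω a (localRadius d k₀ + 1) := by
    intro x hx
    refine hx.2.trans ?_
    gcongr
    have : r ≤ localRadius d k₀ + 1 := by unfold localRadius; omega
    exact_mod_cast this
  have hyS : y ∈ S := by
    refine ⟨hya, hy.trans ?_⟩
    have : (1 : ℝ) ≤ r := by exact_mod_cast hr1
    nlinarith
  -- An edge between unattached nodes spans at most the width of the empty annulus, so it cannot
  -- jump across it.
  have hclosed : ∀ x ∈ S, ∀ x', (graph θ ω).Adj x x' → x' ∉ attached ω θ m₀ ℓ k₀ a t → x' ∈ S := by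
    intro x hx x' hxx' hx'
    have h1 := h.norm_le_of_not_attached ht hx.1 (hx.2.trans (by
      gcongr
      have : r ≤ trapRadius d k₀ := by omega
      exact_mod_cast this)) hxx' hx'
    refine ⟨hx', ?_⟩
    by_contra! hcon
    refine hx' (hr x' hcon ?_)
    have h2 := norm_sub_le_norm_sub_add_norm_sub (ω x').1 (ω x).1 (pt a)
    have h3 := hx.2
    rw [Nat.cast_add, add_mul]
    linarith
  set K : Set (Fin n) := {x | x ∈ S ∧ ((graph θ ω).inside S).Reachable y x} with hK
  obtain ⟨b₀, hb₀⟩ := cluster_nonempty h.one_le (ht.mem_populated h.two_le_dim)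
  have hb₀a : b₀ ∈ attached ω θ m₀ ℓ k₀ a t :=
    ⟨t, SimpleGraph.Reachable.refl _, fun b hb => h.eq_or_adj_of_mem_cluster hb₀ hb⟩
  -- Connectivity of the whole graph provides an edge leaving the trapped component `K` of `y`. By
  -- closedness its far end is attached; it is the only node of the path that may lie far from `a`.
  obtain ⟨p⟩ := hG.preconnected y b₀
  obtain ⟨e, -, he1, he2⟩ := p.exists_boundary_dart K ⟨hyS, SimpleGraph.Reachable.refl _⟩
    (fun hb => hb.1.1 hb₀a)
  have heS := he1.1
  have hua : e.snd ∈ attached ω θ m₀ ℓ k₀ a t := by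
    by_contra hcon
    have h2 := hclosed _ heS _ e.adj hcon
    exact he2 ⟨h2, he1.2.trans (SimpleGraph.Adj.reachable ⟨e.adj, heS, h2⟩)⟩
  refine ⟨e.snd, fun b hb => ?_⟩
  have h1 : ((graph θ ω).inside (near ω a (localRadius d k₀ + 1) ∪ {e.snd})).Reachable y e.fst :=
    he1.2.mono (SimpleGraph.inside_mono _ (hSnear.trans Set.subset_union_left))
  have h2 : ((graph θ ω).inside (near ω a (localRadius d k₀ + 1) ∪ {e.snd})).Reachable e.fst e.snd :=
    SimpleGraph.Adj.reachable ⟨e.adj, Or.inl (hSnear heS), Or.inr rfl⟩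
  exact (h1.trans h2).trans (h.reachable_of_attached ht hua hb)

end

end GTG

/-! ### Poincaré inequalities for regular configurations -/

theorem Finset.sum_sum_sq_sub {ι : Type*} (B : Finset ι) (f : ι → ℝ) :
    ∑ x ∈ B, ∑ y ∈ B, (f x - f y) ^ 2 = 2 * B.card * ∑ x ∈ B, f x ^ 2 - 2 * (∑ x ∈ B, f x) ^ 2 := by
  have : ∀ x y, (f x - f y) ^ 2 = f x ^ 2 + f y ^ 2 - 2 * (f x * f y) := fun x y => by ring
  simp_rw [this, Finset.sum_sub_distrib, Finset.sum_add_distrib, Finset.sum_const, nsmul_eq_mul,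
    ← Finset.mul_sum, ← Finset.sum_mul]
  ring

/-- The mean of `f` over a finite set. -/
noncomputable def Finset.mean {ι : Type*} (B : Finset ι) (f : ι → ℝ) : ℝ := (∑ x ∈ B, f x) / B.card

theorem Finset.sq_mean_sub_mean_le {ι : Type*} (B B' : Finset ι) (hB : B.Nonempty)
    (hB' : B'.Nonempty) (f : ι → ℝ) :
    (B.mean f - B'.mean f) ^ 2 ≤ (∑ x ∈ B, ∑ y ∈ B', (f x - f y) ^ 2) / (B.card * B'.card) := by
  have h1 : (0 : ℝ) < B.card := by exact_mod_cast hB.card_pos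
  have h2 : (0 : ℝ) < B'.card := by exact_mod_cast hB'.card_pos
  have h3 : B.mean f - B'.mean f = (∑ x ∈ B, ∑ y ∈ B', (f x - f y)) / (B.card * B'.card) := by
    simp_rw [Finset.sum_sub_distrib, Finset.sum_const, nsmul_eq_mul, ← Finset.mul_sum]
    unfold Finset.mean
    field_simp
  have h4 : (∑ x ∈ B, ∑ y ∈ B', (f x - f y)) ^ 2
      ≤ (B.card * B'.card) * ∑ x ∈ B, ∑ y ∈ B', (f x - f y) ^ 2 := by
    rw [← Finset.sum_product', ← Finset.sum_product']
    have := sq_sum_le_card_mul_sum_sq (s := B ×ˢ B') (f := fun q => f q.1 - f q.2)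
    rwa [Finset.card_product, Nat.cast_mul] at this
  rw [h3, div_pow, div_le_div_iff₀ (by positivity) (by positivity)]
  calc _ ≤ _ := mul_le_mul_of_nonneg_right h4 (by positivity)
    _ = _ := by ring

namespace GTG

variable {d n : ℕ} {M : ℕ} [NeZero M] {ω : Config d n} {θ m₀ ℓ : ℝ} {k₀ : ℕ}

open Classical in
/-- Charging each edge to its lighter endpoint bounds degree-weighted sums by plain sums. -/
theorem sum_degree_mul_sq_le (ω : Config d n) (θ N : ℝ)
    (hN : ∀ x, ((Finset.univ.filter fun y => (graph θ ω).Adj x y ∧ (ω x).2 ≤ (ω y).2).card : ℝ) ≤ N)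
    (h : Fin n → ℝ) :
    ∑ x, ((graph θ ω).degree x : ℝ) * h x ^ 2 ≤ (graph θ ω).energy h + 3 * N * ∑ x, h x ^ 2 := by
  set G := graph θ ω
  set I : Fin n → Fin n → ℝ := fun x y => if G.Adj x y then 1 else 0
  set J : Fin n → Fin n → ℝ := fun x y => if G.Adj x y ∧ (ω x).2 ≤ (ω y).2 then 1 else 0
  have hI : ∀ x y, I x y = I y x := fun x y => by simp only [I, G.adj_comm]
  have h1 : ∑ x, (G.degree x : ℝ) * h x ^ 2 = ∑ x, ∑ y, I x y * h x ^ 2 := by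
    simp_rw [SimpleGraph.degree_eq_sum_ite, Finset.sum_mul]; rfl
  have h2 : ∑ x, (G.degree x : ℝ) * h x ^ 2 = ∑ x, ∑ y, I x y * h y ^ 2 := by
    rw [h1, Finset.sum_comm]; simp_rw [hI]
  have hJ : ∑ x, ∑ y, J x y * h x ^ 2 ≤ N * ∑ x, h x ^ 2 := by
    rw [Finset.mul_sum]
    refine Finset.sum_le_sum fun x _ => ?_
    rw [← Finset.sum_mul]
    refine mul_le_mul_of_nonneg_right ?_ (sq_nonneg _)
    simp only [J, Finset.sum_boole]
    exact hN x
  have hJ' : ∑ x, ∑ y, J y x * h y ^ 2 ≤ N * ∑ x, h x ^ 2 := by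
    rw [Finset.sum_comm]; exact hJ
  have h3 : ∑ x, ∑ y, I x y * h x ^ 2 + ∑ x, ∑ y, I x y * h y ^ 2
      ≤ 2 * G.energy h + 3 * (∑ x, ∑ y, J x y * h x ^ 2 + ∑ x, ∑ y, J y x * h y ^ 2) := by
    unfold SimpleGraph.energy
    simp_rw [Finset.mul_sum, ← Finset.sum_add_distrib, Finset.mul_sum]
    rw [← Finset.sum_add_distrib]
    simp_rw [← Finset.sum_add_distrib]
    -- On an edge with lighter value `p` and heavier value `q`, `p ^ 2 + q ^ 2 ≤ 2 * (p - q) ^ 2 + 3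
    -- * p ^ 2`, the difference being the square of `2 * p - q`. Only the lighter endpoint is
    -- charged.
    refine Finset.sum_le_sum fun x _ => Finset.sum_le_sum fun y _ => ?_
    by_cases hxy : G.Adj x y
    · simp only [I, J, hxy, hxy.symm, true_and, if_true, one_mul]
      rcases le_total (ω x).2 (ω y).2 with hw | hw
      · simp only [hw, if_true, one_mul]
        split_ifs <;> nlinarith [sq_nonneg (h x), sq_nonneg (h y), sq_nonneg (2 * h x - h y)]
      · simp only [hw, if_true, one_mul]
        split_ifs <;> nlinarith [sq_nonneg (h x), sq_nonneg (h y), sq_nonneg (2 * h y - h x)]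
    · have hyx : ¬ G.Adj y x := fun h => hxy h.symm
      simp [I, J, hxy, hyx]
  linarith

open Classical in
/-- The finite set of nodes near `a` used in local sums. -/
noncomputable def nearFinset (ω : Config d n) (k₀ : ℕ) (a : Fin d → ZMod M) : Finset (Fin n) :=
  Finset.univ.filter fun x => ‖(ω x).1 - pt a‖ ≤ (localRadius d k₀ + 3 : ℕ) * (1 / M)

open Classical in
/-- Sum of `F` over the ordered adjacent pairs whose first node is near `a`. -/
noncomputable def localSum (ω : Config d n) (θ : ℝ) (k₀ : ℕ) (a : Fin d → ZMod M)
    (F : Fin n → Fin n → ℝ) : ℝ :=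
  ∑ x ∈ nearFinset ω k₀ a, ∑ y, if (graph θ ω).Adj x y then F x y else 0

/-- The bound on the number of lattice points near a point. -/
noncomputable def overlap (d k₀ : ℕ) : ℕ := (Grid.box d (2 * (localRadius d k₀ + 3) + 1)).card

open Classical in
-- Exchange the sums: each node is near at most `overlap d k₀` lattice points, so the local energies
-- overlap boundedly.
theorem sum_localSum_le (ω : Config d n) (M : ℕ) [NeZero M] (θ : ℝ) (k₀ : ℕ)
    (F : Fin n → Fin n → ℝ) (hF : ∀ x y, 0 ≤ F x y) :
    ∑ a : Fin d → ZMod M, localSum ω θ k₀ a F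
      ≤ overlap d k₀ * ∑ x, ∑ y, if (graph θ ω).Adj x y then F x y else 0 := by
  unfold localSum nearFinset
  simp_rw [Finset.sum_filter]
  rw [Finset.sum_comm, Finset.mul_sum]
  refine Finset.sum_le_sum fun x _ => ?_
  rw [← Finset.sum_filter, Finset.sum_const, nsmul_eq_mul]
  refine mul_le_mul_of_nonneg_right ?_ (Finset.sum_nonneg fun y _ => by split_ifs; exacts [hF x y, le_rfl])
  exact_mod_cast card_filter_norm_le (ω x).1 (localRadius d k₀ + 3)

open Classical in
theorem sum_pairs_le_localSum {a : Fin d → ZMod M} {B B' : Finset (Fin n)}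
    (hB : B ⊆ nearFinset ω k₀ a) (hBB' : ∀ b ∈ B, ∀ b' ∈ B', b = b' ∨ (graph θ ω).Adj b b')
    (F : Fin n → Fin n → ℝ) (hF : ∀ x y, 0 ≤ F x y) :
    ∑ b ∈ B, ∑ b' ∈ B', (if b = b' then 0 else F b b') ≤ localSum ω θ k₀ a F := by
  have hnn : ∀ x y, 0 ≤ if (graph θ ω).Adj x y then F x y else 0 := fun x y => by
    split_ifs; exacts [hF x y, le_rfl]
  unfold localSum
  refine le_trans (Finset.sum_le_sum fun b hb => ?_)
    (Finset.sum_le_sum_of_subset_of_nonneg hB fun x _ _ => Finset.sum_nonneg fun y _ => hnn x y)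
  refine le_trans (Finset.sum_le_sum fun b' hb' => ?_)
    (Finset.sum_le_sum_of_subset_of_nonneg (Finset.subset_univ B') fun y _ _ => hnn b y)
  rcases hBB' b hb b' hb' with h | h
  · rw [if_pos h]; exact hnn _ _
  · rw [if_neg h.ne, if_pos h]

theorem localSum_nonneg (a : Fin d → ZMod M) (F : Fin n → Fin n → ℝ) (hF : ∀ x y, 0 ≤ F x y) :
    0 ≤ localSum ω θ k₀ a F :=
  Finset.sum_nonneg fun x _ => Finset.sum_nonneg fun y _ => by split_ifs; exacts [hF x y, le_rfl]

theorem cluster_subset_nearFinset {a : Fin d → ZMod M} {v : Fin d → ℤ}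
    (hv : v ∈ Grid.box d (localRadius d k₀ + 1)) :
    cluster ω m₀ (a + red M v) ⊆ nearFinset ω k₀ a := by
  intro b hb
  have h1 : ‖(ω b).1 - pt a‖ ≤ _ := cluster_subset_near hv hb
  refine Finset.mem_filter.2 ⟨Finset.mem_univ b, h1.trans ?_⟩
  have := mesh_pos (M := M)
  push_cast
  nlinarith

open Classical in
-- The path of `exists_reachable` visits only nodes near `a` and one extra node `u`. Each of its
-- edges still has an end near `a`, since there is no loop at `u`, so the local energy pays for all
-- of them even if `u` is far away.
theorem Regular.sq_sub_le (h : Regular ω M θ m₀ ℓ k₀) (hG : (graph θ ω).Connected) {N : ℝ}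
    (hN1 : 1 ≤ N) (hN : ∀ a : Fin d → ZMod M, ((nearFinset ω k₀ a).card : ℝ) ≤ N)
    {a : Fin d → ZMod M} {t : Fin d → ℤ} (ht : IsCrossing ω m₀ ℓ k₀ a t) (f : Fin n → ℝ) {y : Fin n}
    (hy : ‖(ω y).1 - pt a‖ ≤ 1 / M) {b : Fin n} (hb : b ∈ cluster ω m₀ (a + red M t)) :
    (f y - f b) ^ 2 ≤ 4 * N * localSum ω θ k₀ a fun x y => (f x - f y) ^ 2 := by
  obtain ⟨u, hu⟩ := h.exists_reachable hG ht hy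
  set S := near ω a (localRadius d k₀ + 1)
  have hS : ∀ x ∈ S, x ∈ nearFinset ω k₀ a := by
    intro x hx
    refine Finset.mem_filter.2 ⟨Finset.mem_univ x, le_trans (show ‖(ω x).1 - pt a‖ ≤ _ from hx) ?_⟩
    have := mesh_pos (M := M)
    push_cast
    gcongr
    norm_num
  set H := (graph θ ω).inside (S ∪ {u}) with hH
  set K := insert u (nearFinset ω k₀ a)
  have hK : ∀ x y, H.Adj x y → x ∈ K := by
    intro x y hxy
    rcases hxy.2.1 with hx | hx
    · exact Finset.mem_insert_of_mem (hS x hx)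
    · exact Finset.mem_insert.2 (Or.inl hx)
  have h1 := SimpleGraph.sq_sub_le_of_reachable H K hK f (hu b hb)
  set F : Fin n → Fin n → ℝ := fun x y => (f x - f y) ^ 2
  have hF : ∀ x y, 0 ≤ if (graph θ ω).Adj x y then F x y else 0 := fun x y => by
    split_ifs; exacts [sq_nonneg _, le_rfl]
  set E := localSum ω θ k₀ a F with hE
  have hE0 : 0 ≤ E := localSum_nonneg a F fun _ _ => sq_nonneg _
  have hcard : (K.card : ℝ) ≤ 2 * N := by
    have : (K.card : ℝ) ≤ (nearFinset ω k₀ a).card + 1 := by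
      exact_mod_cast Finset.card_insert_le _ _
    linarith [hN a]
  -- The factor 2 comes from ordered pairs: `localSum` requires the first node to be near `a`, so an
  -- ordered edge is charged to whichever of its ends is near.
  have h2 : ∑ x ∈ K, ∑ y ∈ K, (if H.Adj x y then (f x - f y) ^ 2 else 0) ≤ 2 * E := by
    set Nr := nearFinset ω k₀ a
    have e1 : ∑ x ∈ K, ∑ y ∈ K, (if H.Adj x y then (f x - f y) ^ 2 else 0)
        ≤ ∑ x, ∑ y, ((if x ∈ Nr then (if (graph θ ω).Adj x y then F x y else 0) else 0)
          + (if y ∈ Nr then (if (graph θ ω).Adj y x then F y x else 0) else 0)) := by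
      have hpos : ∀ x y, 0 ≤ (if x ∈ Nr then (if (graph θ ω).Adj x y then F x y else 0) else 0)
          + (if y ∈ Nr then (if (graph θ ω).Adj y x then F y x else 0) else 0) := by
        intro x y
        refine add_nonneg ?_ ?_ <;> split_ifs <;> first | exact sq_nonneg _ | exact le_rfl
      refine le_trans (Finset.sum_le_sum fun x _ => ?_) (Finset.sum_le_sum_of_subset_of_nonneg
        (Finset.subset_univ K) fun x _ _ => Finset.sum_nonneg fun y _ => hpos x y)
      refine le_trans (Finset.sum_le_sum fun y _ => ?_) (Finset.sum_le_sum_of_subset_of_nonneg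
        (Finset.subset_univ K) fun y _ _ => hpos x y)
      by_cases hxy : H.Adj x y
      · rw [if_pos hxy]
        have hadj : (graph θ ω).Adj x y := hxy.1
        have hFs : F y x = F x y := by simp only [F]; ring
        have hF0 : 0 ≤ F x y := sq_nonneg _
        rcases hxy.2.1 with hx | hx
        · rw [if_pos (hS x hx), if_pos hadj, if_pos hadj.symm, hFs]
          split_ifs
          · change F x y ≤ _; linarith
          · change F x y ≤ _; linarith
        · rcases hxy.2.2 with hy | hy
          · rw [if_pos (hS y hy), if_pos hadj, if_pos hadj.symm, hFs]
            split_ifs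
            · change F x y ≤ _; linarith
            · change F x y ≤ _; linarith
          · exact absurd (Set.mem_singleton_iff.1 hx |>.trans (Set.mem_singleton_iff.1 hy).symm)
              hadj.ne
      · rw [if_neg hxy]; exact hpos x y
    refine e1.trans (le_of_eq ?_)
    simp_rw [Finset.sum_add_distrib]
    have e2 : ∑ x, ∑ y, (if x ∈ Nr then (if (graph θ ω).Adj x y then F x y else 0) else 0) = E := by
      have e4 : ∀ x, ∑ y, (if x ∈ Nr then (if (graph θ ω).Adj x y then F x y else 0) else 0)
          = if x ∈ Nr then ∑ y, (if (graph θ ω).Adj x y then F x y else 0) else 0 := by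
        intro x; split_ifs <;> simp
      simp_rw [e4]
      rw [Finset.sum_ite_mem, Finset.univ_inter]
      rfl
    have e3 : ∑ x, ∑ y, (if y ∈ Nr then (if (graph θ ω).Adj y x then F y x else 0) else 0) = E := by
      rw [Finset.sum_comm]; exact e2
    rw [e2, e3]; ring
  calc (f y - f b) ^ 2 ≤ _ := h1
    _ ≤ (2 * N) * (2 * E) := by
        refine mul_le_mul hcard h2 ?_ (by linarith)
        exact Finset.sum_nonneg fun _ _ => Finset.sum_nonneg fun _ _ => by
          split_ifs; exacts [sq_nonneg _, le_rfl]
    _ = _ := by ring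

open Classical in
/-- Degree-weighted sums are controlled by the energy and the averages over crossing clusters. -/
theorem Regular.sum_degree_mul_sq_le (h : Regular ω M θ m₀ ℓ k₀) (hG : (graph θ ω).Connected)
    {N : ℝ} (hN1 : 1 ≤ N) (hN : ∀ a : Fin d → ZMod M, ((nearFinset ω k₀ a).card : ℝ) ≤ N)
    (hdeg : ∀ x,
      ((Finset.univ.filter fun y => (graph θ ω).Adj x y ∧ (ω x).2 ≤ (ω y).2).card : ℝ) ≤ N)
    (t : (Fin d → ZMod M) → Fin d → ℤ) (ht : ∀ a, IsCrossing ω m₀ ℓ k₀ a (t a)) (f : Fin n → ℝ) :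
    ∑ x, ((graph θ ω).degree x : ℝ) * f x ^ 2
      ≤ (1 + 24 * N ^ 3 * overlap d k₀) * (graph θ ω).energy f
        + 6 * N ^ 2 * ∑ a, (cluster ω m₀ (a + red M (t a))).mean fun x => f x ^ 2 := by
  set E : (Fin d → ZMod M) → ℝ := fun a => localSum ω θ k₀ a fun x y => (f x - f y) ^ 2
  set A : (Fin d → ZMod M) → ℝ := fun a => (cluster ω m₀ (a + red M (t a))).mean fun x => f x ^ 2
  have hE0 : ∀ a, 0 ≤ E a := fun a => localSum_nonneg a _ fun _ _ => sq_nonneg _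
  have hA0 : ∀ a, 0 ≤ A a := fun a =>
    div_nonneg (Finset.sum_nonneg fun _ _ => sq_nonneg _) (Nat.cast_nonneg _)
  -- Compare `f y` with every node `b` of the crossing cluster, using `f y ^ 2 ≤ 2 * f b ^ 2 + 2 *
  -- (f y - f b) ^ 2`, and average over `b`.
  have hpt : ∀ (a : Fin d → ZMod M) (y : Fin n), ‖(ω y).1 - pt a‖ ≤ 1 / M →
      f y ^ 2 ≤ 2 * A a + 8 * N * E a := by
    intro a y hy
    set B := cluster ω m₀ (a + red M (t a))
    have hB : B.Nonempty := cluster_nonempty h.one_le ((ht a).mem_populated h.two_le_dim)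
    have hB0 : (0 : ℝ) < B.card := by exact_mod_cast hB.card_pos
    have hb : ∀ b ∈ B, f y ^ 2 ≤ 2 * f b ^ 2 + 8 * N * E a := by
      intro b hb
      have h1 : (f y - f b) ^ 2 ≤ 4 * N * E a := h.sq_sub_le hG hN1 hN (ht a) f hy hb
      nlinarith [sq_nonneg (f y - 2 * f b)]
    have h2 := Finset.sum_le_sum hb
    rw [Finset.sum_const, nsmul_eq_mul, Finset.sum_add_distrib, Finset.sum_const, nsmul_eq_mul,
      ← Finset.mul_sum] at h2
    have h3 : A a * B.card = ∑ b ∈ B, f b ^ 2 := by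
      simp only [A, Finset.mean]; rw [div_mul_cancel₀]; exact hB0.ne'
    rw [← h3] at h2
    have h4 : (B.card : ℝ) * f y ^ 2 ≤ B.card * (2 * A a + 8 * N * E a) := by linarith
    exact le_of_mul_le_mul_left h4 hB0
  have hsum : ∑ y, f y ^ 2 ≤ ∑ a, N * (2 * A a + 8 * N * E a) := by
    choose c hc using fun y => exists_near_pt (M := M) (ω y).1
    rw [← Finset.sum_fiberwise (s := Finset.univ) (g := c)]
    refine Finset.sum_le_sum fun a _ => ?_
    have h0 : 0 ≤ 2 * A a + 8 * N * E a := by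
      have := hE0 a; have := hA0 a; positivity
    calc ∑ y ∈ Finset.univ.filter (fun y => c y = a), f y ^ 2
        ≤ ∑ _y ∈ Finset.univ.filter (fun y => c y = a), (2 * A a + 8 * N * E a) := by
          refine Finset.sum_le_sum fun y hy => hpt a y ?_
          rw [Finset.mem_filter] at hy
          rw [← hy.2]; exact hc y
      _ = (Finset.univ.filter (fun y => c y = a)).card * (2 * A a + 8 * N * E a) := by
          rw [Finset.sum_const, nsmul_eq_mul]
      _ ≤ N * (2 * A a + 8 * N * E a) := by
          refine mul_le_mul_of_nonneg_right (le_trans ?_ (hN a)) h0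
          refine Nat.cast_le.2 (Finset.card_le_card fun y hy => ?_)
          rw [Finset.mem_filter] at hy
          refine Finset.mem_filter.2 ⟨Finset.mem_univ y, ?_⟩
          rw [← hy.2]
          refine (hc y).trans ?_
          have := mesh_pos (M := M)
          push_cast
          have : (0 : ℝ) ≤ localRadius d k₀ := Nat.cast_nonneg _
          nlinarith
  have hEs : ∑ a, E a ≤ overlap d k₀ * (graph θ ω).energy f :=
    sum_localSum_le ω M θ k₀ _ fun _ _ => sq_nonneg _
  have h1 := GTG.sum_degree_mul_sq_le ω θ N hdeg f
  have h2 : ∑ a, N * (2 * A a + 8 * N * E a) = 2 * N * ∑ a, A a + 8 * N ^ 2 * ∑ a, E a := by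
    simp_rw [mul_add, Finset.sum_add_distrib, Finset.mul_sum]
    congr 1 <;> exact Finset.sum_congr rfl fun a _ => by ring
  have h3 : 8 * N ^ 2 * ∑ a, E a ≤ 8 * N ^ 2 * (overlap d k₀ * (graph θ ω).energy f) := by gcongr
  have h4 : 3 * N * ∑ y, f y ^ 2 ≤ 3 * N * (2 * N * ∑ a, A a
      + 8 * N ^ 2 * (overlap d k₀ * (graph θ ω).energy f)) := by
    gcongr; linarith
  calc _ ≤ _ := h1
    _ ≤ _ := add_le_add_right h4 _
    _ = _ := by ring


/-- The constant in the Poincaré inequalities for regular configurations. -/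
noncomputable def poincareConst (d k₀ M : ℕ) (N ℓ : ℝ) : ℝ :=
  1 + 24 * N ^ 3 * overlap d k₀ + 6 * (N / ℓ) ^ 2 *
    (overlap d k₀ * (d ^ 2 * M ^ 2 * (Grid.box d (localRadius d k₀ + 1)).card ^ 3 + 1))

theorem energy_abs_le_signlessEnergy {V : Type*} [Fintype V] (G : SimpleGraph V) (f : V → ℝ) :
    G.energy (fun x => |f x|) ≤ G.signlessEnergy f := by
  unfold SimpleGraph.energy SimpleGraph.signlessEnergy
  refine Finset.sum_le_sum fun x _ => Finset.sum_le_sum fun y _ => ?_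
  split_ifs
  · refine sq_le_sq.2 ?_
    have := abs_abs_sub_abs_le (f x) (-f y)
    rwa [abs_neg, sub_neg_eq_add] at this
  · exact le_rfl

theorem energy_nonneg {V : Type*} [Fintype V] (G : SimpleGraph V) (f : V → ℝ) : 0 ≤ G.energy f :=
  Finset.sum_nonneg fun _ _ => Finset.sum_nonneg fun _ _ => by
    split_ifs; exacts [sq_nonneg _, le_rfl]

theorem signlessEnergy_nonneg {V : Type*} [Fintype V] (G : SimpleGraph V) (f : V → ℝ) :
    0 ≤ G.signlessEnergy f :=
  Finset.sum_nonneg fun _ _ => Finset.sum_nonneg fun _ _ => by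
    split_ifs; exacts [sq_nonneg _, le_rfl]

open Classical in
-- Pass to `|f|`, whose energy is at most the signless energy of `f`. The means of `f ^ 2` are then
-- controlled inside each cluster: on a clique of `m ≥ 4` nodes the signless form is at least `2 *
-- (m - 2) ≥ m` times the sum of squares, so neither centring nor the grid is needed.
theorem Regular.signless_poincare (h : Regular ω M θ m₀ ℓ k₀) (hG : (graph θ ω).Connected)
    (hℓ : 4 ≤ ℓ) {N : ℝ} (hN1 : 1 ≤ N)
    (hN : ∀ a : Fin d → ZMod M, ((nearFinset ω k₀ a).card : ℝ) ≤ N)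
    (hdeg : ∀ x,
      ((Finset.univ.filter fun y => (graph θ ω).Adj x y ∧ (ω x).2 ≤ (ω y).2).card : ℝ) ≤ N)
    (f : Fin n → ℝ) :
    ∑ x, ((graph θ ω).degree x : ℝ) * f x ^ 2
      ≤ poincareConst d k₀ M N ℓ * (graph θ ω).signlessEnergy f := by
  choose t ht using fun a : Fin d → ZMod M => h.exists_isCrossing a
  have h1 := h.sum_degree_mul_sq_le hG hN1 hN hdeg t ht (fun x => |f x|)
  simp only [sq_abs] at h1
  set S := (graph θ ω).signlessEnergy f with hS
  have hS0 : 0 ≤ S := signlessEnergy_nonneg _ f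
  have h2 : ∀ a, (cluster ω m₀ (a + red M (t a))).mean (fun x => f x ^ 2)
      ≤ localSum ω θ k₀ a (fun x y => (f x + f y) ^ 2) / ℓ ^ 2 := by
    intro a
    set B := cluster ω m₀ (a + red M (t a))
    have hBℓ : ℓ ≤ B.card := (ht a).mem_populated h.two_le_dim
    have hB0 : (0 : ℝ) < B.card := by linarith
    have hp := sum_pairs_le_localSum (θ := θ) (k₀ := k₀) (a := a) (B := B) (B' := B)
      (cluster_subset_nearFinset (Grid.box_mono (Nat.le_succ _) (ht a).mem_box))
      (fun b hb b' hb' => h.eq_or_adj_of_mem_cluster hb hb') (fun x y => (f x + f y) ^ 2)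
      (fun _ _ => sq_nonneg _)
    have hid : ∑ b ∈ B, ∑ b' ∈ B, (if b = b' then 0 else (f b + f b') ^ 2)
        = 2 * (B.card - 2) * ∑ x ∈ B, f x ^ 2 + 2 * (∑ x ∈ B, f x) ^ 2 := by
      have e1 : ∀ x y, (if x = y then 0 else (f x + f y) ^ 2)
          = f x ^ 2 + f y ^ 2 + 2 * (f x * f y) - if x = y then 4 * f x ^ 2 else 0 := by
        intro x y
        split_ifs with hxy
        · subst hxy; ring
        · ring
      have e2 : ∀ x ∈ B, ∑ y ∈ B, (if x = y then 4 * f x ^ 2 else 0) = 4 * f x ^ 2 := by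
        intro x hx
        rw [Finset.sum_ite_eq, if_pos hx]
      simp_rw [e1, Finset.sum_sub_distrib]
      rw [Finset.sum_congr rfl e2]
      simp_rw [Finset.sum_add_distrib, Finset.sum_const, nsmul_eq_mul, ← Finset.mul_sum,
        ← Finset.sum_mul]
      ring
    rw [hid] at hp
    set Q := ∑ x ∈ B, f x ^ 2 with hQ
    have hQ0 : 0 ≤ Q := Finset.sum_nonneg fun _ _ => sq_nonneg _
    have h3 : B.card * Q ≤ localSum ω θ k₀ a (fun x y => (f x + f y) ^ 2) := by
      nlinarith [sq_nonneg (∑ x ∈ B, f x), mul_nonneg (by linarith : (0 : ℝ) ≤ B.card - 4) hQ0]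
    unfold Finset.mean
    rw [← hQ, div_le_div_iff₀ hB0 (by positivity)]
    calc Q * ℓ ^ 2 ≤ Q * (B.card : ℝ) ^ 2 := by gcongr
      _ = B.card * Q * B.card := by ring
      _ ≤ _ := by gcongr
  have h3 : ∑ a, (cluster ω m₀ (a + red M (t a))).mean (fun x => f x ^ 2)
      ≤ overlap d k₀ * S / ℓ ^ 2 := by
    refine (Finset.sum_le_sum fun a _ => h2 a).trans ?_
    rw [← Finset.sum_div]
    gcongr
    exact sum_localSum_le ω M θ k₀ _ fun _ _ => sq_nonneg _
  have h4 := energy_abs_le_signlessEnergy (graph θ ω) f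
  have hℓ0 : 0 < ℓ := by linarith
  have hK : 0 ≤ 6 * (N / ℓ) ^ 2 * (overlap d k₀ *
    (d ^ 2 * M ^ 2 * ((Grid.box d (localRadius d k₀ + 1)).card : ℝ) ^ 3)) := by positivity
  calc _ ≤ _ := h1
    _ ≤ (1 + 24 * N ^ 3 * overlap d k₀) * S + 6 * N ^ 2 * (overlap d k₀ * S / ℓ ^ 2) := by gcongr
    _ = (1 + 24 * N ^ 3 * overlap d k₀ + 6 * (N / ℓ) ^ 2 * overlap d k₀) * S := by
        field_simp
    _ ≤ poincareConst d k₀ M N ℓ * S := by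
        refine mul_le_mul_of_nonneg_right ?_ hS0
        unfold poincareConst
        linarith

open Classical in
-- Neighbouring clusters are completely joined, and averaging over their at least `ℓ ^ 2` pairs
-- gains the factor `ℓ ^ (-2)`. This offsets the `N ^ 2` lost in passing from degree-weighted sums
-- to cluster means.
theorem Regular.sq_mean_sub_mean_le (h : Regular ω M θ m₀ ℓ k₀) (hℓ : 0 < ℓ) (a : Fin d → ZMod M)
    {u v : Fin d → ℤ} (huv : (Grid.nnGraph (populated ω m₀ ℓ a ∩
      Grid.box d (localRadius d k₀ + 1))).Adj u v) (f : Fin n → ℝ) :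
    ((cluster ω m₀ (a + red M u)).mean f - (cluster ω m₀ (a + red M v)).mean f) ^ 2
      ≤ localSum ω θ k₀ a (fun x y => (f x - f y) ^ 2) / ℓ ^ 2 := by
  set B := cluster ω m₀ (a + red M u)
  set B' := cluster ω m₀ (a + red M v)
  have hB : ℓ ≤ B.card := huv.1.1
  have hB' : ℓ ≤ B'.card := huv.2.1.1
  have hp := sum_pairs_le_localSum (θ := θ) (k₀ := k₀) (a := a) (B := B) (B' := B')
    (cluster_subset_nearFinset huv.1.2) (fun b hb b' hb' => h.eq_or_adj_of_nnGraph_adj a huv hb hb')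
    (fun x y => (f x - f y) ^ 2) (fun _ _ => sq_nonneg _)
  have he : ∀ b b', (if b = b' then 0 else (f b - f b') ^ 2) = (f b - f b') ^ 2 := by
    intro b b'; split_ifs with hbb
    · rw [hbb]; ring
    · rfl
  simp_rw [he] at hp
  refine (Finset.sq_mean_sub_mean_le B B' (cluster_nonempty h.one_le huv.1.1)
    (cluster_nonempty h.one_le huv.2.1.1) f).trans ?_
  refine div_le_div₀ (localSum_nonneg a _ fun _ _ => sq_nonneg _) hp (by positivity) ?_
  rw [sq]
  exact mul_le_mul hB hB' hℓ.le (by linarith)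

open Classical in
-- Centre `f` at the lattice average `c` of the crossing cluster means. The fluctuation of these
-- means is bounded by the discrete torus inequality, and the fluctuation inside each cluster by its
-- clique edges.
theorem Regular.poincare (h : Regular ω M θ m₀ ℓ k₀) (hG : (graph θ ω).Connected)
    {N : ℝ} (hN1 : 1 ≤ N)
    (hN : ∀ a : Fin d → ZMod M, ((nearFinset ω k₀ a).card : ℝ) ≤ N)
    (hdeg : ∀ x,
      ((Finset.univ.filter fun y => (graph θ ω).Adj x y ∧ (ω x).2 ≤ (ω y).2).card : ℝ) ≤ N)
    (f : Fin n → ℝ) (hf : ∑ x, ((graph θ ω).degree x : ℝ) * f x = 0) :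
    ∑ x, ((graph θ ω).degree x : ℝ) * f x ^ 2
      ≤ poincareConst d k₀ M N ℓ * (graph θ ω).energy f := by
  choose t ht using fun a : Fin d → ZMod M => h.exists_isCrossing a
  have hℓ0 : 0 < ℓ := by linarith [h.one_le]
  set B : (Fin d → ZMod M) → Finset (Fin n) := fun a => cluster ω m₀ (a + red M (t a)) with hBdef
  set g : (Fin d → ZMod M) → ℝ := fun a => (B a).mean f with hg
  set c : ℝ := (∑ a, g a) / (M ^ d : ℕ) with hc
  set S := (graph θ ω).energy f with hS
  have hS0 : 0 ≤ S := energy_nonneg _ f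
  set E : (Fin d → ZMod M) → ℝ := fun a => localSum ω θ k₀ a fun x y => (f x - f y) ^ 2 with hE
  have hE0 : ∀ a, 0 ≤ E a := fun a => localSum_nonneg a _ fun _ _ => sq_nonneg _
  have hEs : ∑ a, E a ≤ overlap d k₀ * S := sum_localSum_le ω M θ k₀ _ fun _ _ => sq_nonneg _
  have h1 := h.sum_degree_mul_sq_le hG hN1 hN hdeg t ht (fun x => f x - c)
  have hen : (graph θ ω).energy (fun x => f x - c) = S := by
    simp only [hS, SimpleGraph.energy, sub_sub_sub_cancel_right]
  rw [hen] at h1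
  -- The degree-weighted mean of `f` is zero, so replacing it by any other centre only increases the
  -- weighted sum of squares.
  have hshift : ∑ x, ((graph θ ω).degree x : ℝ) * f x ^ 2
      ≤ ∑ x, ((graph θ ω).degree x : ℝ) * (f x - c) ^ 2 := by
    have e : ∑ x, ((graph θ ω).degree x : ℝ) * (f x - c) ^ 2
        = ∑ x, ((graph θ ω).degree x : ℝ) * f x ^ 2 - 2 * c * ∑ x, ((graph θ ω).degree x : ℝ) * f x
          + ∑ x, ((graph θ ω).degree x : ℝ) * c ^ 2 := by
      rw [Finset.mul_sum, ← Finset.sum_sub_distrib, ← Finset.sum_add_distrib]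
      exact Finset.sum_congr rfl fun x _ => by ring
    have e2 : 0 ≤ ∑ x, ((graph θ ω).degree x : ℝ) * c ^ 2 :=
      Finset.sum_nonneg fun _ _ => by positivity
    rw [e, hf]; linarith
  set Λ : ℝ := ((Grid.box d (localRadius d k₀ + 1)).card : ℝ) with hΛ
  -- Adjacent crossing points are joined by a path of populated points inside a box of `Λ` points:
  -- one factor `Λ` from Cauchy–Schwarz along the path, two more from crudely summing over all pairs
  -- of the box.
  have hstep : ∀ a j, (g (a + Pi.single j 1) - g a) ^ 2 ≤ Λ ^ 3 * (E a / ℓ ^ 2) := by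
    intro a j
    have hreach := Grid.reachable_translate h.two_le_dim (populated ω m₀ ℓ a) (localRadius d k₀) k₀
      (le_localRadius d k₀) (t a) (t (a + Pi.single j 1)) (ht a).mem_Icc (ht _).mem_Icc j
      (ht a).slab (fun i v hv hvi => by
        have := (ht (a + Pi.single j 1)).slab i v hv hvi
        change ℓ ≤ _ at this
        change ℓ ≤ _
        rwa [red_add, red_single, add_comm (red M v), ← add_assoc])
      (fun i => Grid.exists_slab_subset _ _ _ (h.sparse a) i)
    have hb := SimpleGraph.sq_sub_le_of_reachable
      (Grid.nnGraph (populated ω m₀ ℓ a ∩ Grid.box d (localRadius d k₀ + 1)))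
      (Grid.box d (localRadius d k₀ + 1)) (fun x y hxy => hxy.1.2) (fun v => (cluster ω m₀ (a + red M v)).mean f) hreach
    have he : (cluster ω m₀ (a + red M (t (a + Pi.single j 1) + Pi.single j 1))).mean f
        = g (a + Pi.single j 1) := by
      simp only [hg, hBdef]
      rw [red_add, red_single, add_comm (red M (t _)), ← add_assoc]
    have hcell : 0 ≤ E a / ℓ ^ 2 := div_nonneg (hE0 a) (by positivity)
    rw [he] at hb
    rw [← neg_sub, neg_sq]
    refine hb.trans ?_
    have : ∑ u ∈ Grid.box d (localRadius d k₀ + 1), ∑ v ∈ Grid.box d (localRadius d k₀ + 1),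
        (if (Grid.nnGraph (populated ω m₀ ℓ a ∩ Grid.box d (localRadius d k₀ + 1))).Adj u v then
          ((cluster ω m₀ (a + red M u)).mean f - (cluster ω m₀ (a + red M v)).mean f) ^ 2 else 0)
        ≤ Λ * (Λ * (E a / ℓ ^ 2)) := by
      rw [hΛ, ← nsmul_eq_mul, ← nsmul_eq_mul, ← Finset.sum_const, ← Finset.sum_const]
      refine Finset.sum_le_sum fun u _ => Finset.sum_le_sum fun v _ => ?_
      split_ifs with huv
      · exact h.sq_mean_sub_mean_le hℓ0 a huv f
      · exact hcell
    calc _ ≤ Λ * (Λ * (Λ * (E a / ℓ ^ 2))) := by gcongr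
      _ = _ := by ring
  have hgrid := Grid.poincare g
  have hcard : ((Finset.univ : Finset (Fin d → ZMod M)).card : ℝ) = (M : ℝ) ^ d := by
    rw [Finset.card_univ, Fintype.card_fun, ZMod.card, Fintype.card_fin]; push_cast; rfl
  have hMd : (0 : ℝ) < (M : ℝ) ^ d := by
    have : (0 : ℝ) < M := by exact_mod_cast Nat.pos_of_ne_zero (NeZero.ne M)
    positivity
  have hcM : c * (M : ℝ) ^ d = ∑ a, g a := by
    rw [hc]; push_cast; field_simp
  have hvar : 2 * (M : ℝ) ^ d * ∑ a, (g a - c) ^ 2 = ∑ a, ∑ b, (g b - g a) ^ 2 := by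
    have e1 := Finset.sum_sum_sq_sub Finset.univ (fun a => g a - c)
    simp only [sub_sub_sub_cancel_right] at e1
    have e0 : ∑ a, (g a - c) = 0 := by
      rw [Finset.sum_sub_distrib, Finset.sum_const, nsmul_eq_mul, hcard, ← hcM]; ring
    rw [e0, hcard] at e1
    rw [Finset.sum_comm, e1]; ring
  have hgs : ∑ a, ∑ j, (g (a + Pi.single j 1) - g a) ^ 2
      ≤ d * (Λ ^ 3 * (overlap d k₀ * S / ℓ ^ 2)) := by
    calc ∑ a, ∑ j, (g (a + Pi.single j 1) - g a) ^ 2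
        ≤ ∑ a, ∑ _j : Fin d, Λ ^ 3 * (E a / ℓ ^ 2) :=
          Finset.sum_le_sum fun a _ => Finset.sum_le_sum fun j _ => hstep a j
      _ = d * (Λ ^ 3 * ((∑ a, E a) / ℓ ^ 2)) := by
          simp_rw [Finset.sum_const, Finset.card_univ, Fintype.card_fin, nsmul_eq_mul,
            Finset.sum_div, Finset.mul_sum]
      _ ≤ _ := by gcongr
  have hgc : ∑ a, (g a - c) ^ 2 ≤ d ^ 2 * M ^ 2 * Λ ^ 3 * (overlap d k₀ * S / ℓ ^ 2) := by
    have e1 : 2 * (M : ℝ) ^ d * ∑ a, (g a - c) ^ 2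
        ≤ (M : ℝ) ^ d * (d ^ 2 * M ^ 2 * Λ ^ 3 * (overlap d k₀ * S / ℓ ^ 2)) := by
      rw [hvar]
      refine hgrid.trans ?_
      calc _ ≤ (d : ℝ) * M ^ 2 * M ^ d * (d * (Λ ^ 3 * (overlap d k₀ * S / ℓ ^ 2))) := by gcongr
        _ = _ := by ring
    have e2 : 0 ≤ ∑ a, (g a - c) ^ 2 := Finset.sum_nonneg fun _ _ => sq_nonneg _
    have e3 : (M : ℝ) ^ d * ∑ a, (g a - c) ^ 2
        ≤ (M : ℝ) ^ d * (d ^ 2 * M ^ 2 * Λ ^ 3 * (overlap d k₀ * S / ℓ ^ 2)) := by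
      have := mul_nonneg hMd.le e2
      linarith
    exact le_of_mul_le_mul_left e3 hMd
  -- Bias and variance: the mean square deviation from `c` is `(g a - c) ^ 2` plus the variance in
  -- the cluster, which the clique edges bound.
  have hmean : ∀ a, (B a).mean (fun x => (f x - c) ^ 2) ≤ (g a - c) ^ 2 + E a / ℓ ^ 2 := by
    intro a
    have hBp := (ht a).mem_populated h.two_le_dim
    have hBℓ : ℓ ≤ (B a).card := hBp
    have hB0 : (0 : ℝ) < (B a).card := by linarith
    have hp := sum_pairs_le_localSum (θ := θ) (k₀ := k₀) (a := a) (B := B a) (B' := B a)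
      (cluster_subset_nearFinset (Grid.box_mono (Nat.le_succ _) (ht a).mem_box))
      (fun b hb b' hb' => h.eq_or_adj_of_mem_cluster hb hb') (fun x y => (f x - f y) ^ 2)
      (fun _ _ => sq_nonneg _)
    have he : ∀ b b', (if b = b' then 0 else (f b - f b') ^ 2) = (f b - f b') ^ 2 := by
      intro b b'; split_ifs with hbb
      · rw [hbb]; ring
      · rfl
    simp_rw [he] at hp
    have e1 := Finset.sum_sum_sq_sub (B a) (fun x => f x - c)
    simp only [sub_sub_sub_cancel_right] at e1
    have e2 : ∑ x ∈ B a, (f x - c) = (B a).card * (g a - c) := by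
      rw [Finset.sum_sub_distrib, Finset.sum_const, nsmul_eq_mul]
      simp only [hg, Finset.mean]
      field_simp
    rw [e2] at e1
    have e3 : (B a).card * ∑ x ∈ B a, (f x - c) ^ 2
        ≤ (B a).card ^ 2 * (g a - c) ^ 2 + E a := by
      rw [e1] at hp
      have := hE0 a
      change _ ≤ E a at hp
      nlinarith
    have e4 : (B a).mean (fun x => (f x - c) ^ 2)
        = ((B a).card * ∑ x ∈ B a, (f x - c) ^ 2) / (B a).card ^ 2 := by
      unfold Finset.mean; field_simp
    rw [e4]
    calc _ ≤ ((B a).card ^ 2 * (g a - c) ^ 2 + E a) / (B a).card ^ 2 := by gcongr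
      _ = (g a - c) ^ 2 + E a / (B a).card ^ 2 := by field_simp
      _ ≤ _ := by have := hE0 a; gcongr
  have hmeans : ∑ a, (B a).mean (fun x => (f x - c) ^ 2)
      ≤ d ^ 2 * M ^ 2 * Λ ^ 3 * (overlap d k₀ * S / ℓ ^ 2) + overlap d k₀ * S / ℓ ^ 2 := by
    refine (Finset.sum_le_sum fun a _ => hmean a).trans ?_
    rw [Finset.sum_add_distrib, ← Finset.sum_div]
    gcongr
  calc _ ≤ _ := hshift
    _ ≤ _ := h1
    _ ≤ (1 + 24 * N ^ 3 * overlap d k₀) * S + 6 * N ^ 2 *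
        (d ^ 2 * M ^ 2 * Λ ^ 3 * (overlap d k₀ * S / ℓ ^ 2) + overlap d k₀ * S / ℓ ^ 2) := by
        gcongr
    _ = poincareConst d k₀ M N ℓ * S := by
        unfold poincareConst
        rw [← hΛ]
        field_simp

end GTG

/-! ### Concentration of counts and typical configurations -/

open Classical in
/-- Exponential Markov inequality for the number of coordinates in a set. -/
theorem MeasureTheory.Measure.pi_real_count_le {X : Type*} [MeasurableSpace X] (μ : Measure X)
    [IsProbabilityMeasure μ] (n : ℕ) {S : Set X} (hS : MeasurableSet S) (u s : ℝ) :
    (Measure.pi fun _ : Fin n => μ).real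
        {ω | s ≤ u * ((Finset.univ.filter fun i => ω i ∈ S).card : ℝ)}
      ≤ Real.exp (-s + n * (Real.exp u - 1) * μ.real S) := by
  -- Here `g` equals `exp u` on `S` and one elsewhere, so its product over coordinates is the
  -- exponential of `u` times the count. No sign of `u` is imposed, so both tails follow.
  set g : X → ℝ := fun x => 1 + S.indicator (fun _ => Real.exp u - 1) x with hg
  have hgpos : ∀ x, 0 < g x := by
    intro x
    by_cases hx : x ∈ S
    · simp [g, hx, Real.exp_pos]
    · simp [g, hx]
  have hprod : ∀ ω : Fin n → X,
      ∏ i, g (ω i) = Real.exp (u * ((Finset.univ.filter fun i => ω i ∈ S).card : ℝ)) := by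
    intro ω
    have : ∀ i, g (ω i) = if ω i ∈ S then Real.exp u else 1 := by
      intro i
      by_cases hx : ω i ∈ S <;> simp [g, hx]
    simp_rw [this]
    rw [Finset.prod_ite, Finset.prod_const, Finset.prod_const_one, mul_one, ← Real.exp_nat_mul,
      mul_comm]
  have hint : ∫ x, g x ∂μ = 1 + (Real.exp u - 1) * μ.real S := by
    rw [integral_add (integrable_const _) ((integrable_const _).indicator hS),
      integral_indicator hS]
    simp [mul_comm]
  have hgm : Measurable g := measurable_const.add (measurable_const.indicator hS)
  have hbound : ∀ x, ‖g x‖ ≤ 1 + |Real.exp u - 1| := by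
    intro x
    refine (norm_add_le _ _).trans ?_
    rw [norm_one]
    gcongr
    by_cases hx : x ∈ S <;> simp [hx]
  have hI : Integrable (fun ω : Fin n → X => ∏ i, g (ω i)) (Measure.pi fun _ => μ) := by
    refine Integrable.of_bound (C := (1 + |Real.exp u - 1|) ^ n)
      (Finset.measurable_prod _ fun i _ =>
        hgm.comp (measurable_pi_apply i)).aestronglyMeasurable (Eventually.of_forall fun ω => ?_)
    rw [norm_prod]
    refine (Finset.prod_le_prod (fun i _ => norm_nonneg _) fun i _ => hbound (ω i)).trans ?_
    simp
  have hmark := mul_meas_ge_le_integral_of_nonneg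
    (Eventually.of_forall fun ω => (Finset.prod_pos fun i _ => hgpos (ω i)).le) hI (Real.exp s)
  rw [integral_fintype_prod_eq_pow, Fintype.card_fin, hint] at hmark
  have hset : {ω : Fin n → X | Real.exp s ≤ ∏ i, g (ω i)}
      = {ω | s ≤ u * ((Finset.univ.filter fun i => ω i ∈ S).card : ℝ)} := by
    ext ω
    simp only [Set.mem_ofPred_eq, hprod, Real.exp_le_exp]
  rw [hset] at hmark
  have h1 : (1 + (Real.exp u - 1) * μ.real S) ^ n
      ≤ Real.exp (n * (Real.exp u - 1) * μ.real S) := by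
    have h2 : 1 + (Real.exp u - 1) * μ.real S ≤ Real.exp ((Real.exp u - 1) * μ.real S) := by
      have := Real.add_one_le_exp ((Real.exp u - 1) * μ.real S); linarith
    have h3 : 0 ≤ 1 + (Real.exp u - 1) * μ.real S := by
      rw [← hint]; exact integral_nonneg fun x => (hgpos x).le
    calc _ ≤ _ := pow_le_pow_left₀ h3 h2 n
      _ = _ := by rw [← Real.exp_nat_mul]; congr 1; ring
  rw [Real.exp_add, Real.exp_neg, ← div_eq_inv_mul, le_div_iff₀ (Real.exp_pos s), mul_comm]
  exact hmark.trans h1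

open Classical in
theorem MeasureTheory.Measure.pi_real_le_count_le {X : Type*} [MeasurableSpace X] (μ : Measure X)
    [IsProbabilityMeasure μ] (n : ℕ) {S : Set X} (hS : MeasurableSet S) (s : ℝ) :
    (Measure.pi fun _ : Fin n => μ).real
        {ω | s ≤ ((Finset.univ.filter fun i => ω i ∈ S).card : ℝ)}
      ≤ Real.exp (-s + 2 * (n * μ.real S)) := by
  have h := Measure.pi_real_count_le μ n hS 1 s
  simp only [one_mul] at h
  refine h.trans (Real.exp_le_exp.2 ?_)
  have h1 := Real.exp_one_lt_d9
  have h2 : 0 ≤ (n : ℝ) * μ.real S := by positivity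
  nlinarith

open Classical in
theorem MeasureTheory.Measure.pi_real_count_le_le {X : Type*} [MeasurableSpace X] (μ : Measure X)
    [IsProbabilityMeasure μ] (n : ℕ) {S : Set X} (hS : MeasurableSet S) (s : ℝ) :
    (Measure.pi fun _ : Fin n => μ).real
        {ω | ((Finset.univ.filter fun i => ω i ∈ S).card : ℝ) ≤ s}
      ≤ Real.exp (s - n * μ.real S / 2) := by
  have h := Measure.pi_real_count_le μ n hS (-1) (-s)
  simp only [neg_mul, one_mul, neg_le_neg_iff, neg_neg] at h
  refine h.trans (Real.exp_le_exp.2 ?_)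
  have h1 : Real.exp (-1) < 1 / 2 := by
    have := Real.exp_neg_one_lt_d9; linarith
  have h2 : 0 ≤ (n : ℝ) * μ.real S := by positivity
  nlinarith

/-! ### Probability estimates for the model -/

namespace GTG

variable {d : ℕ}

instance isProbabilityMeasure_volume_torus :
    IsProbabilityMeasure (volume : Measure (UnitAddTorus (Fin d))) := by
  have : IsProbabilityMeasure (volume : Measure UnitAddCircle) :=
    ⟨by rw [AddCircle.measure_univ, ENNReal.ofReal_one]⟩
  rw [volume_pi]
  infer_instance

instance isProbabilityMeasure_law (ρ : Measure ℝ) [IsProbabilityMeasure ρ] (n : ℕ) : IsProbabilityMeasure (law d ρ n) := by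
  unfold law; infer_instance

theorem volume_closedBall_le (x : UnitAddTorus (Fin d)) (r : ℝ) (hr : 0 ≤ r) :
    volume (Metric.closedBall x r) ≤ ENNReal.ofReal ((2 * r) ^ d) := by
  rw [volume_pi_closedBall x hr]
  simp_rw [AddCircle.volume_closedBall]
  rw [Finset.prod_const, Finset.card_univ, Fintype.card_fin, ENNReal.ofReal_pow (by positivity)]
  gcongr
  exact min_le_right _ _

theorem volume_closedBall_eq (x : UnitAddTorus (Fin d)) (r : ℝ) (hr : 0 ≤ r) (hr1 : 2 * r ≤ 1) :
    volume (Metric.closedBall x r) = ENNReal.ofReal ((2 * r) ^ d) := by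
  rw [volume_pi_closedBall x hr]
  simp_rw [AddCircle.volume_closedBall]
  rw [Finset.prod_const, Finset.card_univ, Fintype.card_fin, ENNReal.ofReal_pow (by positivity),
    min_eq_right hr1]

/-- The box is too small to wrap around the torus. This keeps distinct lattice vectors, and hence
their clusters, disjoint in the sparsity estimate. -/
theorem red_injOn_box {M r : ℕ} (hr : 2 * r < M) :
    Set.InjOn (red M) (Grid.box d r : Set (Fin d → ℤ)) := by
  intro v hv v' hv' h
  rw [Finset.mem_coe, Grid.mem_box] at hv hv'
  ext i
  have h1 := congrFun h i
  simp only [red] at h1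
  rw [ZMod.intCast_eq_intCast_iff_dvd_sub] at h1
  have h2 := hv i
  have h3 := hv' i
  have := Int.eq_zero_of_abs_lt_dvd h1 (by rw [abs_lt]; constructor <;> omega)
  omega

section

variable (ρ : Measure ℝ) [IsProbabilityMeasure ρ] (n : ℕ) {M : ℕ} [NeZero M]

/-- Positions and weights reaching the `r`-mesh neighbourhood of the lattice point `a`. -/
def reaching (θ : ℝ) (r : ℕ) (a : Fin d → ZMod M) : Set (UnitAddTorus (Fin d) × ℝ) :=
  {q | ‖q.1 - pt a‖ ≤ (2 * |q.2| / θ) ^ ((d : ℝ)⁻¹) + r * (1 / M)}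

theorem measurableSet_reaching (θ : ℝ) (r : ℕ) (a : Fin d → ZMod M) :
    MeasurableSet (reaching θ r a) := by
  unfold reaching
  refine measurableSet_le ?_ ?_
  · exact (measurable_fst.sub_const _).norm
  · exact (((measurable_snd.abs.const_mul 2).div_const θ).pow_const _).add_const _

/-- For a fixed weight the section is a ball whose volume is bounded by a term linear in the weight
plus the volume of the local neighbourhood; integrating requires only a finite mean. -/
theorem measure_reaching_le (hd : 0 < d) (hW : Integrable (fun w : ℝ => w) ρ) {θ : ℝ} (hθ : 0 < θ)
    (r : ℕ) (a : Fin d → ZMod M) :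
    ((volume : Measure (UnitAddTorus (Fin d))).prod ρ).real (reaching θ r a)
      ≤ 4 ^ d * (2 * (∫ w, |w| ∂ρ) / θ + (r * (1 / M)) ^ d) := by
  have hs := mesh_pos (M := M)
  have hI : Integrable (fun w : ℝ => (4 : ℝ) ^ d * (2 * |w| / θ + (r * (1 / M)) ^ d)) ρ :=
    ((((hW.abs).const_mul 2).div_const θ).add (integrable_const _)).const_mul _
  have hint : ∫ w, (4 : ℝ) ^ d * (2 * |w| / θ + (r * (1 / M)) ^ d) ∂ρ
      = 4 ^ d * (2 * (∫ w, |w| ∂ρ) / θ + (r * (1 / M)) ^ d) := by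
    rw [integral_const_mul, integral_add (((hW.abs).const_mul 2).div_const θ) (integrable_const _),
      integral_div, integral_const_mul]
    simp
  rw [← hint]
  have hpos : ∀ w : ℝ, 0 ≤ (4 : ℝ) ^ d * (2 * |w| / θ + (r * (1 / M)) ^ d) := fun w => by positivity
  refine ENNReal.toReal_le_of_le_ofReal (integral_nonneg hpos) ?_
  rw [Measure.prod_apply_symm (measurableSet_reaching θ r a),
    ofReal_integral_eq_lintegral_ofReal hI (Eventually.of_forall hpos)]
  refine lintegral_mono fun w => ?_
  have hset : (fun x => (x, w)) ⁻¹' reaching θ r a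
      = Metric.closedBall (pt a) ((2 * |w| / θ) ^ ((d : ℝ)⁻¹) + r * (1 / M)) := by
    ext x; simp [reaching, dist_eq_norm]
  have h0 : 0 ≤ (2 * |w| / θ) ^ ((d : ℝ)⁻¹) := by positivity
  have h1 : 0 ≤ r * (1 / (M : ℝ)) := by positivity
  rw [hset]
  refine (volume_closedBall_le _ _ (by positivity)).trans (ENNReal.ofReal_le_ofReal ?_)
  have hmul : ∀ A B : ℝ, 0 ≤ A → 0 ≤ B → (2 * (A + B)) ^ d ≤ 4 ^ d * (A ^ d + B ^ d) := by
    intro A B hA hB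
    rcases le_total A B with hAB | hAB
    · calc (2 * (A + B)) ^ d ≤ (4 * B) ^ d := pow_le_pow_left₀ (by positivity) (by linarith) d
        _ = 4 ^ d * B ^ d := mul_pow _ _ _
        _ ≤ _ := by gcongr; have := pow_nonneg hA d; linarith
    · calc (2 * (A + B)) ^ d ≤ (4 * A) ^ d := pow_le_pow_left₀ (by positivity) (by linarith) d
        _ = 4 ^ d * A ^ d := mul_pow _ _ _
        _ ≤ _ := by gcongr; have := pow_nonneg hB d; linarith
  have h2 := hmul _ _ h0 h1
  rwa [Real.rpow_inv_natCast_pow (by positivity) hd.ne'] at h2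

open Classical in
theorem law_exists_le_card_reaching_le (hd : 0 < d) (hW : Integrable (fun w : ℝ => w) ρ) {θ : ℝ}
    (hθ : 0 < θ) (r : ℕ) (s : ℝ) :
    (law d ρ n).real {ω | ∃ a : Fin d → ZMod M,
        s ≤ ((Finset.univ.filter fun i => ω i ∈ reaching θ r a).card : ℝ)}
      ≤ M ^ d * Real.exp (-s + 2 * (n * (4 ^ d * (2 * (∫ w, |w| ∂ρ) / θ + (r * (1 / M)) ^ d)))) := by
  have hset : {ω : Config d n | ∃ a : Fin d → ZMod M,
        s ≤ ((Finset.univ.filter fun i => ω i ∈ reaching θ r a).card : ℝ)}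
      = ⋃ a ∈ (Finset.univ : Finset (Fin d → ZMod M)), {ω : Config d n |
        s ≤ ((Finset.univ.filter fun i => ω i ∈ reaching θ r a).card : ℝ)} := by
    ext ω; simp
  rw [hset]
  refine (measureReal_biUnion_finset_le _ _).trans ?_
  have hcard : (M : ℝ) ^ d = (Finset.univ : Finset (Fin d → ZMod M)).card := by
    rw [Finset.card_univ, Fintype.card_fun, ZMod.card, Fintype.card_fin]; push_cast; rfl
  rw [hcard, ← nsmul_eq_mul, ← Finset.sum_const]
  refine Finset.sum_le_sum fun a _ => ?_
  refine (Measure.pi_real_le_count_le _ n (measurableSet_reaching θ r a) s).trans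
    (Real.exp_le_exp.2 ?_)
  gcongr
  exact measure_reaching_le ρ hd hW hθ r a

/-- Positions and weights of heavy nodes of the cluster at `a`. -/
def heavyNear (m₀ : ℝ) (a : Fin d → ZMod M) : Set (UnitAddTorus (Fin d) × ℝ) :=
  Metric.closedBall (pt a) (1 / (3 * M)) ×ˢ Set.Ici m₀

theorem measurableSet_heavyNear (m₀ : ℝ) (a : Fin d → ZMod M) : MeasurableSet (heavyNear m₀ a) :=
  Metric.isClosed_closedBall.measurableSet.prod measurableSet_Ici

theorem measure_heavyNear (m₀ : ℝ) (a : Fin d → ZMod M) :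
    ((volume : Measure (UnitAddTorus (Fin d))).prod ρ).real (heavyNear m₀ a)
      = (2 / (3 * M)) ^ d * ρ.real (Set.Ici m₀) := by
  have hM : (1 : ℝ) ≤ M := by exact_mod_cast Nat.pos_of_ne_zero (NeZero.ne M)
  have h1 : 2 * (1 / (3 * (M : ℝ))) = 2 / (3 * M) := by ring
  rw [heavyNear, measureReal_prod_prod, Measure.real, volume_closedBall_eq _ _ (by positivity),
    ENNReal.toReal_ofReal (by positivity), h1]
  rw [h1, div_le_one (by positivity)]; linarith

theorem disjoint_heavyNear (m₀ : ℝ) {a b : Fin d → ZMod M} (hab : a ≠ b) :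
    Disjoint (heavyNear m₀ a) (heavyNear m₀ b) := by
  rw [Set.disjoint_left]
  rintro q ⟨hqa, -⟩ ⟨hqb, -⟩
  rw [Metric.mem_closedBall, dist_eq_norm, third_mesh] at hqa hqb
  have h1 := le_norm_pt_sub a b hab
  have h2 := norm_sub_le_norm_sub_add_norm_sub (pt a) q.1 (pt b)
  rw [norm_sub_rev (pt a) q.1] at h2
  have := mesh_pos (M := M)
  linarith

open Classical in
/-- Unpopulated lattice points are sparse with high probability. -/
theorem law_exists_not_sparse_le (m₀ ℓ : ℝ) (k₀ r : ℕ) (hr : 2 * r < M) :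
    (law d ρ n).real {ω | ∃ a : Fin d → ZMod M,
        k₀ < ((Grid.box d r).filter (· ∉ populated ω m₀ ℓ a)).card}
      ≤ M ^ d * (2 ^ (Grid.box d r).card *
        Real.exp ((k₀ + 1) * ℓ - n * ((k₀ + 1) * ((2 / (3 * M)) ^ d * ρ.real (Set.Ici m₀))) / 2)) := by
  set b := Real.exp ((k₀ + 1) * ℓ - n * ((k₀ + 1) * ((2 / (3 * M)) ^ d * ρ.real (Set.Ici m₀))) / 2)
  have hsub : {ω : Config d n | ∃ a : Fin d → ZMod M,
        k₀ < ((Grid.box d r).filter (· ∉ populated ω m₀ ℓ a)).card}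
      ⊆ ⋃ a ∈ (Finset.univ : Finset (Fin d → ZMod M)),
        ⋃ T ∈ (Grid.box d r).powersetCard (k₀ + 1), {ω : Config d n |
          ((Finset.univ.filter fun i => ω i ∈ ⋃ v ∈ T, heavyNear m₀ (a + red M v)).card : ℝ)
            ≤ (k₀ + 1) * ℓ} := by
    -- Select exactly `k₀ + 1` unpopulated points. Their disjoint cells together hold at most `(k₀ +
    -- 1) * ℓ` heavy nodes, so the lower-tail exponent is multiplied by `k₀ + 1`, enough to beat the
    -- union over `a`.
    rintro ω ⟨a, ha⟩
    obtain ⟨T, hT, hTc⟩ := Finset.exists_subset_card_eq (Nat.succ_le_of_lt ha)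
    refine Set.mem_iUnion₂.2 ⟨a, Finset.mem_univ a, Set.mem_iUnion₂.2 ⟨T,
      Finset.mem_powersetCard.2 ⟨hT.trans (Finset.filter_subset _ _), hTc⟩, ?_⟩⟩
    have h1 : (Finset.univ.filter fun i => ω i ∈ ⋃ v ∈ T, heavyNear m₀ (a + red M v))
        ⊆ T.biUnion fun v => cluster ω m₀ (a + red M v) := by
      intro i hi
      simp only [Finset.mem_filter, Finset.mem_univ, true_and, Set.mem_iUnion] at hi
      obtain ⟨v, hv, hiv⟩ := hi
      refine Finset.mem_biUnion.2 ⟨v, hv, mem_cluster.2 ⟨hiv.2, ?_⟩⟩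
      rw [← dist_eq_norm]; exact hiv.1
    have h2 : ((T.biUnion fun v => cluster ω m₀ (a + red M v)).card : ℝ)
        ≤ ∑ v ∈ T, ((cluster ω m₀ (a + red M v)).card : ℝ) := by
      exact_mod_cast Finset.card_biUnion_le
    have h3 : ∑ v ∈ T, ((cluster ω m₀ (a + red M v)).card : ℝ) ≤ ∑ _v ∈ T, ℓ := by
      refine Finset.sum_le_sum fun v hv => ?_
      have := (Finset.mem_filter.1 (hT hv)).2
      exact (not_le.1 this).le
    rw [Finset.sum_const, hTc, nsmul_eq_mul] at h3
    push_cast at h3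
    have h4 : ((Finset.univ.filter fun i => ω i ∈ ⋃ v ∈ T, heavyNear m₀ (a + red M v)).card : ℝ)
        ≤ ((T.biUnion fun v => cluster ω m₀ (a + red M v)).card : ℝ) := by
      exact_mod_cast Finset.card_le_card h1
    exact h4.trans (h2.trans h3)
  refine (measureReal_mono hsub (measure_ne_top _ _)).trans ((measureReal_biUnion_finset_le _ _).trans ?_)
  have hcard : (M : ℝ) ^ d = (Finset.univ : Finset (Fin d → ZMod M)).card := by
    rw [Finset.card_univ, Fintype.card_fun, ZMod.card, Fintype.card_fin]; push_cast; rfl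
  rw [hcard, ← nsmul_eq_mul, ← Finset.sum_const]
  refine Finset.sum_le_sum fun a _ => (measureReal_biUnion_finset_le _ _).trans ?_
  have hb0 : 0 ≤ b := (Real.exp_pos _).le
  have hT : ∀ T ∈ (Grid.box d r).powersetCard (k₀ + 1), (law d ρ n).real {ω : Config d n |
          ((Finset.univ.filter fun i => ω i ∈ ⋃ v ∈ T, heavyNear m₀ (a + red M v)).card : ℝ)
            ≤ (k₀ + 1) * ℓ} ≤ b := by
    intro T hT
    rw [Finset.mem_powersetCard] at hT
    have hmeas : MeasurableSet (⋃ v ∈ T, heavyNear m₀ (a + red M v)) :=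
      T.measurableSet_biUnion fun v _ => measurableSet_heavyNear m₀ _
    refine (Measure.pi_real_count_le_le _ n hmeas _).trans (le_of_eq ?_)
    rw [measureReal_biUnion_finset ?_ fun v _ => measurableSet_heavyNear m₀ _]
    · simp_rw [measure_heavyNear]
      rw [Finset.sum_const, hT.2, nsmul_eq_mul]
      push_cast
      rfl
    · intro v hv v' hv' hne
      refine disjoint_heavyNear m₀ fun h => hne ?_
      exact red_injOn_box hr (hT.1 hv) (hT.1 hv') (add_left_cancel h)
  refine (Finset.sum_le_sum hT).trans ?_
  rw [Finset.sum_const, nsmul_eq_mul]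
  refine mul_le_mul_of_nonneg_right ?_ hb0
  have : ((Grid.box d r).powersetCard (k₀ + 1)).card ≤ 2 ^ (Grid.box d r).card := by
    rw [← Finset.card_powerset]
    exact Finset.card_le_card fun T hT => Finset.mem_powerset.2 (Finset.mem_powersetCard.1 hT).1
  exact_mod_cast this

theorem ae_law_weight_nonneg (hρ : ∀ᵐ w ∂ρ, 0 ≤ w) : ∀ᵐ ω ∂law d ρ n, ∀ x, 0 ≤ (ω x).2 := by
  rw [ae_all_iff]
  intro x
  have h1 : ∀ᵐ q ∂((volume : Measure (UnitAddTorus (Fin d))).prod ρ), 0 ≤ q.2 :=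
    Measure.quasiMeasurePreserving_snd.ae hρ
  exact (Measure.quasiMeasurePreserving_eval
    (fun _ : Fin n => (volume : Measure (UnitAddTorus (Fin d))).prod ρ) x).ae h1

end

end GTG

/-- A tail bound of order larger than one gives a finite mean. -/
theorem integrable_id_of_tail (ρ : Measure ℝ) [IsProbabilityMeasure ρ] (hρ : ∀ᵐ w ∂ρ, 0 ≤ w)
    (p : ℝ) (hp : 1 < p)
    (htail : (fun x : ℝ => ρ.real (Set.Ici x)) =O[atTop] fun x : ℝ => 1 / x ^ p) :
    Integrable (fun w : ℝ => w) ρ := by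
  obtain ⟨C, hC⟩ := htail.bound
  obtain ⟨x₀, hx₀⟩ := eventually_atTop.1 hC
  set y := max x₀ 1
  have hy : 0 < y := lt_of_lt_of_le one_pos (le_max_right _ _)
  refine ⟨measurable_id.aestronglyMeasurable, ?_⟩
  rw [hasFiniteIntegral_iff_ofReal hρ, lintegral_eq_lintegral_meas_le ρ hρ measurable_id.aemeasurable]
  have hsplit : Set.Ioi (0 : ℝ) ⊆ Set.Ioc 0 y ∪ Set.Ioi y := by
    intro t ht
    rcases le_or_gt t y with h | h
    · exact Or.inl ⟨ht, h⟩
    · exact Or.inr h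
  -- In the layer cake formula the tail is at most one up to `y`, and `C * t ^ (-p)` beyond it is
  -- integrable because `p > 1`.
  refine lt_of_le_of_lt ((lintegral_mono_set hsplit).trans (lintegral_union_le _ _ _)) ?_
  refine ENNReal.add_lt_top.2 ⟨?_, ?_⟩
  · refine lt_of_le_of_lt (setLIntegral_mono measurable_const fun t _ => prob_le_one) ?_
    simp
  · have hI : IntegrableOn (fun t : ℝ => C * t ^ (-p)) (Set.Ioi y) :=
      (integrableOn_Ioi_rpow_of_lt (by linarith) hy).const_mul C
    refine lt_of_le_of_lt (setLIntegral_mono' (g := fun t : ℝ => ENNReal.ofReal (C * t ^ (-p)))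
      measurableSet_Ioi fun t ht => ?_) hI.lintegral_lt_top
    have ht0 : 0 < t := hy.trans ht
    have h1 := hx₀ t ((le_max_left _ _).trans (le_of_lt ht))
    rw [Real.norm_of_nonneg measureReal_nonneg, Real.norm_of_nonneg (by positivity)] at h1
    rw [Real.rpow_neg ht0.le, ← one_div]
    change ρ (Set.Ici t) ≤ _
    rw [← ofReal_measureReal]
    exact ENNReal.ofReal_le_ofReal h1

/-- A law without atom at the origin charges some half line `[m, ∞)` with `m > 0`. -/
theorem exists_pos_measure_Ici (ρ : Measure ℝ) [IsProbabilityMeasure ρ] (hac : ρ ≪ volume)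
    (hρ : ∀ᵐ w ∂ρ, 0 ≤ w) : ∃ m : ℝ, 0 < m ∧ 0 < ρ.real (Set.Ici m) := by
  by_contra! hcon
  have h0 : ∀ k : ℕ, ρ (Set.Ici (1 / ((k : ℝ) + 1))) = 0 := by
    intro k
    have := hcon (1 / ((k : ℝ) + 1)) (by positivity)
    exact (measureReal_eq_zero_iff).1 (le_antisymm this measureReal_nonneg)
  have h1 : ρ (Set.Ioi 0) = 0 := by
    refine measure_mono_null (fun w hw => ?_) (measure_iUnion_null h0)
    obtain ⟨k, hk⟩ := exists_nat_one_div_lt (Set.mem_Ioi.1 hw)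
    exact Set.mem_iUnion.2 ⟨k, hk.le⟩
  have h2 : ρ {0} = 0 := hac (by simp)
  have h3 : ρ (Set.Ici 0)ᶜ = 0 := hρ
  have h4 : ρ Set.univ = 0 := by
    refine measure_mono_null (t := Set.Ioi 0 ∪ {0} ∪ (Set.Ici 0)ᶜ) (fun w _ => ?_)
      (measure_union_null (measure_union_null h1 h2) h3)
    rcases lt_trichotomy w 0 with h | h | h
    · exact Or.inr (not_le.2 h)
    · exact Or.inl (Or.inr h)
    · exact Or.inl (Or.inl h)
  simp at h4

/-! ### The mixing time of geographical threshold graphs -/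

namespace GTG

theorem one_le_poincareConst {d k₀ M : ℕ} {N ℓ : ℝ} (hN : 0 ≤ N) : 1 ≤ poincareConst d k₀ M N ℓ := by
  unfold poincareConst
  have h1 : 0 ≤ 24 * N ^ 3 * overlap d k₀ := by positivity
  have h2 : 0 ≤ 6 * (N / ℓ) ^ 2 * (overlap d k₀ *
    (d ^ 2 * M ^ 2 * ((Grid.box d (localRadius d k₀ + 1)).card : ℝ) ^ 3 + 1)) := by positivity
  linarith

variable {d n : ℕ} {M : ℕ} [NeZero M] {ω : Config d n} {θ m₀ ℓ : ℝ} {k₀ : ℕ}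

open Classical in
theorem card_nearFinset_le {N : ℝ} (a : Fin d → ZMod M)
    (hN : ((Finset.univ.filter fun i => ω i ∈ reaching θ (localRadius d k₀ + 3) a).card : ℝ) ≤ N)
    (hθ : 0 < θ) : ((nearFinset ω k₀ a).card : ℝ) ≤ N := by
  refine le_trans (Nat.cast_le.2 (Finset.card_le_card fun x hx => ?_)) hN
  have hx := (Finset.mem_filter.1 hx).2
  refine Finset.mem_filter.2 ⟨Finset.mem_univ x, hx.trans ?_⟩
  have : 0 ≤ (2 * |(ω x).2| / θ) ^ ((d : ℝ)⁻¹) := by positivity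
  linarith

open Classical in
-- An edge to a heavier node satisfies `θ * r ^ d ≤ 2 * w`, with `w` the weight of that node. So all
-- heavier neighbours of `x` reach the lattice point next to `x`, and one count bounds them together
-- with the local nodes.
theorem card_heavier_neighbors_le (hd : 0 < d) {N : ℝ} (hθ : 0 < θ)
    (hN : ∀ a : Fin d → ZMod M,
      ((Finset.univ.filter fun i => ω i ∈ reaching θ (localRadius d k₀ + 3) a).card : ℝ) ≤ N)
    (x : Fin n) :
    ((Finset.univ.filter fun y => (graph θ ω).Adj x y ∧ (ω x).2 ≤ (ω y).2).card : ℝ) ≤ N := by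
  obtain ⟨a, ha⟩ := exists_near_pt (M := M) (ω x).1
  refine le_trans (Nat.cast_le.2 (Finset.card_le_card fun y hy => ?_)) (hN a)
  obtain ⟨hxy, hw⟩ := (Finset.mem_filter.1 hy).2
  refine Finset.mem_filter.2 ⟨Finset.mem_univ y, ?_⟩
  have h1 : toricDist (ω x).1 (ω y).1 ^ d ≤ 2 * |(ω y).2| / θ := by
    rw [le_div_iff₀ hθ, mul_comm]
    have h2 := hxy.2
    have h3 := le_abs_self (ω y).2
    linarith
  have h2 : toricDist (ω x).1 (ω y).1 ≤ (2 * |(ω y).2| / θ) ^ ((d : ℝ)⁻¹) := by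
    rw [← Real.pow_rpow_inv_natCast (toricDist_nonneg (ω x).1 (ω y).1) hd.ne']
    exact Real.rpow_le_rpow (pow_nonneg (toricDist_nonneg _ _) d) h1 (by positivity)
  have h3 := norm_sub_le_toricDist (ω x).1 (ω y).1
  have h4 := norm_sub_le_norm_sub_add_norm_sub (ω y).1 (ω x).1 (pt a)
  rw [norm_sub_rev (ω y).1 (ω x).1] at h4
  have h5 := mesh_pos (M := M)
  change ‖(ω y).1 - pt a‖ ≤ _
  have h6 : (1 : ℝ) ≤ (localRadius d k₀ + 3 : ℕ) := by
    exact_mod_cast (by omega : 1 ≤ localRadius d k₀ + 3)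
  have h7 := mul_le_mul_of_nonneg_right h6 h5.le
  linarith

open Classical in
theorem mixingTime_graph_le (hd : 2 ≤ d) (hn : 2 ≤ n) (hw : ∀ x, 0 ≤ (ω x).2) (hθ : 0 < θ)
    (hrange : θ * (d * (2 * (1 / M))) ^ d ≤ m₀) (hℓ : 4 ≤ ℓ) {N : ℝ} (hN1 : 1 ≤ N)
    (hsparse : ∀ a : Fin d → ZMod M,
      ((Grid.box d (localRadius d k₀ + 1)).filter (· ∉ populated ω m₀ ℓ a)).card ≤ k₀)
    (hN : ∀ a : Fin d → ZMod M,
      ((Finset.univ.filter fun i => ω i ∈ reaching θ (localRadius d k₀ + 3) a).card : ℝ) ≤ N)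
    (hG : (graph θ ω).Connected) (T : ℕ)
    (hT : 4 * poincareConst d k₀ M N ℓ * Real.log n ≤ T) :
    (graph θ ω).mixingTime (1 / (n : ℝ)) ≤ T := by
  have hreg : Regular ω M θ m₀ ℓ k₀ := ⟨hd, hw, hθ, hrange, by linarith, hsparse⟩
  have hN' := fun a : Fin d → ZMod M => card_nearFinset_le a (hN a) hθ
  have hdeg := card_heavier_neighbors_le (by omega) hθ hN
  have h := SimpleGraph.mixingTime_le_of_poincare (graph θ ω) hG (by rwa [Fintype.card_fin])
    (poincareConst d k₀ M N ℓ) (one_le_poincareConst (by linarith))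
    (hreg.poincare hG hN1 hN' hdeg) (hreg.signless_poincare hG hℓ hN1 hN' hdeg) T
    (by rwa [Fintype.card_fin])
  rwa [Fintype.card_fin] at h

/-- The mesh of the discretisation. -/
noncomputable def meshCount (d : ℕ) (B x l : ℝ) : ℕ := ⌈(B * x / l) ^ ((d : ℝ)⁻¹)⌉₊

/-- The real root is at least one, so rounding it up at most doubles it. The growth condition places
`l ^ 2` below the mesh count, which later absorbs the cubed logarithm. -/
theorem meshCount_bounds (hd : 2 ≤ d) {B x l : ℝ} (hB : 0 < B) (hx : 0 < x) (hl : 1 ≤ l)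
    (hlx : l ^ (2 * d + 1) ≤ B * x) :
    l ^ 2 ≤ meshCount d B x l ∧ B * x / l ≤ (meshCount d B x l : ℝ) ^ d ∧
      (meshCount d B x l : ℝ) ^ d ≤ 2 ^ d * (B * x / l) ∧
      (meshCount d B x l : ℝ) ^ 2 ≤ 4 * (B * x / l) ^ ((2 : ℝ) / d) := by
  have hl0 : 0 < l := by linarith
  have hd0 : d ≠ 0 := by omega
  set q := B * x / l with hq
  have hq0 : 0 < q := by positivity
  set y := q ^ ((d : ℝ)⁻¹) with hy
  have hy0 : 0 ≤ y := by positivity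
  have hyd : y ^ d = q := Real.rpow_inv_natCast_pow hq0.le hd0
  have hly : l ^ 2 ≤ y := by
    have h1 : (l ^ 2) ^ d ≤ y ^ d := by
      rw [hyd, hq, le_div_iff₀ hl0, ← pow_mul, ← pow_succ]; exact hlx
    exact (pow_le_pow_iff_left₀ (by positivity) hy0 hd0).1 h1
  have hy1 : 1 ≤ y := le_trans (one_le_pow₀ hl) hly
  have hM1 : y ≤ (meshCount d B x l : ℝ) := Nat.le_ceil _
  have hM2 : (meshCount d B x l : ℝ) ≤ 2 * y := by
    have := Nat.ceil_lt_add_one hy0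
    change ((⌈y⌉₊ : ℕ) : ℝ) ≤ _
    linarith
  refine ⟨hly.trans hM1, ?_, ?_, ?_⟩
  · rw [← hyd]; exact pow_le_pow_left₀ hy0 hM1 d
  · rw [← hyd, ← mul_pow]; exact pow_le_pow_left₀ (by positivity) hM2 d
  · have h1 : q ^ ((2 : ℝ) / d) = y ^ 2 := by
      rw [hy, ← Real.rpow_natCast, ← Real.rpow_mul hq0.le]
      congr 1
      push_cast
      ring
    rw [h1]
    calc _ ≤ (2 * y) ^ 2 := pow_le_pow_left₀ (by positivity) hM2 2
      _ = _ := by ring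

/-- Failure probability at a fixed large `n`. -/
theorem law_compl_le (hd : 2 ≤ d) (ρ : Measure ℝ) [IsProbabilityMeasure ρ]
    (hρ : ∀ᵐ w ∂ρ, 0 ≤ w) (hW : Integrable (fun w : ℝ => w) ρ) {m₀ c : ℝ} (hm₀ : 0 < m₀)
    (hp₀ : 0 < ρ.real (Set.Ici m₀)) (hc : 0 < c) :
    ∃ K C X B : ℝ, 0 < B ∧ ∀ n : ℕ, 2 ≤ n → X ≤ Real.log n →
      Real.log n ^ (2 * d + 1) ≤ B * n →
      law d ρ n {ω | (graph (c * (n : ℝ) / Real.log n) ω).Connected →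
        ((graph (c * (n : ℝ) / Real.log n) ω).mixingTime (1 / (n : ℝ)) : ℝ≥0∞) ≤
          ENNReal.ofReal
            (K * ((n : ℝ) ^ ((2 : ℝ) / d) * Real.log n ^ (((d : ℝ) - 2) / d)))}ᶜ
        ≤ ENNReal.ofReal (C / n) := by
  classical
  have hdpos : (0 : ℝ) < d := by exact_mod_cast (by omega : 0 < d)
  obtain ⟨p₀, hp₀_def⟩ : ∃ x, x = ρ.real (Set.Ici m₀) := ⟨_, rfl⟩
  rw [← hp₀_def] at hp₀
  -- With `M ^ d ≥ B * n / log n`, this value makes the threshold at distance `d` times two meshes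
  -- at most `m₀`.
  obtain ⟨B, hB⟩ : ∃ x : ℝ, x = c * (2 * d) ^ d / m₀ := ⟨_, rfl⟩
  have hB0 : 0 < B := by rw [hB]; positivity
  -- Expected cluster sizes are at least `c₁ * log n`; the `2 ^ d` lost by rounding the mesh cancels
  -- the one in the cell volume.
  obtain ⟨c₁, hc₁⟩ : ∃ x : ℝ, x = p₀ / (3 ^ d * B) := ⟨_, rfl⟩
  have hc₁0 : 0 < c₁ := by rw [hc₁]; positivity
  -- Being populated means a quarter of the mean bound, `ℓ = c₁ / 4 * log n`, while the lower tail
  -- costs half of the mean. The net exponent `(k₀ + 1) * c₁ / 4` must be at least 2.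
  obtain ⟨k₀, hk₀⟩ : ∃ x : ℕ, x = ⌈8 / c₁⌉₊ := ⟨_, rfl⟩
  have hk₀' : 2 ≤ (k₀ + 1) * (c₁ / 4) := by
    have h1 : 8 / c₁ ≤ k₀ := by rw [hk₀]; exact Nat.le_ceil _
    rw [div_le_iff₀ hc₁0] at h1
    linarith
  obtain ⟨r, hr⟩ : ∃ x : ℕ, x = localRadius d k₀ + 3 := ⟨_, rfl⟩
  obtain ⟨W, hWdef⟩ : ∃ x, x = ∫ w, |w| ∂ρ := ⟨_, rfl⟩
  have hW0 : 0 ≤ W := by rw [hWdef]; exact integral_nonneg fun _ => abs_nonneg _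
  -- The expected number of nodes reaching a local box is at most `C₅ * log n`. Taking `N = (2 * C₅
  -- + 2) * log n` leaves the exponent `-2 * log n` in the upper tail.
  obtain ⟨C₅, hC₅⟩ : ∃ x : ℝ, x = 4 ^ d * (2 * W / c + r ^ d / B) := ⟨_, rfl⟩
  have hC₅0 : 0 ≤ C₅ := by rw [hC₅]; positivity
  obtain ⟨κ, hκ⟩ : ∃ x : ℝ, x = (2 * C₅ + 2) / (c₁ / 4) := ⟨_, rfl⟩
  obtain ⟨Λ, hΛ⟩ : ∃ x : ℝ, x = ((Grid.box d (localRadius d k₀ + 1)).card : ℝ) := ⟨_, rfl⟩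
  have hΛ0 : 0 ≤ Λ := hΛ ▸ Nat.cast_nonneg _
  obtain ⟨ov, hov⟩ : ∃ x : ℝ, x = (overlap d k₀ : ℝ) := ⟨_, rfl⟩
  have hov0 : 0 ≤ ov := hov ▸ Nat.cast_nonneg _
  obtain ⟨C₆, hC₆⟩ : ∃ x : ℝ, x = 1 + 24 * (2 * C₅ + 2) ^ 3 * ov
    + 6 * κ ^ 2 * (ov * (d ^ 2 * Λ ^ 3 + 1)) := ⟨_, rfl⟩
  have hC₆1 : 1 ≤ C₆ := by
    have h1 : 0 ≤ 24 * (2 * C₅ + 2) ^ 3 * ov := by positivity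
    have h2 : 0 ≤ 6 * κ ^ 2 * (ov * (d ^ 2 * Λ ^ 3 + 1)) := by positivity
    rw [hC₆]; linarith
  obtain ⟨b, hb⟩ : ∃ x : ℕ, x = (Grid.box d (localRadius d k₀ + 1)).card := ⟨_, rfl⟩
  -- The thresholds on `log n` ensure, in order, `log n ≥ 1`, clusters of at least four nodes, at
  -- most `n` lattice points, and boxes that do not wrap around. The 20 is 5 from rounding the time
  -- up times 4 from rounding the mesh up.
  refine ⟨20 * C₆ * B ^ ((2 : ℝ) / d), 2 ^ b + 1,
    max (max 1 (16 / c₁)) (max (2 ^ d * B) (2 * (localRadius d k₀ + 1) + 1)), B, hB0, ?_⟩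
  intro n hn hX hln
  obtain ⟨l, hl⟩ : ∃ x, x = Real.log n := ⟨_, rfl⟩
  rw [← hl] at hX hln ⊢
  have hl1 : 1 ≤ l := ((le_max_left _ _).trans (le_max_left _ _)).trans hX
  have hl2 : 16 / c₁ ≤ l := ((le_max_right _ _).trans (le_max_left _ _)).trans hX
  have hl3 : 2 ^ d * B ≤ l := ((le_max_left _ _).trans (le_max_right _ _)).trans hX
  have hl4 : 2 * ((localRadius d k₀ : ℝ) + 1) + 1 ≤ l :=
    ((le_max_right _ _).trans (le_max_right _ _)).trans hX
  have hl0 : 0 < l := by linarith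
  have hn0 : (0 : ℝ) < n := by exact_mod_cast (by omega : 0 < n)
  obtain ⟨M, hM⟩ : ∃ x, x = meshCount d B n l := ⟨_, rfl⟩
  obtain ⟨hM1, hM2, hM3, hM4⟩ := meshCount_bounds hd hB0 hn0 hl1 hln
  rw [← hM] at hM1 hM2 hM3 hM4
  have hM0 : (1 : ℝ) ≤ M := (one_le_pow₀ hl1).trans hM1
  have hMpos : (0 : ℝ) < M := by linarith
  have : NeZero M := ⟨by rintro h; rw [h] at hM0; norm_num at hM0⟩
  have hMd : (0 : ℝ) < (M : ℝ) ^ d := by positivity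
  have hlM : l ≤ M := (le_self_pow₀ hl1 two_ne_zero).trans hM1
  have hMn : (M : ℝ) ^ d ≤ n := by
    refine hM3.trans ?_
    rw [← mul_div_assoc, div_le_iff₀ hl0, ← mul_assoc, mul_comm (n : ℝ)]
    gcongr
  have hbox : 2 * (localRadius d k₀ + 1) < M := by
    have : ((2 * (localRadius d k₀ + 1) : ℕ) : ℝ) < M := by push_cast; linarith
    exact_mod_cast this
  have hnM1 : (n : ℝ) / M ^ d ≤ l / B := by
    rw [div_le_div_iff₀ hMd hB0]
    rw [div_le_iff₀ hl0] at hM2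
    linarith
  have hnM2 : l / (2 ^ d * B) ≤ (n : ℝ) / M ^ d := by
    rw [div_le_div_iff₀ (by positivity) hMd]
    rw [← mul_div_assoc, le_div_iff₀ hl0] at hM3
    linarith
  obtain ⟨θ, hθ⟩ : ∃ x : ℝ, x = c * n / l := ⟨_, rfl⟩
  rw [← hθ]
  have hθ0 : 0 < θ := by rw [hθ]; positivity
  have hrange : θ * (d * (2 * (1 / M))) ^ d ≤ m₀ := by
    have e1 : θ * (d * (2 * (1 / (M : ℝ)))) ^ d = c / l * (2 * d) ^ d * (n / M ^ d) := by
      rw [hθ, show (d : ℝ) * (2 * (1 / (M : ℝ))) = 2 * d / M by ring, div_pow]; ring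
    rw [e1]
    calc c / l * (2 * d) ^ d * (n / M ^ d) ≤ c / l * (2 * d) ^ d * (l / B) := by gcongr
      _ = m₀ := by rw [hB]; field_simp
  obtain ⟨ℓ, hℓ⟩ : ∃ x : ℝ, x = c₁ / 4 * l := ⟨_, rfl⟩
  have hℓ4 : 4 ≤ ℓ := by
    rw [div_le_iff₀ hc₁0] at hl2
    rw [hℓ]; linarith
  obtain ⟨N, hN⟩ : ∃ x : ℝ, x = (2 * C₅ + 2) * l := ⟨_, rfl⟩
  have hN1 : 1 ≤ N := by rw [hN]; exact one_le_mul_of_one_le_of_one_le (by linarith) hl1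
  have hexp : Real.exp (-(2 * l)) = 1 / (n : ℝ) ^ 2 := by
    rw [Real.exp_neg, two_mul, Real.exp_add, hl, Real.exp_log hn0, one_div, sq]
  have hbad₂ := law_exists_not_sparse_le ρ n (d := d) (M := M) m₀ ℓ k₀ (localRadius d k₀ + 1) hbox
  have hbad₃ := law_exists_le_card_reaching_le ρ n (d := d) (M := M) (by omega) hW hθ0 r N
  rw [← hp₀_def, ← hb] at hbad₂
  rw [← hWdef] at hbad₃
  set S₂ : Set (Config d n) := {ω | ∃ a : Fin d → ZMod M, k₀ < ((Grid.box d
    (localRadius d k₀ + 1)).filter (· ∉ populated ω m₀ ℓ a)).card}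
  set S₃ : Set (Config d n) := {ω | ∃ a : Fin d → ZMod M,
    N ≤ ((Finset.univ.filter fun i => ω i ∈ reaching θ r a).card : ℝ)}
  have hP₂ : (law d ρ n).real S₂ ≤ 2 ^ b / n := by
    have e1 : (k₀ + 1) * ℓ - n * ((k₀ + 1) * ((2 / (3 * (M : ℝ))) ^ d * p₀)) / 2 ≤ -(2 * l) := by
      have e2 : n * ((2 / (3 * (M : ℝ))) ^ d * p₀) = (2 / 3) ^ d * p₀ * (n / M ^ d) := by
        rw [show (2 : ℝ) / (3 * (M : ℝ)) = 2 / 3 / M by ring, div_pow (2 / 3 : ℝ)]; ring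
      have e3 : c₁ * l ≤ n * ((2 / (3 * (M : ℝ))) ^ d * p₀) := by
        rw [e2]
        calc c₁ * l = (2 / 3) ^ d * p₀ * (l / (2 ^ d * B)) := by
              rw [hc₁, div_pow]; field_simp
          _ ≤ _ := by gcongr
      have e4 : (0 : ℝ) ≤ k₀ + 1 := by positivity
      have e5 := mul_le_mul_of_nonneg_left e3 e4
      have e6 := mul_le_mul_of_nonneg_right hk₀' hl0.le
      rw [hℓ]
      linarith
    refine hbad₂.trans ?_
    calc _ ≤ (n : ℝ) * (2 ^ b * (1 / (n : ℝ) ^ 2)) := by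
          rw [← hexp]
          gcongr
      _ = _ := by field_simp
  have hP₃ : (law d ρ n).real S₃ ≤ 1 / n := by
    have e1 : -N + 2 * (n * (4 ^ d * (2 * W / θ + (r * (1 / (M : ℝ))) ^ d))) ≤ -(2 * l) := by
      have e2 : n * (4 ^ d * (2 * W / θ + (r * (1 / (M : ℝ))) ^ d))
          = 4 ^ d * (2 * W / c * l + r ^ d * (n / M ^ d)) := by
        rw [hθ, mul_one_div, div_pow]; field_simp
      have e3 : 4 ^ d * (2 * W / c * l + r ^ d * (n / M ^ d)) ≤ C₅ * l := by
        calc _ ≤ 4 ^ d * (2 * W / c * l + (r : ℝ) ^ d * (l / B)) := by gcongr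
          _ = C₅ * l := by rw [hC₅]; ring
      rw [e2, hN]
      linarith
    refine hbad₃.trans ?_
    calc _ ≤ (n : ℝ) * (1 / (n : ℝ) ^ 2) := by
          rw [← hexp]
          gcongr
      _ = _ := by field_simp
  -- The ratio `N / ℓ` is the constant `κ`, and `N ^ 3` is of order `(log n) ^ 3`, which is at most
  -- `M ^ 2`. So the grid term sets the order.
  have hconst : poincareConst d k₀ M N ℓ ≤ C₆ * M ^ 2 := by
    have e1 : N / ℓ = κ := by rw [hN, hℓ, hκ]; field_simp
    have e2 : l ^ 3 ≤ (M : ℝ) ^ 2 := by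
      calc l ^ 3 ≤ l ^ 4 := pow_le_pow_right₀ hl1 (by norm_num)
        _ = (l ^ 2) ^ 2 := by ring
        _ ≤ _ := pow_le_pow_left₀ (by positivity) hM1 2
    have e3 : (1 : ℝ) ≤ (M : ℝ) ^ 2 := one_le_pow₀ hM0
    have e4 : 24 * N ^ 3 * ov
        ≤ 24 * (2 * C₅ + 2) ^ 3 * ov * (M : ℝ) ^ 2 := by
      calc 24 * N ^ 3 * ov = 24 * (2 * C₅ + 2) ^ 3 * ov * l ^ 3 := by
            rw [hN]; ring
        _ ≤ _ := by gcongr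
    have e5 : 6 * κ ^ 2 * (ov * (d ^ 2 * M ^ 2 * Λ ^ 3 + 1))
        ≤ 6 * κ ^ 2 * (ov * (d ^ 2 * Λ ^ 3 + 1)) * (M : ℝ) ^ 2 := by
      calc _ ≤ 6 * κ ^ 2 * (ov * (d ^ 2 * M ^ 2 * Λ ^ 3 + (M : ℝ) ^ 2)) := by gcongr
        _ = _ := by ring
    unfold poincareConst
    rw [e1, ← hΛ, ← hov, hC₆, add_mul, add_mul]
    linarith
  have hgood : {ω : Config d n | (graph θ ω).Connected →
        ((graph θ ω).mixingTime (1 / (n : ℝ)) : ℝ≥0∞) ≤ ENNReal.ofReal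
            (20 * C₆ * B ^ ((2 : ℝ) / d) * ((n : ℝ) ^ ((2 : ℝ) / d) * l ^ (((d : ℝ) - 2) / d)))}ᶜ
      ⊆ {ω : Config d n | ¬ ∀ x, 0 ≤ (ω x).2} ∪ (S₂ ∪ S₃) := by
    intro ω hω
    by_contra hcon
    simp only [Set.mem_union, not_or] at hcon
    obtain ⟨h1, h2, h3⟩ := hcon
    apply hω
    intro hG
    have h1 : ∀ x, 0 ≤ (ω x).2 := not_not.1 h1
    have h2 : ∀ a : Fin d → ZMod M, ((Grid.box d
        (localRadius d k₀ + 1)).filter (· ∉ populated ω m₀ ℓ a)).card ≤ k₀ := by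
      intro a; by_contra hlt; exact h2 ⟨a, not_le.1 hlt⟩
    have h3 : ∀ a : Fin d → ZMod M,
        ((Finset.univ.filter fun i => ω i ∈ reaching θ r a).card : ℝ) ≤ N := by
      intro a; by_contra hlt; exact h3 ⟨a, (not_le.1 hlt).le⟩
    rw [hr] at h3
    obtain ⟨A, hA⟩ : ∃ x, x = poincareConst d k₀ M N ℓ := ⟨_, rfl⟩
    have h4 := mixingTime_graph_le hd hn h1 hθ0 hrange hℓ4 hN1 h2 h3 hG ⌈4 * A * l⌉₊
      (by rw [← hA, ← hl]; exact Nat.le_ceil _)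
    have hA1 : 1 ≤ A := hA ▸ one_le_poincareConst (by linarith)
    have h5 : ((graph θ ω).mixingTime (1 / (n : ℝ)) : ℝ≥0∞) ≤ ((⌈4 * A * l⌉₊ : ℕ) : ℝ≥0∞) := by
      have := ENat.toENNReal_le.2 h4
      rwa [ENat.toENNReal_coe] at this
    refine h5.trans ?_
    rw [← ENNReal.ofReal_natCast]
    refine ENNReal.ofReal_le_ofReal ?_
    have h6 : ((⌈4 * A * l⌉₊ : ℕ) : ℝ) ≤ 5 * (A * l) := by
      have e1 := Nat.ceil_lt_add_one (by positivity : 0 ≤ 4 * A * l)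
      have e2 : 1 ≤ A * l := one_le_mul_of_one_le_of_one_le hA1 hl1
      linarith
    -- Relaxation time times `log n`: the exponent of the logarithm becomes `1 - 2 / d`.
    have h7 : (B * n / l) ^ ((2 : ℝ) / d) * l
        = B ^ ((2 : ℝ) / d) * ((n : ℝ) ^ ((2 : ℝ) / d) * l ^ (((d : ℝ) - 2) / d)) := by
      rw [Real.div_rpow (by positivity) hl0.le, Real.mul_rpow hB0.le hn0.le]
      have e1 : l ^ (((d : ℝ) - 2) / d) = l / l ^ ((2 : ℝ) / d) := by
        rw [sub_div, div_self hdpos.ne', Real.rpow_sub hl0, Real.rpow_one]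
      rw [e1]; ring
    calc ((⌈4 * A * l⌉₊ : ℕ) : ℝ) ≤ 5 * (A * l) := h6
      _ ≤ 5 * (C₆ * (4 * (B * n / l) ^ ((2 : ℝ) / d)) * l) := by
          gcongr
          rw [hA]
          exact hconst.trans (by gcongr)
      _ = 20 * C₆ * ((B * n / l) ^ ((2 : ℝ) / d) * l) := by ring
      _ = _ := by rw [h7]; ring
  have hnull : law d ρ n {ω : Config d n | ¬ ∀ x, 0 ≤ (ω x).2} = 0 := ae_law_weight_nonneg ρ n hρ
  calc _ ≤ law d ρ n ({ω : Config d n | ¬ ∀ x, 0 ≤ (ω x).2} ∪ (S₂ ∪ S₃)) := measure_mono hgood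
    _ ≤ law d ρ n {ω : Config d n | ¬ ∀ x, 0 ≤ (ω x).2} + (law d ρ n S₂ + law d ρ n S₃) :=
        (measure_union_le _ _).trans (by gcongr; exact measure_union_le _ _)
    _ = ENNReal.ofReal ((law d ρ n).real S₂ + (law d ρ n).real S₃) := by
        rw [hnull, zero_add, ENNReal.ofReal_add measureReal_nonneg measureReal_nonneg,
          ofReal_measureReal, ofReal_measureReal]
    _ ≤ _ := by
        refine ENNReal.ofReal_le_ofReal ?_
        rw [add_div]
        exact add_le_add hP₂ hP₃

end GTG

theorem theorem2 (d : ℕ) (hd : 2 ≤ d)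
    -- the weight law: an absolutely continuous probability distribution on `[0, ∞)`
    (ρ : Measure ℝ) [IsProbabilityMeasure ρ] (hρ : ρ ≪ volume) (hρ_nonneg : ∀ᵐ w ∂ρ, 0 ≤ w)
    (ν : ℝ) (hν : 0 < ν)
    (htail : (fun x : ℝ => ρ.real (Set.Ici x)) =O[atTop] (fun x : ℝ => 1 / x ^ ((d : ℝ) + ν)))
    (c : ℝ) (hc : 0 < c)
    (hc_le : ENNReal.ofReal c ≤ ENNReal.ofReal (1 / ((d : ℝ) + 3)) *
      min (⨆ α ∈ Set.Ioc (0 : ℝ) (1 / 2), ENNReal.ofReal (α * GTG.quantile ρ α))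
        (⨆ α ∈ Set.Ioo (1 / 2 : ℝ) 1, ENNReal.ofReal ((1 - α) * GTG.quantile ρ α))) :
    ∃ K : ℝ, GTG.Whp (d := d) ρ (fun n =>
      {ω | (GTG.graph (c * (n : ℝ) / Real.log n) ω).Connected →
        ((GTG.graph (c * (n : ℝ) / Real.log n) ω).mixingTime (1 / (n : ℝ)) : ℝ≥0∞) ≤
          ENNReal.ofReal
            (K * ((n : ℝ) ^ ((2 : ℝ) / d) * Real.log n ^ (((d : ℝ) - 2) / d)))}) := by
  have hW : Integrable (fun w : ℝ => w) ρ := by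
    refine integrable_id_of_tail ρ hρ_nonneg ((d : ℝ) + ν) ?_ htail
    have : (2 : ℝ) ≤ d := by exact_mod_cast hd
    linarith
  obtain ⟨m₀, hm₀, hp₀⟩ := exists_pos_measure_Ici ρ hρ hρ_nonneg
  obtain ⟨K, C, X, B, hB, hmain⟩ := GTG.law_compl_le hd ρ hρ_nonneg hW hm₀ hp₀ hc
  refine ⟨K, ?_⟩
  have hlog : Tendsto (fun n : ℕ => Real.log n) atTop atTop :=
    Real.tendsto_log_atTop.comp tendsto_natCast_atTop_atTop
  have hpow : ∀ᶠ n : ℕ in atTop, Real.log n ^ (2 * d + 1) ≤ B * n := by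
    have h1 := (Real.isLittleO_pow_log_id_atTop (n := 2 * d + 1)).bound hB
    have h2 := tendsto_natCast_atTop_atTop (R := ℝ) |>.eventually h1
    filter_upwards [h2] with n hn
    simp only [id, Real.norm_eq_abs, Nat.abs_cast] at hn
    exact (le_abs_self _).trans hn
  have hlim : Tendsto (fun n : ℕ => ENNReal.ofReal (C / n)) atTop (𝓝 0) := by
    have := ENNReal.tendsto_ofReal (tendsto_const_div_atTop_nhds_zero_nat C)
    rwa [ENNReal.ofReal_zero] at this
  refine tendsto_of_tendsto_of_tendsto_of_le_of_le' tendsto_const_nhds hlim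
    (Eventually.of_forall fun _ => zero_le) ?_
  filter_upwards [hlog.eventually_ge_atTop X, hpow, eventually_ge_atTop 2] with n h1 h2 h3
  exact hmain n h3 h1 h2
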